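/- Let $c,D,r,\eta_\infty>0$ and $e(\eta)=\frac{\eta_\infty}{\eta_\infty-\eta}$ for $0\le\eta<\eta_\infty$. On the unit sphere $\mathbb{S}^2$ with spherical coordinates $(\theta,\varphi)$ and surface measure $\sin\theta\,d\theta\,d\varphi$ consider the Cauchy problem $$\left(\frac{e(\eta)}{D}+\frac{e'(\eta)}{c^2e(\eta)}\right)\frac{\partial \widetilde u}{\partial\eta}+\frac1{c^2}\frac{\partial^2\widetilde u}{\partial\eta^2}-\frac1{r^2}\frac{\partial^2\widetilde u}{\partial\theta^2}-\frac{1}{r^2\sin^2\theta}\frac{\partial^2\widetilde u}{\partial\varphi^2}-\frac{\cot\theta}{r^2}\frac{\partial\widetilde u}{\partial\theta}=0,\qquad 0\le\eta<\eta_\infty,$$ $$\widetilde u|_{\eta=0}=\delta,\qquad \frac{\partial\widetilde u}{\partial\eta}\Big|_{\eta=0}=0,$$ where $\delta$ is the Dirac delta at the pole $\mathbf 0$ with coordinates $\theta=0$, $\varphi=0$. A solution is a family $\widetilde u(\eta)$, $0\le\eta<\eta_\infty$, of distributions on $\mathbb{S}^2$ such that $\eta\mapsto\langle\widetilde u(\eta),\psi\rangle$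 is $C^2$ on $[0,\eta_\infty)$ for every $\psi\in C^\infty(\mathbb{S}^2;\mathbb{C})$ (one-sided at $0$), and which satisfies the equation and the initial conditions when paired with every such $\psi$, the angular (Laplace--Beltrami) operator acting on distributions by duality. This problem has a solution, it is unique, and it is given by the series $$\widetilde u(\eta,\theta,\varphi)=\sum_{l=0}^\infty F_l(\eta)\sum_{m=-l}^lY^*_{lm}(\mathbf 0)\,Y_{lm}(\theta,\varphi),$$ which for each $\eta\in[0,\eta_\infty)$ converges in the sense of distributions on $\mathbb{S}^2$. Here $Y_{lm}(\theta,\varphi)=d_{lm}e^{im\varphi}P_l^m(\cos\theta)$, with $d_{lm}=(-1)^m\sqrt{\frac{2l+1}{4\pi}\frac{(l-m)!}{(l+m)!}}$ and $P_l^m$ the associated Legendre functions (with the factor $(-1)^m$), are the orthonormal spherical harmonics, ${}^*$ is complex conjugation, $F_0=1$, and for $l\ge1$ $$F_l(\eta)=(\eta_\infty-\eta)^\nu\Big(K_1^{(l)}J_\nu\big(z_l(\eta_\infty-\eta)\big)+K_2^{(l)}Y_\nu\big(z_l(\eta_\infty-\eta)\big)\Big),$$ $$K_1^{(l)}=\frac{\pi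 z_l\,Y_{\nu-1}(z_l\eta_\infty)}{2\eta_\infty^{\nu-1}},\qquad K_2^{(l)}=-\frac{\pi z_l\,J_{\nu-1}(z_l\eta_\infty)}{2\eta_\infty^{\nu-1}},\qquad z_l=\frac{c\sqrt{l(l+1)}}{r},\qquad \nu=\frac{c^2\eta_\infty}{2D}+1,$$ where $J_\nu$ and $Y_\nu$ are the Bessel functions of the first and second kind. -/

import Mathlib

open Set Filter Topology MeasureTheory Real
open scoped ContDiff Manifold Laplacian ComplexConjugate

noncomputable section

namespace SphDiffusion

/-! ### The sphere, smooth functions on it and the Laplace-Beltrami operator -/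

/-- Euclidean three-space. -/
abbrev E3 : Type := EuclideanSpace ℝ (Fin 3)

/-- The unit sphere in `ℝ³`. -/
abbrev S2 : Type := Metric.sphere (0 : E3) 1

/-- The point of the sphere with spherical coordinates `(θ, φ)`. The pole `θ = 0` is
`(1, 0, 0)`. -/
def sphPoint (θ φ : ℝ) : S2 :=
  ⟨!₂[cos θ, sin θ * cos φ, sin θ * sin φ], by
    rw [mem_sphere_zero_iff_norm, EuclideanSpace.norm_eq, Real.sqrt_eq_one]
    simp only [Fin.sum_univ_three, Real.norm_eq_abs, sq_abs]
    simp
    nlinarith [sin_sq_add_cos_sq θ, sin_sq_add_cos_sq φ]⟩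

/-- Radial projection of a nonzero vector to the unit sphere (with the pole as a
conventional value at the origin). -/
def radial (y : E3) : S2 :=
  if h : y = 0 then sphPoint 0 0
  else ⟨‖y‖⁻¹ • y, by
    rw [mem_sphere_zero_iff_norm, norm_smul, norm_inv, norm_norm,
      inv_mul_cancel₀ (norm_ne_zero_iff.mpr h)]⟩

/-- The extension of a function on the sphere to `ℝ³`, constant along open rays from the
origin. -/
def radialExt (f : S2 → ℂ) : E3 → ℂ := fun y => f (radial y)

/-- The complex-valued smooth functions on the sphere, i.e. the test functions. -/
def TestFun : Submodule ℂ (S2 → ℂ) where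
  carrier := {f | ContMDiff (𝓡 2) 𝓘(ℝ, ℂ) ∞ f}
  add_mem' hf hg := ContMDiff.add hf hg
  zero_mem' := contMDiff_const
  smul_mem' a f hf := by
    have h : ContMDiff (𝓡 2) 𝓘(ℝ, ℂ) ∞ fun x => (fun z : ℂ => a * z) (f x) :=
      (contDiff_const.mul contDiff_id).contMDiff.comp hf
    exact h

lemma radial_of_ne {y : E3} (h : y ≠ 0) : ((radial y : S2) : E3) = ‖y‖⁻¹ • y := by
  simp [radial, h]

lemma radial_coe (x : S2) : radial (x : E3) = x := by
  have hx : ‖(x : E3)‖ = 1 := mem_sphere_zero_iff_norm.mp x.2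
  have h0 : (x : E3) ≠ 0 := by
    intro h
    simp [h] at hx
  ext1
  simp [radial_of_ne h0, hx]

lemma contDiffAt_radialExt {f : S2 → ℂ} (hf : ContMDiff (𝓡 2) 𝓘(ℝ, ℂ) ∞ f) {y : E3}
    (hy : y ≠ 0) : ContDiffAt ℝ ∞ (radialExt f) y := by
  let U : TopologicalSpace.Opens E3 := ⟨{0}ᶜ, isOpen_compl_singleton⟩
  have hN : ContMDiff 𝓘(ℝ, E3) 𝓘(ℝ, E3) ∞ (fun z : U => ‖(z : E3)‖⁻¹ • (z : E3)) := by
    intro z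
    have hz : (z : E3) ≠ 0 := z.2
    have h1 : ContDiffAt ℝ ∞ (fun w : E3 => ‖w‖⁻¹ • w) z :=
      ((contDiffAt_norm ℝ hz).inv (norm_ne_zero_iff.mpr hz)).smul contDiffAt_id
    exact (contMDiffAt_subtype_iff (U := U) (f := fun w : E3 => ‖w‖⁻¹ • w) (x := z)).mpr
      h1.contMDiffAt
  have : Fact (Module.finrank ℝ E3 = 2 + 1) := ⟨by simp⟩
  have hS : ∀ z : U, ‖(z : E3)‖⁻¹ • (z : E3) ∈ Metric.sphere (0 : E3) 1 := by
    intro z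
    have hz : (z : E3) ≠ 0 := z.2
    rw [← radial_of_ne hz]
    exact (radial (z : E3)).2
  have h2 := hf.comp (ContMDiff.codRestrict_sphere (n := 2) hN hS)
  have h3 := (h2 ⟨y, hy⟩)
  have h4 : (f ∘ Set.codRestrict (fun z : U => ‖(z : E3)‖⁻¹ • (z : E3)) _ hS)
      = fun z : U => radialExt f z := by
    funext z
    have hz : (z : E3) ≠ 0 := z.2
    simp only [Function.comp, radialExt]
    congr 1
    ext1
    rw [radial_of_ne hz]
    rfl
  rw [h4] at h3
  exact (contMDiffAt_subtype_iff (U := U) (f := radialExt f) (x := ⟨y, hy⟩)).mp h3 |>.contDiffAt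

lemma contDiffAt_laplacian {g : E3 → ℂ} {y : E3} (hg : ContDiffAt ℝ ∞ g y) :
    ContDiffAt ℝ ∞ (Δ g) y := by
  have h := InnerProductSpace.laplacian_eq_iteratedFDeriv_orthonormalBasis g
    (EuclideanSpace.basisFun (Fin 3) ℝ)
  rw [h]
  refine ContDiffAt.sum fun i _ => ?_
  have h2 : ContDiffAt ℝ ∞ (iteratedFDeriv ℝ 2 g) y := hg.iteratedFDeriv_right (by exact le_rfl)
  exact ((ContinuousMultilinearMap.apply ℝ (fun _ : Fin 2 => E3) ℂ
    ![EuclideanSpace.basisFun (Fin 3) ℝ i, EuclideanSpace.basisFun (Fin 3) ℝ i]).contDiff.contDiffAt.comp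
      y h2)

/-- The Laplace-Beltrami operator of the unit sphere on smooth functions: the Euclidean
Laplacian of the radially constant extension, restricted to the sphere. In spherical coordinates
it is the operator `∂²/∂θ² + cot θ ∂/∂θ + (sin θ)⁻² ∂²/∂φ²`, see `sphLaplacian_apply_sphPoint`. -/
def sphLaplacian (ψ : TestFun) : TestFun :=
  ⟨fun x => Δ (radialExt ψ.1) (x : E3), by
    intro x
    have hx : (x : E3) ≠ 0 := by
      intro h
      have := mem_sphere_zero_iff_norm.mp x.2
      simp [h] at this
    have h1 : ContMDiffAt 𝓘(ℝ, E3) 𝓘(ℝ, ℂ) ∞ (Δ (radialExt ψ.1)) (x : E3) :=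
      (contDiffAt_laplacian (contDiffAt_radialExt ψ.2 hx)).contMDiffAt
    have : Fact (Module.finrank ℝ E3 = 2 + 1) := ⟨by simp⟩
    exact h1.comp x (contMDiff_coe_sphere (n := 2) x)⟩

lemma deriv2_comp_curve {g : E3 → ℂ} {γ γ' : ℝ → E3} {γ'' : E3} {t : ℝ}
    (hg : ContDiffAt ℝ ∞ g (γ t)) (h1 : ∀ s, HasDerivAt γ (γ' s) s)
    (h2 : HasDerivAt γ' γ'' t) :
    deriv (fun s => g (γ s)) t = fderiv ℝ g (γ t) (γ' t) ∧
    deriv (deriv fun s => g (γ s)) t =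
      iteratedFDeriv ℝ 2 g (γ t) ![γ' t, γ' t] + fderiv ℝ g (γ t) γ'' := by
  have hev : ∀ᶠ y in 𝓝 (γ t), DifferentiableAt ℝ g y := by
    have := (hg.of_le (m := 1) (by exact_mod_cast le_top)).eventually (by simp)
    exact this.mono fun y hy => hy.differentiableAt (by simp)
  have hev2 : deriv (fun s => g (γ s)) =ᶠ[𝓝 t] fun s => fderiv ℝ g (γ s) (γ' s) := by
    filter_upwards [(h1 t).continuousAt.eventually hev] with s hs
    exact (hs.hasFDerivAt.comp_hasDerivAt s (h1 s)).deriv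
  refine ⟨hev2.eq_of_nhds, ?_⟩
  rw [hev2.deriv_eq]
  have hd : DifferentiableAt ℝ (fderiv ℝ g) (γ t) :=
    (hg.fderiv_right (m := 1) (by exact WithTop.coe_le_coe.mpr le_top)).differentiableAt (by simp)
  have h3 := (hd.hasFDerivAt.comp_hasDerivAt t (h1 t)).clm_apply h2
  rw [iteratedFDeriv_two_apply]
  simpa using h3.deriv

lemma coe_sphPoint (θ φ : ℝ) : ((sphPoint θ φ : S2) : E3) =
    cos θ • EuclideanSpace.single 0 1 + sin θ • (cos φ • EuclideanSpace.single 1 1 +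
      sin φ • EuclideanSpace.single 2 1) := by
  ext i
  fin_cases i <;> simp [sphPoint]

lemma sphLaplacian_apply_sphPoint (ψ : TestFun) (θ φ : ℝ) (hθ : sin θ ≠ 0) :
    (sphLaplacian ψ).1 (sphPoint θ φ) =
      deriv (deriv fun t => ψ.1 (sphPoint t φ)) θ
      + ((cos θ / sin θ : ℝ) : ℂ) * deriv (fun t => ψ.1 (sphPoint t φ)) θ
      + ((1 / sin θ ^ 2 : ℝ) : ℂ) * deriv (deriv fun t => ψ.1 (sphPoint θ t)) φ := by
  set g := radialExt ψ.1 with hg_def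
  have hψ : ∀ a b, ψ.1 (sphPoint a b) = g ((sphPoint a b : S2) : E3) := by
    intro a b
    simp only [hg_def, radialExt, radial_coe]
  set x : E3 := ((sphPoint θ φ : S2) : E3) with hx
  have hxn : ‖x‖ = 1 := mem_sphere_zero_iff_norm.mp (sphPoint θ φ).2
  have hx0 : x ≠ 0 := by
    intro h
    simp [h] at hxn
  have hg : ContDiffAt ℝ ∞ g x := contDiffAt_radialExt ψ.2 hx0
  set e0 : E3 := EuclideanSpace.single 0 1 with he0
  set e1 : E3 := EuclideanSpace.single 1 1 with he1
  set e2 : E3 := EuclideanSpace.single 2 1 with he2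
  have hX : x = cos θ • e0 + sin θ • (cos φ • e1 + sin φ • e2) := coe_sphPoint θ φ
  have hA := deriv2_comp_curve (g := g) (t := θ)
    (γ := fun s => cos s • e0 + sin s • (cos φ • e1 + sin φ • e2))
    (γ' := fun s => (-sin s) • e0 + cos s • (cos φ • e1 + sin φ • e2))
    (γ'' := (-cos θ) • e0 + (-sin θ) • (cos φ • e1 + sin φ • e2))
    (by simpa [hX] using hg)
    (fun s => ((hasDerivAt_cos s).smul_const _).add ((hasDerivAt_sin s).smul_const _))
    (((hasDerivAt_sin θ).neg.smul_const _).add ((hasDerivAt_cos θ).smul_const _))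
  have hB := deriv2_comp_curve (g := g) (t := φ)
    (γ := fun s => cos θ • e0 + sin θ • (cos s • e1 + sin s • e2))
    (γ' := fun s => sin θ • ((-sin s) • e1 + cos s • e2))
    (γ'' := sin θ • ((-cos φ) • e1 + (-sin φ) • e2))
    (by simpa [hX] using hg)
    (fun s => ((((hasDerivAt_cos s).smul_const e1).add
      ((hasDerivAt_sin s).smul_const e2)).const_smul (sin θ)).const_add _)
    ((((hasDerivAt_sin φ).neg.smul_const e1).add
      ((hasDerivAt_cos φ).smul_const e2)).const_smul (sin θ))
  have hC := deriv2_comp_curve (g := g) (t := 1) (γ := fun s => s • x) (γ' := fun _ => x)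
    (γ'' := 0) (by simpa using hg)
    (fun s => by simpa using (hasDerivAt_id s).smul_const x) (hasDerivAt_const _ _)
  have hC0 : (fun s : ℝ => g (s • x)) =ᶠ[𝓝 1] fun _ => g x := by
    filter_upwards [lt_mem_nhds (zero_lt_one (α := ℝ))] with s hs
    have h1 : radial (s • x) = radial x := by
      ext1
      rw [radial_of_ne hx0, radial_of_ne (smul_ne_zero hs.ne' hx0), norm_smul, hxn,
        Real.norm_of_nonneg hs.le, smul_smul]
      simp [inv_mul_cancel₀ hs.ne']
    simp only [hg_def, radialExt, h1]
  have hC1 : deriv (fun s : ℝ => g (s • x)) =ᶠ[𝓝 1] fun _ => 0 := by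
    simpa using hC0.deriv
  have hD1 : fderiv ℝ g x x = 0 := by
    have := hC.1.symm.trans hC1.eq_of_nhds
    simpa using this
  have hD2 : iteratedFDeriv ℝ 2 g x ![x, x] = 0 := by
    have := hC.2.symm.trans (hC1.deriv_eq)
    simpa using this
  have hlap : (sphLaplacian ψ).1 (sphPoint θ φ) = iteratedFDeriv ℝ 2 g x ![e0, e0]
      + iteratedFDeriv ℝ 2 g x ![e1, e1] + iteratedFDeriv ℝ 2 g x ![e2, e2] := by
    change Δ g x = _
    rw [InnerProductSpace.laplacian_eq_iteratedFDeriv_orthonormalBasis g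
      (EuclideanSpace.basisFun (Fin 3) ℝ)]
    simp [Fin.sum_univ_three, he0, he1, he2]
  have e1' : (fun t => ψ.1 (sphPoint t φ)) =
      fun s => g (cos s • e0 + sin s • (cos φ • e1 + sin φ • e2)) := by
    funext t
    rw [hψ, coe_sphPoint]
  have e2' : (fun t => ψ.1 (sphPoint θ t)) =
      fun s => g (cos θ • e0 + sin θ • (cos s • e1 + sin s • e2)) := by
    funext t
    rw [hψ, coe_sphPoint]
  rw [hlap, e1', e2', hA.1, hA.2, hB.2]
  rw [← hX]
  simp only [iteratedFDeriv_two_apply] at hD2 ⊢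
  set L := fderiv ℝ g x
  set Q := fderiv ℝ (fderiv ℝ g) x
  rw [hX] at hD1 hD2
  simp only [Matrix.cons_val_zero, Matrix.cons_val_one, map_add, map_smul, map_neg, neg_smul,
    add_apply, smul_apply, smul_add,
    neg_apply, Complex.real_smul] at hD1 hD2 ⊢
  have hs : (sin θ : ℂ) ≠ 0 := by exact_mod_cast hθ
  have t1 : (sin θ : ℂ) ^ 2 = 1 - (cos θ : ℂ) ^ 2 := by exact_mod_cast sin_sq θ
  have t2 : (sin φ : ℂ) ^ 2 = 1 - (cos φ : ℂ) ^ 2 := by exact_mod_cast sin_sq φ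
  push_cast at hD1 hD2 hs t1 t2 ⊢
  have hI : (Complex.sin θ)⁻¹ * Complex.sin θ = 1 := inv_mul_cancel₀ hs
  rw [div_eq_mul_inv, one_div, ← inv_pow]
  generalize (Complex.sin θ)⁻¹ = I at *
  generalize Complex.sin θ = S at *
  generalize Complex.cos θ = C at *
  generalize Complex.sin φ = s at *
  generalize Complex.cos φ = k at *
  generalize L e0 = l0 at *
  generalize L e1 = l1 at *
  generalize L e2 = l2 at *
  linear_combination hD2 + 2 * hD1
    - t1 * (Q e0 e0 + k ^ 2 * Q e1 e1 + k * s * (Q e1 e2 + Q e2 e1) + s ^ 2 * Q e2 e2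
      + I * (k * l1 + s * l2))
    - t2 * (Q e1 e1 + Q e2 e2)
    - hI * ((I * S + 1) * (s ^ 2 * Q e1 e1 - s * k * Q e2 e1 - s * k * Q e1 e2 + k ^ 2 * Q e2 e2)
      - C * l0 - S * (k * l1 + s * l2) - I * (k * l1 + s * l2))

/-! ### Distributions on the sphere -/

/-- A linear functional on the smooth functions on the sphere is a distribution when it is
continuous, that is, bounded by a `C^N` norm. The `C^N` norms are computed with the derivatives,
at the points of the sphere, of the radially constant extension. -/
def IsDistribution (T : TestFun →ₗ[ℂ] ℂ) : Prop :=
  ∃ N : ℕ, ∃ K : ℝ, ∀ (ψ : TestFun) (M : ℝ),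
    (∀ k ≤ N, ∀ x : S2, ‖iteratedFDeriv ℝ k (radialExt ψ.1) (x : E3)‖ ≤ M) → ‖T ψ‖ ≤ K * M

/-- The pairing `∫_{S²} f ψ dσ` of a test function `ψ` with a function `f` of the spherical
coordinates, where `dσ = sin θ dθ dφ`. -/
def pairing (f : ℝ → ℝ → ℂ) (ψ : TestFun) : ℂ :=
  ∫ θ in (0 : ℝ)..π, ∫ φ in (0 : ℝ)..(2 * π), f θ φ * ψ.1 (sphPoint θ φ) * (sin θ : ℂ)

/-! ### Spherical harmonics -/

/-- The Legendre polynomial `P_l`, by Rodrigues' formula. -/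
def legendre (l : ℕ) : Polynomial ℝ :=
  Polynomial.C (1 / (2 ^ l * (l.factorial : ℝ))) *
    Polynomial.derivative^[l] ((Polynomial.X ^ 2 - 1) ^ l)

/-- The associated Legendre function
`P_l^m(x) = (-1)^m (1 - x²)^{m/2} (d/dx)^m P_l(x)` of order `m ≥ 0`, for `-1 ≤ x ≤ 1`. -/
def assocLegendreNat (l m : ℕ) (x : ℝ) : ℝ :=
  (-1) ^ m * √(1 - x ^ 2) ^ m * (Polynomial.derivative^[m] (legendre l)).eval x

/-- The associated Legendre function `P_l^m` of order `-l ≤ m ≤ l`; for negative orders,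
`P_l^{-m} = (-1)^m (l - m)! / (l + m)! P_l^m`. -/
def assocLegendre (l : ℕ) : ℤ → ℝ → ℝ
  | Int.ofNat m, x => assocLegendreNat l m x
  | Int.negSucc k, x => (-1) ^ (k + 1) *
      (((l - (k + 1)).factorial : ℝ) / ((l + (k + 1)).factorial : ℝ)) *
        assocLegendreNat l (k + 1) x

/-- The constant `d_{lm} = (-1)^m √((2l+1)/(4π) (l-m)!/(l+m)!)`, for `-l ≤ m ≤ l`. -/
def harmonicConst (l : ℕ) (m : ℤ) : ℝ :=
  (-1) ^ m * √((2 * l + 1) / (4 * π) *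
    (((l - m : ℤ).toNat.factorial : ℝ) / ((l + m : ℤ).toNat.factorial : ℝ)))

/-- The spherical harmonic `Y_{lm}(θ, φ) = d_{lm} e^{imφ} P_l^m(cos θ)`, for `-l ≤ m ≤ l`. -/
def sphHarmonic (l : ℕ) (m : ℤ) (θ φ : ℝ) : ℂ :=
  (harmonicConst l m : ℂ) * Complex.exp (Complex.I * m * φ) * (assocLegendre l m (cos θ) : ℂ)

/-! ### Bessel functions -/

/-- The Bessel function of the first kind `J_ν(x)`. At a pole of the Gamma function `Real.Gamma`
takes the value `0`, so that the corresponding term is `0`, as it should be. -/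
def besselJ (ν x : ℝ) : ℝ :=
  (x / 2) ^ ν * ∑' k : ℕ, (-(x ^ 2) / 4) ^ k / ((k.factorial : ℝ) * Real.Gamma (ν + k + 1))

/-- The quotient defining the Bessel function of the second kind of noninteger order. -/
def besselYAux (ν x : ℝ) : ℝ :=
  (besselJ ν x * cos (ν * π) - besselJ (-ν) x) / sin (ν * π)

open Classical in
/-- The Bessel function of the second kind `Y_ν(x)`; for integer orders it is the limit of the
functions of noninteger orders. -/
def besselY (ν x : ℝ) : ℝ :=
  if ∃ n : ℤ, (n : ℝ) = ν then limUnder (𝓝[≠] ν) fun μ => besselYAux μ x else besselYAux ν x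

/-! ### The Cauchy problem -/

/-- The expansion factor `e(η) = η_∞ / (η_∞ - η)` in the conformal time. -/
def expansion (ηinf η : ℝ) : ℝ := ηinf / (ηinf - η)

/-- The family of distributions `u(η)`, `0 ≤ η < η_∞`, is a solution of
`(e/D + e'/(c² e)) ∂u/∂η + (1/c²) ∂²u/∂η² - (1/r²) Δ_{S²} u = 0`
with `u = δ` (the delta function at the pole `θ = 0`) and `∂u/∂η = 0` at `η = 0`. The solution
is twice continuously differentiable in `η`, and the operator
`Δ_{S²} = ∂²/∂θ² + cot θ ∂/∂θ + (sin θ)⁻² ∂²/∂φ²` acts on distributions by duality. -/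
structure IsSolution (c D r ηinf : ℝ) (u : ℝ → TestFun →ₗ[ℂ] ℂ) : Prop where
  isDistribution : ∀ η ∈ Ico 0 ηinf, IsDistribution (u η)
  contDiffOn : ∀ ψ, ContDiffOn ℝ 2 (fun η => u η ψ) (Ico 0 ηinf)
  equation : ∀ ψ, ∀ η ∈ Ico 0 ηinf,
    ((expansion ηinf η / D + deriv (expansion ηinf) η / (c ^ 2 * expansion ηinf η) : ℝ) : ℂ) *
        derivWithin (fun s => u s ψ) (Ico 0 ηinf) η
      + ((1 / c ^ 2 : ℝ) : ℂ) * iteratedDerivWithin 2 (fun s => u s ψ) (Ico 0 ηinf) η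
      - ((1 / r ^ 2 : ℝ) : ℂ) * u η (sphLaplacian ψ) = 0
  initial : ∀ ψ, u 0 ψ = ψ.1 (sphPoint 0 0)
  initial_deriv : ∀ ψ, derivWithin (fun s => u s ψ) (Ico 0 ηinf) 0 = 0

/-- `z_l = c √(l(l+1)) / r`. -/
def freq (c r : ℝ) (l : ℕ) : ℝ := c * √((l : ℝ) * (l + 1)) / r

/-- `ν = c² η_∞ / (2D) + 1`. -/
def order (c D ηinf : ℝ) : ℝ := c ^ 2 * ηinf / (2 * D) + 1

/-- `K_1^{(l)} = π z_l Y_{ν-1}(z_l η_∞) / (2 η_∞^{ν-1})`. -/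
def coeffJ (c D r ηinf : ℝ) (l : ℕ) : ℝ :=
  π * freq c r l * besselY (order c D ηinf - 1) (freq c r l * ηinf) /
    (2 * ηinf ^ (order c D ηinf - 1))

/-- `K_2^{(l)} = -π z_l J_{ν-1}(z_l η_∞) / (2 η_∞^{ν-1})`. -/
def coeffY (c D r ηinf : ℝ) (l : ℕ) : ℝ :=
  -(π * freq c r l * besselJ (order c D ηinf - 1) (freq c r l * ηinf) /
    (2 * ηinf ^ (order c D ηinf - 1)))

/-- The functions `F_l(η)`. -/
def timeFactor (c D r ηinf : ℝ) (l : ℕ) (η : ℝ) : ℝ :=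
  if l = 0 then 1
  else (ηinf - η) ^ order c D ηinf *
    (coeffJ c D r ηinf l * besselJ (order c D ηinf) (freq c r l * (ηinf - η)) +
      coeffY c D r ηinf l * besselY (order c D ηinf) (freq c r l * (ηinf - η)))

end SphDiffusion

end

noncomputable section

namespace SphDiffusion

/-! ### Bessel functions -/

/-! The problem is solved by separation of variables. Since `P_l^m` vanishes at `1` for `m ≠ 0`,
only `m = 0` contributes to the series, and the pairing of its `l`-th term with a test function is
`F_l` times the zonal coefficient, a Legendre coefficient of the azimuthal mean. Green's identity on
the sphere (`zonalCoeff_sphLaplacian`) turns the Laplace-Beltrami operator into multiplication by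
`-l(l+1)`. The equation then splits into the damped oscillators `F'' + (2ν-1)/(η_∞-η) F' + z_l² F =
0` with `F(0) = 1`, `F'(0) = 0`.

For noninteger order the Bessel expression is shown to solve this by differentiating power series,
with the constants normalized by the Wronskian. For integer order `Y_ν` is only a limit in the
order. The equation is therefore put in integrated form together with bounds from energy decay
(`IsDampedWave`), and these survive pointwise limits.

The bound `|F_l| ≤ 1` and the decay of zonal coefficients, obtained by applying the Laplacian
repeatedly, justify termwise differentiation. At `η = 0` the series is the Legendre series of the
azimuthal mean at `1`. It converges absolutely, and by completeness of the Legendre polynomials its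
sum is the value of the test function at the pole (`hasSum_zonalCoeff`).

For uniqueness, the difference of two solutions is tested on homogeneous polynomials. The spherical
Laplacian of such a polynomial `Q` of degree `n` is `ΔQ - n(n+1)Q`, and `ΔQ` has lower degree, so
induction on the degree and energy decay give zero. Restrictions of polynomials are dense in every
`C^N` norm (`exists_polyFun_near`), so the difference vanishes as a distribution. -/

lemma exists_bound_inv_Gamma (R : ℝ) :
    ∃ M : ℝ, 0 ≤ M ∧ ∀ s : ℂ, ‖s‖ ≤ R → ∀ k : ℕ, ‖(Complex.Gamma (s + k + 1))⁻¹‖ ≤ M := by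
  have hcont : ∀ j : ℕ, ∃ M : ℝ, ∀ s ∈ Metric.closedBall (0 : ℂ) R,
      ‖(Complex.Gamma (s + j + 1))⁻¹‖ ≤ M := fun j =>
    (isCompact_closedBall (0 : ℂ) R).exists_bound_of_continuousOn
      (Complex.differentiable_one_div_Gamma.continuous.comp
        ((continuous_id.add continuous_const).add continuous_const)).continuousOn
  choose M hM using hcont
  set K := ⌈R⌉₊
  have hsum : ∀ j ≤ K, |M j| ≤ ∑ i ∈ Finset.range (K + 1), |M i| := fun j hj =>
    Finset.single_le_sum (f := fun i => |M i|) (fun i _ => abs_nonneg _) (by simp; omega)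
  refine ⟨∑ i ∈ Finset.range (K + 1), |M i|, Finset.sum_nonneg fun i _ => abs_nonneg _, ?_⟩
  intro s hs k
  have hs' : s ∈ Metric.closedBall (0 : ℂ) R := by simpa using hs
  rcases le_total k K with hk | hk
  · exact (hM k s hs').trans ((le_abs_self _).trans (hsum k hk))
  · induction k, hk using Nat.le_induction with
    | base => exact (hM K s hs').trans ((le_abs_self _).trans (hsum K le_rfl))
    | succ k hk ih =>
      refine le_trans ?_ ih
      -- As `1/Γ(w) = w · 1/Γ(w + 1)` with `w = s + k + 1` and `|w| ≥ k + 1 - R ≥ 1`, the norms no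
      -- longer increase once `k ≥ R`. The finitely many earlier `k` are bounded by compactness.
      rw [Complex.one_div_Gamma_eq_self_mul_one_div_Gamma_add_one (s + k + 1), norm_mul]
      push_cast
      rw [← add_assoc s]
      refine le_mul_of_one_le_left (norm_nonneg _) ?_
      have h1 : R ≤ k := (Nat.le_ceil R).trans (by exact_mod_cast hk)
      have h2 : ‖(k + 1 : ℂ)‖ - ‖-s‖ ≤ ‖(k + 1 : ℂ) - -s‖ := norm_sub_norm_le _ _
      have h3 : ‖(k + 1 : ℂ)‖ = k + 1 := by
        rw [← Nat.cast_succ, Complex.norm_natCast, Nat.cast_succ]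
      rw [h3, norm_neg, sub_neg_eq_add] at h2
      rw [show s + k + 1 = (k + 1 : ℂ) + s by ring]
      linarith

/-- No exception at the poles: there `Real.Gamma` is `0`, and its inverse is the value of the entire
function `1/Γ`. Hence the recurrences below hold for every real order. -/
lemma inv_Gamma_eq (s : ℝ) : (Real.Gamma s)⁻¹ = s * (Real.Gamma (s + 1))⁻¹ := by
  have := Complex.one_div_Gamma_eq_self_mul_one_div_Gamma_add_one (s : ℂ)
  rw [show (s : ℂ) + 1 = ((s + 1 : ℝ) : ℂ) by push_cast; rfl, Complex.Gamma_ofReal,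
    Complex.Gamma_ofReal] at this
  exact_mod_cast this

/-- The entire function `∑ (-w)^k / (k! Γ(ν + k + 1))`, so that
`J_ν(x) = (x / 2)^ν besselCore ν (x² / 4)`. -/
def besselCore (ν w : ℝ) : ℝ := ∑' k : ℕ, (-w) ^ k / ((k.factorial : ℝ) * Real.Gamma (ν + k + 1))

lemma besselJ_eq (ν x : ℝ) : besselJ ν x = (x / 2) ^ ν * besselCore ν (x ^ 2 / 4) := by
  simp only [besselJ, besselCore, neg_div]

/-- The terms of the series with a complex order. -/
def besselTerm (w : ℝ) (k : ℕ) (s : ℂ) : ℂ :=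
  ((-w) ^ k / k.factorial : ℝ) * (Complex.Gamma (s + k + 1))⁻¹

lemma besselTerm_ofReal (w : ℝ) (k : ℕ) (ν : ℝ) :
    besselTerm w k ν = (((-w) ^ k / ((k.factorial : ℝ) * Real.Gamma (ν + k + 1)) : ℝ) : ℂ) := by
  rw [besselTerm, show (ν : ℂ) + k + 1 = ((ν + k + 1 : ℝ) : ℂ) by push_cast; rfl,
    Complex.Gamma_ofReal, ← Complex.ofReal_inv, ← Complex.ofReal_mul, ← div_eq_mul_inv, div_div]

lemma norm_besselTerm_le {R M : ℝ} (hM : ∀ s : ℂ, ‖s‖ ≤ R → ∀ k : ℕ,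
    ‖(Complex.Gamma (s + k + 1))⁻¹‖ ≤ M) (w : ℝ) (k : ℕ) {s : ℂ} (hs : ‖s‖ ≤ R) :
    ‖besselTerm w k s‖ ≤ |w| ^ k / k.factorial * M := by
  rw [besselTerm, norm_mul, Complex.norm_real]
  have : ‖(-w) ^ k / (k.factorial : ℝ)‖ = |w| ^ k / k.factorial := by simp
  rw [this]
  exact mul_le_mul_of_nonneg_left (hM s hs k) (by positivity)

/-- The order is complex so that locally uniform convergence of holomorphic terms suffices; no
derivative of `1/Γ` has to be estimated. -/
lemma differentiable_tsum_besselTerm (w : ℝ) :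
    Differentiable ℂ fun s => ∑' k, besselTerm w k s := by
  intro s
  obtain ⟨M, -, hM⟩ := exists_bound_inv_Gamma (‖s‖ + 1)
  have h := Complex.differentiableOn_tsum_of_summable_norm (F := fun k s => besselTerm w k s)
    (U := Metric.ball 0 (‖s‖ + 1)) (u := fun k => |w| ^ k / k.factorial * M)
    ((Real.summable_pow_div_factorial |w|).mul_right M) ?_ Metric.isOpen_ball ?_
  · exact h.differentiableAt (Metric.isOpen_ball.mem_nhds (by simp))
  · intro k
    exact ((Complex.differentiable_one_div_Gamma.comp
      ((differentiable_id.add_const _).add_const _)).const_mul _).differentiableOn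
  · intro k z hz
    exact norm_besselTerm_le hM w k (by simpa using (mem_ball_zero_iff.mp hz).le)

lemma besselCore_ofReal (ν w : ℝ) : (besselCore ν w : ℂ) = ∑' k, besselTerm w k ν := by
  simp only [besselCore, Complex.ofReal_tsum, besselTerm_ofReal]

lemma differentiable_besselCore_order (w : ℝ) : Differentiable ℝ fun ν => besselCore ν w := by
  intro ν
  have h := (differentiable_tsum_besselTerm w (ν : ℂ)).hasDerivAt.real_of_complex
  have h2 : (fun x : ℝ => (∑' k, besselTerm w k (x : ℂ)).re) = fun ν => besselCore ν w := by
    funext x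
    rw [← besselCore_ofReal, Complex.ofReal_re]
  rw [h2] at h
  exact h.differentiableAt

lemma exists_bound_inv_Gamma_real (ν : ℝ) :
    ∃ M : ℝ, 0 ≤ M ∧ ∀ k : ℕ, |(Real.Gamma (ν + k + 1))⁻¹| ≤ M := by
  obtain ⟨M, h0, hM⟩ := exists_bound_inv_Gamma |ν|
  refine ⟨M, h0, fun k => ?_⟩
  have := hM (ν : ℂ) (by simp) k
  rw [show (ν : ℂ) + k + 1 = ((ν + k + 1 : ℝ) : ℂ) by push_cast; rfl,
    Complex.Gamma_ofReal, ← Complex.ofReal_inv, Complex.norm_real] at this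
  exact this

lemma summable_besselCore (ν w : ℝ) :
    Summable fun k : ℕ => (-w) ^ k / ((k.factorial : ℝ) * Real.Gamma (ν + k + 1)) := by
  obtain ⟨M, -, hM⟩ := exists_bound_inv_Gamma_real ν
  refine Summable.of_norm_bounded ((Real.summable_pow_div_factorial |w|).mul_right M) fun k => ?_
  rw [← div_div, div_eq_mul_inv, norm_mul, norm_div, norm_pow, norm_neg]
  simp only [Real.norm_eq_abs, Nat.abs_cast]
  exact mul_le_mul_of_nonneg_left (hM k) (by positivity)

lemma hasDerivAt_besselCore (ν w : ℝ) :
    HasDerivAt (besselCore ν) (-besselCore (ν + 1) w) w := by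
  obtain ⟨M, -, hM⟩ := exists_bound_inv_Gamma_real ν
  have h := hasDerivAt_tsum_of_isPreconnected
    (g := fun (k : ℕ) (x : ℝ) => (-x) ^ k / ((k.factorial : ℝ) * Real.Gamma (ν + k + 1)))
    (g' := fun (k : ℕ) (x : ℝ) => (k : ℝ) * (-x) ^ (k - 1) * (-1) /
      ((k.factorial : ℝ) * Real.Gamma (ν + k + 1)))
    (u := fun k : ℕ => (k : ℝ) * (|w| + 1) ^ (k - 1) / k.factorial * M)
    (t := Metric.ball 0 (|w| + 1)) (y₀ := 0) (y := w) ?_ Metric.isOpen_ball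
    (convex_ball _ _).isPreconnected ?_ ?_ (by simp; positivity) (summable_besselCore ν 0) (by simp)
  · refine h.congr_deriv ?_
    have hs : Summable fun k : ℕ => (k : ℝ) * (-w) ^ (k - 1) * (-1) /
        ((k.factorial : ℝ) * Real.Gamma (ν + k + 1)) := by
      rw [← summable_nat_add_iff 1]
      refine (summable_besselCore (ν + 1) w).neg.congr fun k => ?_
      rw [Nat.factorial_succ]
      push_cast
      rw [show ν + 1 + k + 1 = ν + (k + 1) + 1 by ring, mul_assoc ((k : ℝ) + 1) _ (Gamma _),
        mul_assoc, mul_div_mul_left _ _ (by positivity)]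
      ring
    rw [hs.tsum_eq_zero_add, besselCore, ← tsum_neg]
    simp only [Nat.cast_zero, zero_mul, zero_div, zero_add]
    refine tsum_congr fun k => ?_
    rw [Nat.factorial_succ]
    push_cast
    rw [show ν + 1 + k + 1 = ν + (k + 1) + 1 by ring, mul_assoc ((k : ℝ) + 1) _ (Gamma _),
      mul_assoc, mul_div_mul_left _ _ (by positivity)]
    ring
  · refine Summable.mul_right _ ?_
    rw [← summable_nat_add_iff 1]
    refine (Real.summable_pow_div_factorial (|w| + 1)).congr fun k => ?_
    rw [Nat.factorial_succ]
    push_cast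
    rw [mul_div_mul_left _ _ (by positivity)]
  · intro k y _
    have := ((hasDerivAt_neg y).pow k).div_const ((k.factorial : ℝ) * Real.Gamma (ν + k + 1))
    exact this
  · intro k y hy
    rw [← div_div, div_eq_mul_inv, norm_mul, norm_div, norm_mul, norm_mul, norm_pow, norm_neg]
    simp only [Real.norm_eq_abs, Nat.abs_cast, abs_neg, abs_one, mul_one]
    have hy' : |y| ≤ |w| + 1 := by simpa using (mem_ball_zero_iff.mp hy).le
    have := hM k
    gcongr

/-- In each term `1/Γ(ν + k) = (ν + k)/Γ(ν + k + 1)`. The part with `ν` reproduces the series, and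
in the part with `k` the factorial cancels and the index shifts by one. -/
lemma besselCore_sub_one (ν w : ℝ) :
    besselCore (ν - 1) w = ν * besselCore ν w - w * besselCore (ν + 1) w := by
  have h0 := summable_besselCore ν w
  have h1 := summable_besselCore (ν + 1) w
  have h2 : ∀ k : ℕ, (-w) ^ k / ((k.factorial : ℝ) * Real.Gamma (ν - 1 + k + 1)) =
      ν * ((-w) ^ k / ((k.factorial : ℝ) * Real.Gamma (ν + k + 1))) +
        k * ((-w) ^ k / ((k.factorial : ℝ) * Real.Gamma (ν + k + 1))) := by
    intro k
    have := inv_Gamma_eq (ν + k)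
    rw [show ν - 1 + k + 1 = ν + k by ring, ← div_div, ← div_div, div_eq_mul_inv _ (Gamma _), this]
    ring
  have h3 : Summable fun k : ℕ => (k : ℝ) * ((-w) ^ k / ((k.factorial : ℝ) *
      Real.Gamma (ν + k + 1))) := by
    refine ((summable_besselCore (ν - 1) w).sub (h0.mul_left ν)).congr fun k => ?_
    rw [h2 k]
    ring
  simp only [besselCore]
  rw [tsum_congr h2, (h0.mul_left ν).tsum_add h3, tsum_mul_left, h3.tsum_eq_zero_add,
    ← tsum_mul_left (a := w), sub_eq_add_neg, ← tsum_neg]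
  simp only [Nat.cast_zero, zero_mul, zero_add]
  congr 1
  refine tsum_congr fun k => ?_
  rw [Nat.factorial_succ]
  push_cast
  rw [show ν + 1 + k + 1 = ν + (k + 1) + 1 by ring, mul_assoc ((k : ℝ) + 1) _ (Gamma _),
    mul_div_assoc', mul_div_mul_left _ _ (by positivity)]
  ring

/-- The recurrence has three terms, so two consecutive orders are carried through the induction. It
is used at `-(n+1)` and at `n+1`. -/
lemma besselCore_neg_nat (n : ℕ) (w : ℝ) :
    besselCore (-n) w = (-w) ^ n * besselCore n w := by
  suffices h : besselCore (-n) w = (-w) ^ n * besselCore n w ∧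
      besselCore (-(n + 1 : ℕ)) w = (-w) ^ (n + 1) * besselCore (n + 1 : ℕ) w from h.1
  induction n with
  | zero =>
    refine ⟨by simp, ?_⟩
    have := besselCore_sub_one 0 w
    simp only [zero_sub, zero_mul, zero_add] at this
    simp [this]
  | succ n ih =>
    refine ⟨ih.2, ?_⟩
    have h1 := besselCore_sub_one (-(n + 1 : ℕ)) w
    have h2 := besselCore_sub_one (n + 1 : ℕ) w
    rw [show (-((n + 1 : ℕ) : ℝ) - 1) = -((n + 1 + 1 : ℕ) : ℝ) by push_cast; ring,
      show (-((n + 1 : ℕ) : ℝ) + 1) = -(n : ℝ) by push_cast; ring] at h1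
    rw [show (((n + 1 : ℕ) : ℝ) - 1) = (n : ℝ) by push_cast; ring,
      show (((n + 1 : ℕ) : ℝ) + 1) = ((n + 1 + 1 : ℕ) : ℝ) by push_cast; ring] at h2
    rw [h1, ih.1, ih.2, h2]
    push_cast
    ring

lemma differentiableAt_besselJ_order {x : ℝ} (hx : 0 < x) (ν : ℝ) :
    DifferentiableAt ℝ (fun μ => besselJ μ x) ν := by
  simp only [besselJ_eq]
  exact ((hasStrictDerivAt_const_rpow (half_pos hx) ν).hasDerivAt.differentiableAt).mul
    (differentiable_besselCore_order _ ν)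

lemma besselJ_neg_nat {x : ℝ} (hx : 0 < x) (n : ℕ) :
    besselJ (-n) x = (-1) ^ n * besselJ n x := by
  rw [besselJ_eq, besselJ_eq, besselCore_neg_nat, rpow_neg (half_pos hx).le, rpow_natCast,
    show -(x ^ 2 / 4) = (-1) * ((x / 2) * (x / 2)) by ring, mul_pow, mul_pow]
  field_simp

/-- Numerator and denominator both vanish at `n` because `J_{-n} = (-1)^n J_n`. The quotient is thus
a quotient of slopes in the order, and the slope of `sin(μπ)` tends to `π cos(nπ) ≠ 0`. -/
lemma exists_tendsto_besselYAux {x : ℝ} (hx : 0 < x) (n : ℕ) :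
    ∃ L, Tendsto (fun μ => besselYAux μ x) (𝓝[≠] (n : ℝ)) (𝓝 L) := by
  have hsin : HasDerivAt (fun μ : ℝ => sin (μ * π)) (cos (n * π) * π) n := by
    exact ((hasDerivAt_sin (n * π)).comp (n : ℝ) ((hasDerivAt_id (n : ℝ)).mul_const π)).congr_deriv
      (by rw [one_mul])
  have hnum : DifferentiableAt ℝ (fun μ : ℝ => besselJ μ x * cos (μ * π) - besselJ (-μ) x) n := by
    refine ((differentiableAt_besselJ_order hx _).mul (by fun_prop)).sub ?_
    exact (differentiableAt_besselJ_order hx (-(n : ℝ))).comp (n : ℝ)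
      (differentiable_neg.differentiableAt)
  have hcos : cos (n * π) * π ≠ 0 := by
    rw [Real.cos_nat_mul_pi]
    have := pi_ne_zero
    positivity
  have h1 := hasDerivAt_iff_tendsto_slope.mp hnum.hasDerivAt
  have h2 := hasDerivAt_iff_tendsto_slope.mp hsin
  refine ⟨_, (h1.div h2 hcos).congr' ?_⟩
  filter_upwards [self_mem_nhdsWithin] with μ hμ
  have hμ' : μ - n ≠ 0 := sub_ne_zero.mpr hμ
  simp only [Pi.div_apply, slope_def_field, besselYAux]
  rw [Real.sin_nat_mul_pi, Real.cos_nat_mul_pi, besselJ_neg_nat hx, mul_comm (besselJ n x),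
    sub_self, sub_zero, sub_zero, div_div_div_cancel_right₀ hμ']

lemma tendsto_besselY {x : ℝ} (hx : 0 < x) (n : ℕ) :
    Tendsto (fun μ => besselYAux μ x) (𝓝[≠] (n : ℝ)) (𝓝 (besselY n x)) := by
  have h : ∃ k : ℤ, (k : ℝ) = n := ⟨n, by simp⟩
  rw [besselY, if_pos h]
  exact tendsto_nhds_limUnder (exists_tendsto_besselYAux hx n)

lemma sin_mul_pi_ne_zero {ν : ℝ} (h : ¬ ∃ n : ℤ, (n : ℝ) = ν) : sin (ν * π) ≠ 0 := by
  intro h0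
  obtain ⟨n, hn⟩ := Real.sin_eq_zero_iff.mp h0
  exact h ⟨n, mul_right_cancel₀ pi_ne_zero hn⟩

/-- The Wronskian relation, in terms of the functions `besselCore`. -/
lemma besselCore_wronskian (ν w : ℝ) :
    besselCore (ν - 1) w * besselCore (-ν) w + w * (besselCore ν w * besselCore (1 - ν) w) =
      sin (ν * π) / π := by
  set f : ℝ → ℝ := fun w => besselCore (ν - 1) w * besselCore (-ν) w +
    w * (besselCore ν w * besselCore (1 - ν) w) with hf
  -- The derivatives raise the order by one and the two contiguous relations lower it again, after
  -- which everything cancels.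
  have hd : ∀ x, HasDerivAt f 0 x := by
    intro x
    have h1 := hasDerivAt_besselCore (ν - 1) x
    have h2 := hasDerivAt_besselCore (-ν) x
    have h3 := hasDerivAt_besselCore ν x
    have h4 := hasDerivAt_besselCore (1 - ν) x
    refine ((h1.mul h2).add ((hasDerivAt_id x).mul (h3.mul h4))).congr_deriv ?_
    have e1 := besselCore_sub_one ν x
    have e2 := besselCore_sub_one (1 - ν) x
    rw [show 1 - ν - 1 = -ν by ring] at e2
    rw [show ν - 1 + 1 = ν by ring, show -ν + 1 = 1 - ν by ring, e1, e2]
    simp only [id, Pi.mul_apply]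
    ring
  have hconst := is_const_of_deriv_eq_zero (fun x => (hd x).differentiableAt)
    (fun x => (hd x).deriv) w 0
  have h0 : ∀ μ : ℝ, besselCore μ 0 = (Real.Gamma (μ + 1))⁻¹ := by
    intro μ
    rw [besselCore, tsum_eq_single 0]
    · simp
    · intro k hk
      simp [hk]
  -- At `w = 0` only `1/(Γ(ν) Γ(1-ν))` remains, which the reflection formula evaluates.
  have : f w = sin (ν * π) / π := by
    rw [hconst]
    simp only [hf, h0, zero_mul, add_zero]
    rw [show ν - 1 + 1 = ν by ring, show -ν + 1 = 1 - ν by ring, ← mul_inv,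
      Real.Gamma_mul_Gamma_one_sub, inv_div, mul_comm]
  exact this

/-! ### The time factors -/

/-- The energy has derivative `-2 p ‖y₁‖² ≤ 0`. A general `V` covers both the real time factors and
the complex pairings in the uniqueness proof. -/
lemma energy_le {V : Type*} [NormedAddCommGroup V] [InnerProductSpace ℝ V] {H lam : ℝ}
    {y y₁ : ℝ → V} {p : ℝ → ℝ} (hp : ∀ t ∈ Ico 0 H, 0 ≤ p t)
    (h1 : ∀ t ∈ Ico 0 H, HasDerivWithinAt y (y₁ t) (Ico 0 H) t)
    (h2 : ∀ t ∈ Ico 0 H, HasDerivWithinAt y₁ (-(p t) • y₁ t - lam • y t) (Ico 0 H) t)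
    {t : ℝ} (ht : t ∈ Ico 0 H) :
    ‖y₁ t‖ ^ 2 + lam * ‖y t‖ ^ 2 ≤ ‖y₁ 0‖ ^ 2 + lam * ‖y 0‖ ^ 2 := by
  have hd : ∀ s ∈ Ico 0 H, HasDerivWithinAt (fun s => ‖y₁ s‖ ^ 2 + lam * ‖y s‖ ^ 2)
      (-(2 * p s * ‖y₁ s‖ ^ 2)) (Ico 0 H) s := by
    intro s hs
    refine ((h2 s hs).norm_sq.add ((h1 s hs).norm_sq.const_mul lam)).congr_deriv ?_
    rw [inner_sub_right, inner_smul_right, inner_smul_right, real_inner_self_eq_norm_sq,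
      real_inner_comm (y s)]
    ring
  have hanti : AntitoneOn (fun s => ‖y₁ s‖ ^ 2 + lam * ‖y s‖ ^ 2) (Ico 0 H) := by
    refine antitoneOn_of_deriv_nonpos (convex_Ico 0 H) (fun s hs => (hd s hs).continuousWithinAt)
      ?_ ?_
    · intro s hs
      exact ((hd s (interior_subset hs)).mono interior_subset).differentiableWithinAt
    · intro s hs
      rw [((hd s (interior_subset hs)).hasDerivAt (mem_interior_iff_mem_nhds.mp hs)).deriv]
      have := hp s (interior_subset hs)
      have : 0 ≤ 2 * p s * ‖y₁ s‖ ^ 2 := by positivity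
      linarith
  exact hanti ⟨le_rfl, ht.1.trans_lt ht.2⟩ ht ht.1

/-- The integrated form of `F'' + (2μ - 1)/(H - η) F' + z² F = 0`, `F(0) = 1`, `F'(0) = 0`, with
the a priori bounds that its solutions satisfy. -/
structure IsDampedWave (z H μ : ℝ) (F : ℝ → ℝ) : Prop where
  abs_le : ∀ t ∈ Ico 0 H, |F t| ≤ 1
  lipschitz : ∀ s ∈ Ico 0 H, ∀ t ∈ Ico 0 H, |F s - F t| ≤ z * |s - t|
  eq_integral : ∀ t ∈ Ico 0 H, F t = 1 + ∫ τ in (0 : ℝ)..t,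
    -(z ^ 2 * ((H - τ) ^ (2 * μ - 1) * ∫ s in (0 : ℝ)..τ, (H - s) ^ (-(2 * μ - 1)) * F s))

lemma IsDampedWave.continuousOn {z H μ : ℝ} {F : ℝ → ℝ} (h : IsDampedWave z H μ F) :
    ContinuousOn F (Ico 0 H) := by
  intro s hs
  refine tendsto_iff_dist_tendsto_zero.mpr ?_
  refine squeeze_zero' (g := fun t => z * |t - s|) (Eventually.of_forall fun t => dist_nonneg) ?_ ?_
  · filter_upwards [self_mem_nhdsWithin] with t ht
    rw [Real.dist_eq]
    exact h.lipschitz t ht s hs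
  · have : Continuous fun t : ℝ => z * |t - s| := by fun_prop
    simpa using (this.tendsto s).mono_left nhdsWithin_le_nhds

lemma continuousOn_sub_rpow (H q : ℝ) : ContinuousOn (fun s : ℝ => (H - s) ^ q) (Iio H) :=
  (continuousOn_const.sub continuousOn_id).rpow_const fun _ hs =>
    Or.inl (sub_pos.mpr (mem_Iio.mp hs)).ne'

lemma hasDerivAt_sub_rpow {H η : ℝ} (hη : η < H) (q : ℝ) :
    HasDerivAt (fun s : ℝ => (H - s) ^ q) (-(q * (H - η) ^ (q - 1))) η := by
  refine (((hasDerivAt_id η).const_sub H).rpow_const (p := q)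
    (Or.inl (sub_pos.mpr hη).ne')).congr_deriv ?_
  simp only [id]
  ring

lemma uIcc_subset_Ico {H t : ℝ} (ht : t ∈ Ico 0 H) : uIcc 0 t ⊆ Ico 0 H := by
  rw [uIcc_of_le ht.1]
  exact fun s hs => ⟨hs.1, hs.2.trans_lt ht.2⟩

lemma continuousOn_inner_integrand {H μ : ℝ} {F : ℝ → ℝ} (hF : ContinuousOn F (Ico 0 H)) :
    ContinuousOn (fun s => (H - s) ^ (-(2 * μ - 1)) * F s) (Ico 0 H) :=
  ((continuousOn_sub_rpow H _).mono fun _ hs => hs.2).mul hF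

lemma continuousOn_outer_integrand {z H μ : ℝ} {F : ℝ → ℝ} (hF : ContinuousOn F (Ico 0 H)) {t : ℝ}
    (ht : t ∈ Ico 0 H) :
    ContinuousOn (fun τ => -(z ^ 2 * ((H - τ) ^ (2 * μ - 1) *
      ∫ s in (0 : ℝ)..τ, (H - s) ^ (-(2 * μ - 1)) * F s))) (uIcc 0 t) := by
  have h1 : ContinuousOn (fun s => (H - s) ^ (-(2 * μ - 1)) * F s) (uIcc 0 t) :=
    (continuousOn_inner_integrand hF).mono (uIcc_subset_Ico ht)
  have h2 := intervalIntegral.continuousOn_primitive_interval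
    (h1.integrableOn_compact isCompact_uIcc (μ := volume))
  have h3 : ContinuousOn (fun s : ℝ => (H - s) ^ (2 * μ - 1)) (uIcc 0 t) :=
    (continuousOn_sub_rpow H _).mono fun s hs => (uIcc_subset_Ico ht hs).2
  exact ((h3.mul h2).const_mul _).neg

/-- Energy decay gives `F₁² + z² F² ≤ z²`, which contains both a priori bounds. The integrating
factor `(H - s)^(-(2μ-1))` turns the equation into `((H - s)^(-(2μ-1)) F₁)' = -z² (H - s)^(-(2μ-1))
F`, and two integrations give the integral equation. -/
lemma IsDampedWave.of_hasDerivAt {z H μ : ℝ} (hz : 0 < z) (hμ : 0 ≤ 2 * μ - 1)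
    {F F₁ : ℝ → ℝ} (h1 : ∀ t < H, HasDerivAt F (F₁ t) t)
    (h2 : ∀ t < H, HasDerivAt F₁ (-((2 * μ - 1) / (H - t)) * F₁ t - z ^ 2 * F t) t)
    (hF0 : F 0 = 1) (hF₁ : F₁ 0 = 0) : IsDampedWave z H μ F := by
  have hE : ∀ t ∈ Ico 0 H, F₁ t ^ 2 + z ^ 2 * F t ^ 2 ≤ z ^ 2 := by
    intro t ht
    have := energy_le (y := F) (y₁ := F₁) (p := fun t => (2 * μ - 1) / (H - t)) (lam := z ^ 2)
      (fun s hs => div_nonneg hμ (sub_pos.mpr hs.2).le)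
      (fun s hs => (h1 s hs.2).hasDerivWithinAt)
      (fun s hs => by simpa using (h2 s hs.2).hasDerivWithinAt) ht
    simpa [hF0, hF₁] using this
  have hF₁le : ∀ t ∈ Ico 0 H, |F₁ t| ≤ z := fun t ht => abs_le_of_sq_le_sq
    (by nlinarith [hE t ht, mul_nonneg (sq_nonneg z) (sq_nonneg (F t))]) hz.le
  have hc : ContinuousOn F (Iio H) := fun t ht => (h1 t ht).continuousAt.continuousWithinAt
  have hc1 : ContinuousOn F₁ (Iio H) := fun t ht => (h2 t ht).continuousAt.continuousWithinAt
  have hint : ∀ τ ∈ Ico 0 H, F₁ τ = -(z ^ 2 * ((H - τ) ^ (2 * μ - 1) *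
      ∫ s in (0 : ℝ)..τ, (H - s) ^ (-(2 * μ - 1)) * F s)) := by
    intro τ hτ
    have hd : ∀ s ∈ uIcc 0 τ, HasDerivAt (fun s => (H - s) ^ (-(2 * μ - 1)) * F₁ s)
        (-z ^ 2 * ((H - s) ^ (-(2 * μ - 1)) * F s)) s := by
      intro s hs
      have hs' := (uIcc_subset_Ico hτ hs).2
      have hs0 : H - s ≠ 0 := (sub_pos.mpr hs').ne'
      refine ((hasDerivAt_sub_rpow hs' _).mul (h2 s hs')).congr_deriv ?_
      rw [rpow_sub_one hs0]
      field_simp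
      ring
    have hI := intervalIntegral.integral_eq_sub_of_hasDerivAt hd
      ((((continuousOn_inner_integrand (hc.mono fun _ h => h.2)).mono
        (uIcc_subset_Ico hτ)).const_mul _).intervalIntegrable)
    rw [intervalIntegral.integral_const_mul, hF₁, mul_zero, sub_zero] at hI
    have hpow : (H - τ) ^ (2 * μ - 1) * (H - τ) ^ (-(2 * μ - 1)) = 1 := by
      rw [← rpow_add (sub_pos.mpr hτ.2), add_neg_cancel, rpow_zero]
    linear_combination (-(F₁ τ)) * hpow - (H - τ) ^ (2 * μ - 1) * hI
  refine ⟨?_, ?_, ?_⟩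
  · intro t ht
    refine abs_le_of_sq_le_sq ?_ zero_le_one
    have := hE t ht
    have h3 : z ^ 2 * F t ^ 2 ≤ z ^ 2 * 1 := by nlinarith [sq_nonneg (F₁ t)]
    simpa using le_of_mul_le_mul_left h3 (by positivity)
  · intro s hs t ht
    have := (convex_Ico (0 : ℝ) H).norm_image_sub_le_of_norm_hasDerivWithin_le (f := F) (f' := F₁)
      (C := z) (fun x hx => (h1 x hx.2).hasDerivWithinAt) hF₁le ht hs
    simpa [Real.norm_eq_abs] using this
  · intro t ht
    have hI := intervalIntegral.integral_eq_sub_of_hasDerivAt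
      (fun s hs => h1 s (uIcc_subset_Ico ht hs).2)
      ((hc1.mono fun s hs => (uIcc_subset_Ico ht hs).2).intervalIntegrable)
    rw [← intervalIntegral.integral_congr fun s hs => hint s (uIcc_subset_Ico ht hs), hI, hF0]
    ring

/-- Supplies the dominating constants, uniform in the order near `n`, for the limit below; it is
used with `a = 1` and `a = -1`. -/
lemma exists_bound_sub_rpow (H n t : ℝ) (ht : t < H) (a : ℝ) :
    ∃ B, 0 ≤ B ∧ ∀ μ ∈ Icc (n - 1) (n + 1), ∀ s ∈ Icc 0 t, |(H - s) ^ (a * (2 * μ - 1))| ≤ B := by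
  have hcont : ContinuousOn (fun p : ℝ × ℝ => (H - p.2) ^ (a * (2 * p.1 - 1)))
      (Icc (n - 1) (n + 1) ×ˢ Icc 0 t) := by
    refine ContinuousOn.rpow (by fun_prop) (by fun_prop) ?_
    rintro ⟨μ, s⟩ ⟨-, hs⟩
    exact Or.inl (sub_pos.mpr (hs.2.trans_lt ht)).ne'
  obtain ⟨B, hB⟩ := (isCompact_Icc.prod isCompact_Icc).exists_bound_of_continuousOn hcont
  refine ⟨|B|, abs_nonneg _, fun μ hμ s hs => (hB (μ, s) ⟨hμ, hs⟩).trans (le_abs_self _)⟩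

lemma tendsto_sub_rpow {H s : ℝ} (hs : s < H) (n a : ℝ) :
    Tendsto (fun μ : ℝ => (H - s) ^ (a * (2 * μ - 1))) (𝓝[≠] n) (𝓝 ((H - s) ^ (a * (2 * n - 1)))) := by
  have : Continuous fun μ : ℝ => (H - s) ^ (a * (2 * μ - 1)) :=
    Continuous.rpow continuous_const (by fun_prop) fun _ => Or.inl (sub_pos.mpr hs).ne'
  exact (this.tendsto n).mono_left nhdsWithin_le_nhds

/-- The integrated form involves values of `F` only, so pointwise convergence is enough and nothing
is needed about derivatives. The bound `|F| ≤ 1`, uniform in the order, dominates both the inner and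
the outer integral. -/
lemma IsDampedWave.of_tendsto {z H n : ℝ} {F : ℝ → ℝ} {Fμ : ℝ → ℝ → ℝ}
    (h : ∀ᶠ μ in 𝓝[≠] n, IsDampedWave z H μ (Fμ μ))
    (hlim : ∀ t ∈ Ico 0 H, Tendsto (fun μ => Fμ μ t) (𝓝[≠] n) (𝓝 (F t))) :
    IsDampedWave z H n F := by
  have hnear : ∀ᶠ μ in 𝓝[≠] n, μ ∈ Icc (n - 1) (n + 1) :=
    nhdsWithin_le_nhds (Icc_mem_nhds (by linarith) (by linarith))
  refine ⟨?_, ?_, ?_⟩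
  · intro t ht
    exact le_of_tendsto (hlim t ht).abs (h.mono fun μ hμ => hμ.abs_le t ht)
  · intro s hs t ht
    exact le_of_tendsto ((hlim s hs).sub (hlim t ht)).abs (h.mono fun μ hμ => hμ.lipschitz s hs t ht)
  · intro t ht
    obtain ⟨B, hB0, hB⟩ := exists_bound_sub_rpow H n t ht.2 1
    obtain ⟨B', hB'0, hB'⟩ := exists_bound_sub_rpow H n t ht.2 (-1)
    have hinner_le : ∀ᶠ μ in 𝓝[≠] n, ∀ s ∈ Icc 0 t, ‖(H - s) ^ (-(2 * μ - 1)) * Fμ μ s‖ ≤ B' := by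
      filter_upwards [h, hnear] with μ hμ hμn s hs
      have h1 := hB' μ hμn s hs
      rw [neg_one_mul] at h1
      rw [Real.norm_eq_abs, abs_mul]
      calc _ ≤ B' * 1 := mul_le_mul h1 (hμ.abs_le s ⟨hs.1, hs.2.trans_lt ht.2⟩) (abs_nonneg _) hB'0
        _ = B' := mul_one _
    have hinner : ∀ τ ∈ Icc 0 t, Tendsto (fun μ => ∫ s in (0 : ℝ)..τ, (H - s) ^ (-(2 * μ - 1)) *
        Fμ μ s) (𝓝[≠] n) (𝓝 (∫ s in (0 : ℝ)..τ, (H - s) ^ (-(2 * n - 1)) * F s)) := by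
      intro τ hτ
      have hτH : τ ∈ Ico 0 H := ⟨hτ.1, hτ.2.trans_lt ht.2⟩
      have hsub : uIoc 0 τ ⊆ Icc 0 t := by
        rw [uIoc_of_le hτ.1]
        exact fun s hs => ⟨hs.1.le, hs.2.trans hτ.2⟩
      refine intervalIntegral.tendsto_integral_filter_of_dominated_convergence (fun _ => B') ?_ ?_
        (by simp) ?_
      · filter_upwards [h] with μ hμ
        exact (((continuousOn_inner_integrand hμ.continuousOn).mono
          (uIcc_subset_Ico hτH)).intervalIntegrable).def'.aestronglyMeasurable
      · filter_upwards [hinner_le] with μ hμ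
        exact Eventually.of_forall fun s hs => hμ s (hsub hs)
      · refine Eventually.of_forall fun s hs => ?_
        have hs' := hsub hs
        have h3 := tendsto_sub_rpow (H := H) (hs'.2.trans_lt ht.2) n (-1)
        simp only [neg_one_mul] at h3
        exact h3.mul (hlim s ⟨hs'.1, hs'.2.trans_lt ht.2⟩)
    have houter : Tendsto (fun μ => 1 + ∫ τ in (0 : ℝ)..t, -(z ^ 2 * ((H - τ) ^ (2 * μ - 1) *
        ∫ s in (0 : ℝ)..τ, (H - s) ^ (-(2 * μ - 1)) * Fμ μ s))) (𝓝[≠] n)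
        (𝓝 (1 + ∫ τ in (0 : ℝ)..t, -(z ^ 2 * ((H - τ) ^ (2 * n - 1) *
          ∫ s in (0 : ℝ)..τ, (H - s) ^ (-(2 * n - 1)) * F s)))) := by
      refine Tendsto.const_add 1 ?_
      have hsub : uIoc 0 t ⊆ Icc 0 t := by
        rw [uIoc_of_le ht.1]
        exact Ioc_subset_Icc_self
      refine intervalIntegral.tendsto_integral_filter_of_dominated_convergence
        (fun _ => z ^ 2 * (B * (B' * t))) ?_ ?_ (by simp) ?_
      · filter_upwards [h] with μ hμ
        exact ((continuousOn_outer_integrand hμ.continuousOn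
          ht).intervalIntegrable).def'.aestronglyMeasurable
      · filter_upwards [hinner_le, hnear] with μ hμ hμn
        refine Eventually.of_forall fun τ hτ => ?_
        have hτ' := hsub hτ
        have h1 := hB μ hμn τ hτ'
        rw [one_mul] at h1
        have h2 : ‖∫ s in (0 : ℝ)..τ, (H - s) ^ (-(2 * μ - 1)) * Fμ μ s‖ ≤ B' * |τ - 0| := by
          refine intervalIntegral.norm_integral_le_of_norm_le_const fun s hs => hμ s ?_
          rw [uIoc_of_le hτ'.1] at hs
          exact ⟨hs.1.le, hs.2.trans hτ'.2⟩
        rw [sub_zero, abs_of_nonneg hτ'.1] at h2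
        have h3 : B' * τ ≤ B' * t := mul_le_mul_of_nonneg_left hτ'.2 hB'0
        rw [norm_neg, norm_mul, norm_mul, Real.norm_of_nonneg (sq_nonneg z)]
        exact mul_le_mul_of_nonneg_left (mul_le_mul h1 (h2.trans h3) (norm_nonneg _) hB0)
          (sq_nonneg z)
      · refine Eventually.of_forall fun τ hτ => ?_
        have hτ' := hsub hτ
        have h3 := tendsto_sub_rpow (H := H) (hτ'.2.trans_lt ht.2) n 1
        simp only [one_mul] at h3
        exact ((h3.mul (hinner τ hτ')).const_mul (z ^ 2)).neg
    exact tendsto_nhds_unique ((hlim t ht).congr' (h.mono fun μ hμ => hμ.eq_integral t ht)) houter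

/-- The time factor written with the noninteger-order formula for the Bessel functions of the
second kind. -/
def waveAux (z H μ η : ℝ) : ℝ :=
  (H - η) ^ μ *
    (π * z * besselYAux (μ - 1) (z * H) / (2 * H ^ (μ - 1)) * besselJ μ (z * (H - η)) +
      -(π * z * besselJ (μ - 1) (z * H) / (2 * H ^ (μ - 1))) * besselYAux μ (z * (H - η)))

lemma hasDerivAt_besselCore_comp (z H μ η : ℝ) :
    HasDerivAt (fun s => besselCore μ (z ^ 2 * (H - s) ^ 2 / 4))
      (z ^ 2 * (H - η) / 2 * besselCore (μ + 1) (z ^ 2 * (H - η) ^ 2 / 4)) η := by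
  have h := (hasDerivAt_besselCore μ (z ^ 2 * (H - η) ^ 2 / 4)).comp η
    (((((hasDerivAt_id η).const_sub H).pow 2).const_mul (z ^ 2)).div_const 4)
  refine h.congr_deriv ?_
  simp only [id]
  push_cast
  ring

/-- Shifting the order by one changes the sign of both `cos(μπ)` and `sin(μπ)`, so the products
`J_{μ-1} J_μ cos(μπ)` cancel and only `J_{1-μ} J_μ + J_{μ-1} J_{-μ}` remains. Through `besselCore`
the only singular factor left is a power of `H - η`. -/
lemma waveAux_eq {z H μ : ℝ} (hz : 0 < z) (hH : 0 < H) (hμ : ¬ ∃ n : ℤ, (n : ℝ) = μ) {η : ℝ}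
    (hη : η < H) :
    waveAux z H μ η = π * z / (2 * H ^ (μ - 1) * sin (μ * π)) *
      (besselJ (1 - μ) (z * H) * (z / 2) ^ μ *
          ((H - η) ^ (2 * μ) * besselCore μ (z ^ 2 * (H - η) ^ 2 / 4)) +
        besselJ (μ - 1) (z * H) * (z / 2) ^ (-μ) * besselCore (-μ) (z ^ 2 * (H - η) ^ 2 / 4)) := by
  have hs : 0 < H - η := sub_pos.mpr hη
  have hsin := sin_mul_pi_ne_zero hμ
  have h1 : sin ((μ - 1) * π) = -sin (μ * π) := by rw [sub_one_mul, sin_sub_pi]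
  have h2 : cos ((μ - 1) * π) = -cos (μ * π) := by rw [sub_one_mul, cos_sub_pi]
  have e : z * (H - η) / 2 = z / 2 * (H - η) := by ring
  have e2 : (z * (H - η)) ^ 2 / 4 = z ^ 2 * (H - η) ^ 2 / 4 := by ring
  have hHp : H ^ (μ - 1) ≠ 0 := (rpow_pos_of_pos hH _).ne'
  rw [waveAux, besselYAux, besselYAux, h1, h2, besselJ_eq μ (z * (H - η)),
    besselJ_eq (-μ) (z * (H - η)), e, e2, mul_rpow (half_pos hz).le hs.le,
    mul_rpow (half_pos hz).le hs.le, show 2 * μ = μ + μ by ring, rpow_add hs,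
    rpow_neg hs.le μ, show -(μ - 1) = 1 - μ by ring]
  have hsp : (H - η) ^ μ ≠ 0 := (rpow_pos_of_pos hs _).ne'
  field_simp
  ring

lemma isDampedWave_waveAux {z H μ : ℝ} (hz : 0 < z) (hH : 0 < H) (hμ : ¬ ∃ n : ℤ, (n : ℝ) = μ)
    (hμ' : 0 ≤ 2 * μ - 1) : IsDampedWave z H μ (waveAux z H μ) := by
  have hsin := sin_mul_pi_ne_zero hμ
  set κ := π * z / (2 * H ^ (μ - 1) * sin (μ * π)) with hκ
  set a := besselJ (1 - μ) (z * H) * (z / 2) ^ μ with ha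
  set b := besselJ (μ - 1) (z * H) * (z / 2) ^ (-μ) with hb
  have hzp : (z / 2) ^ μ ≠ 0 := (rpow_pos_of_pos (half_pos hz) _).ne'
  have hHp : H ^ μ ≠ 0 := (rpow_pos_of_pos hH _).ne'
  have e1 : z * H / 2 = z / 2 * H := by ring
  have e2 : (z * H) ^ 2 / 4 = z ^ 2 * H ^ 2 / 4 := by ring
  have hzH : 0 < z / 2 * H := by positivity
  have hJ1 : besselJ (1 - μ) (z * H) = z / 2 * H / ((z / 2) ^ μ * H ^ μ) *
      besselCore (1 - μ) (z ^ 2 * H ^ 2 / 4) := by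
    rw [besselJ_eq, e1, e2, rpow_sub hzH, rpow_one, mul_rpow (half_pos hz).le hH.le]
  have hJ2 : besselJ (μ - 1) (z * H) = ((z / 2) ^ μ * H ^ μ) / (z / 2 * H) *
      besselCore (μ - 1) (z ^ 2 * H ^ 2 / 4) := by
    rw [besselJ_eq, e1, e2, rpow_sub_one hzH.ne', mul_rpow (half_pos hz).le hH.le]
  -- In `F₁` the contiguous relation has merged the two terms of the product rule into order `μ -
  -- 1`. At `η = 0` its two summands cancel, since `a` and `b` carry the factors `J_{1-μ}(zH)` and
  -- `J_{μ-1}(zH)`.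
  refine IsDampedWave.of_hasDerivAt hz hμ' (F₁ := fun η => κ *
    (a * (-2 * (H - η) ^ (2 * μ - 1) * besselCore (μ - 1) (z ^ 2 * (H - η) ^ 2 / 4)) +
      b * (z ^ 2 / 2 * (H - η) * besselCore (1 - μ) (z ^ 2 * (H - η) ^ 2 / 4)))) ?_ ?_ ?_ ?_
  · intro t ht
    have hs : H - t ≠ 0 := (sub_pos.mpr ht).ne'
    have heq : waveAux z H μ =ᶠ[𝓝 t] fun η => κ * (a * ((H - η) ^ (2 * μ) *
        besselCore μ (z ^ 2 * (H - η) ^ 2 / 4)) +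
        b * besselCore (-μ) (z ^ 2 * (H - η) ^ 2 / 4)) := by
      filter_upwards [Iio_mem_nhds ht] with η hη
      exact waveAux_eq hz hH hμ hη
    refine HasDerivAt.congr_of_eventuallyEq ?_ heq
    refine (((((hasDerivAt_sub_rpow ht (2 * μ)).mul
      (hasDerivAt_besselCore_comp z H μ t)).const_mul a).add
      ((hasDerivAt_besselCore_comp z H (-μ) t).const_mul b)).const_mul κ).congr_deriv ?_
    rw [besselCore_sub_one, show -μ + 1 = 1 - μ by ring, rpow_sub_one hs]
    field_simp
    ring
  · intro t ht
    have hs : H - t ≠ 0 := (sub_pos.mpr ht).ne'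
    have hB : HasDerivAt (fun η : ℝ => z ^ 2 / 2 * (H - η)) (-(z ^ 2 / 2)) t := by
      refine (((hasDerivAt_id t).const_sub H).const_mul (z ^ 2 / 2)).congr_deriv ?_
      ring
    rw [waveAux_eq hz hH hμ ht]
    refine (((((hasDerivAt_sub_rpow ht (2 * μ - 1)).const_mul (-2)).mul
      (hasDerivAt_besselCore_comp z H (μ - 1) t)).const_mul a).add
      ((hB.mul (hasDerivAt_besselCore_comp z H (1 - μ) t)).const_mul b)
      |>.const_mul κ).congr_deriv ?_
    have e3 := besselCore_sub_one (1 - μ) (z ^ 2 * (H - t) ^ 2 / 4)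
    rw [show 1 - μ - 1 = -μ by ring] at e3
    rw [e3, sub_add_cancel, rpow_sub_one hs (2 * μ - 1), rpow_sub_one hs (2 * μ)]
    simp only [← ha, ← hb, ← hκ]
    field_simp
    ring
  · rw [waveAux_eq hz hH hμ hH]
    -- The normalization `F(0) = 1` is exactly the Wronskian relation at `x = zH`.
    have hW := besselCore_wronskian μ (z ^ 2 * H ^ 2 / 4)
    simp only [sub_zero]
    rw [hJ1, hJ2, rpow_neg (half_pos hz).le, show 2 * μ = μ + μ by ring, rpow_add hH,
      rpow_sub_one hH.ne']
    have hpi := pi_ne_zero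
    field_simp at hW ⊢
    linear_combination hW
  · simp only [sub_zero]
    rw [ha, hb, hJ1, hJ2, rpow_neg (half_pos hz).le, show 2 * μ - 1 = μ + μ - 1 by ring,
      rpow_sub_one hH.ne', rpow_add hH]
    field_simp
    ring

lemma besselY_of_not_int {ν : ℝ} (h : ¬ ∃ n : ℤ, (n : ℝ) = ν) (x : ℝ) :
    besselY ν x = besselYAux ν x := by
  rw [besselY, if_neg h]

/-- A noninteger order is covered by the explicit formula; an integer order is reached as a limit of
noninteger ones, along which both `Y_ν` and `Y_{ν-1}` converge. -/
lemma isDampedWave_timeFactor {c D r H : ℝ} (hc : 0 < c) (hD : 0 < D) (hr : 0 < r) (hH : 0 < H)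
    (l : ℕ) : IsDampedWave (freq c r l) H (order c D H) (timeFactor c D r H l) := by
  -- For `l = 0` the frequency vanishes and the time factor is the constant `1`.
  rcases Nat.eq_zero_or_pos l with rfl | hl
  · have hz : freq c r 0 = 0 := by simp [freq]
    rw [hz]
    exact ⟨fun t _ => by simp [timeFactor], fun s _ t _ => by simp [timeFactor],
      fun t _ => by simp [timeFactor]⟩
  have hz : 0 < freq c r l := by
    have : (0 : ℝ) < l := by exact_mod_cast hl
    unfold freq
    positivity
  have hν : 1 < order c D H := by
    have : 0 < c ^ 2 * H / (2 * D) := by positivity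
    unfold order
    linarith
  by_cases hint : ∃ n : ℤ, (n : ℝ) = order c D H
  · obtain ⟨n, hn⟩ := hint
    have hn1 : 1 < n := by
      rw [← hn] at hν
      exact_mod_cast hν
    -- As `ν > 1`, both `ν = m + 1` and `ν - 1 = m` are natural numbers, as `tendsto_besselY`
    -- requires.
    obtain ⟨m, rfl⟩ : ∃ m : ℕ, n = (m + 1 : ℕ) := ⟨(n - 1).toNat, by omega⟩
    have hm1 : 1 ≤ m := by omega
    rw [Int.cast_natCast] at hn
    refine IsDampedWave.of_tendsto (Fμ := fun μ => waveAux (freq c r l) H μ) ?_ ?_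
    · rw [← hn]
      -- The only integer in this interval is `m + 1`, which the punctured neighbourhood omits;
      -- moreover `μ > m ≥ 1` gives `2μ - 1 ≥ 0`.
      have hnear : ∀ᶠ μ : ℝ in 𝓝[≠] ((m + 1 : ℕ) : ℝ), μ ∈ Ioo (m : ℝ) (m + 2) :=
        nhdsWithin_le_nhds (Ioo_mem_nhds (by push_cast; linarith) (by push_cast; linarith))
      filter_upwards [hnear, self_mem_nhdsWithin] with μ hμ hne
      refine isDampedWave_waveAux hz hH ?_ ?_
      · rintro ⟨k, rfl⟩
        apply hne
        have h1 : (m : ℤ) < k := by exact_mod_cast hμ.1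
        have h2 : k < m + 2 := by exact_mod_cast hμ.2
        have : k = m + 1 := by omega
        rw [this]
        simp
      · have : (1 : ℝ) ≤ m := by exact_mod_cast hm1
        linarith [hμ.1]
    · intro t ht
      have hs : 0 < freq c r l * (H - t) := mul_pos hz (sub_pos.mpr ht.2)
      have hX : 0 < freq c r l * H := mul_pos hz hH
      have htend : Tendsto (fun μ : ℝ => μ - 1) (𝓝[≠] (order c D H)) (𝓝[≠] (m : ℝ)) := by
        refine tendsto_nhdsWithin_of_tendsto_nhds_of_eventually_within _ ?_ ?_
        · have h1 : Tendsto (fun μ : ℝ => μ - 1) (𝓝 (order c D H)) (𝓝 (order c D H - 1)) :=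
            (continuous_sub_right 1).tendsto _
          rw [show (m : ℝ) = order c D H - 1 by rw [← hn]; push_cast; ring]
          exact h1.mono_left nhdsWithin_le_nhds
        · filter_upwards [self_mem_nhdsWithin] with μ hμ h
          apply hμ
          simp only [mem_singleton_iff] at h ⊢
          rw [← hn]
          push_cast
          linarith
      have hY1 := (tendsto_besselY hX m).comp htend
      have hY2 := tendsto_besselY hs (m + 1)
      have hcont : ∀ {f : ℝ → ℝ}, ContinuousAt f (order c D H) →
          Tendsto f (𝓝[≠] (order c D H)) (𝓝 (f (order c D H))) :=
        fun hf => hf.tendsto.mono_left nhdsWithin_le_nhds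
      have hJ1 := hcont (f := fun μ => besselJ (μ - 1) (freq c r l * H))
        (ContinuousAt.comp (f := fun μ : ℝ => μ - 1)
          (differentiableAt_besselJ_order hX _).continuousAt (by fun_prop))
      have hJ2 := hcont (differentiableAt_besselJ_order hs (order c D H)).continuousAt
      have hP1 := hcont (f := fun μ => (H - t) ^ μ)
        (Real.continuousAt_const_rpow (sub_pos.mpr ht.2).ne')
      have hP2 := hcont (f := fun μ => 2 * H ^ (μ - 1)) (continuousAt_const.mul
        (ContinuousAt.comp (f := fun μ : ℝ => μ - 1) (Real.continuousAt_const_rpow hH.ne')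
          (by fun_prop)))
      have hP2' : 2 * H ^ (order c D H - 1) ≠ 0 := by positivity
      rw [hn] at hY2
      rw [show (m : ℝ) = order c D H - 1 by rw [← hn]; push_cast; ring] at hY1
      have := hP1.mul ((((hY1.const_mul (π * freq c r l)).div hP2 hP2').mul hJ2).add
        ((((hJ1.const_mul (π * freq c r l)).div hP2 hP2').neg).mul hY2))
      rw [timeFactor, if_neg hl.ne']
      exact this
  · have hint' : ¬ ∃ n : ℤ, (n : ℝ) = order c D H - 1 := by
      rintro ⟨n, hn⟩
      exact hint ⟨n + 1, by push_cast; linarith⟩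
    have : timeFactor c D r H l = waveAux (freq c r l) H (order c D H) := by
      funext η
      rw [timeFactor, if_neg hl.ne', waveAux, coeffJ, coeffY, besselY_of_not_int hint,
        besselY_of_not_int hint']
    rw [this]
    exact isDampedWave_waveAux hz hH hint (by linarith)

/-- The derivative of `waveExt`. -/
def waveExtDeriv (z H μ : ℝ) (F : ℝ → ℝ) (η : ℝ) : ℝ :=
  -(z ^ 2 * ((H - η) ^ (2 * μ - 1) * ∫ s in (0 : ℝ)..η, (H - s) ^ (-(2 * μ - 1)) * F (max s 0)))

/-- The second derivative of `waveExt`. -/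
def waveExtDeriv₂ (z H μ : ℝ) (F : ℝ → ℝ) (η : ℝ) : ℝ :=
  -((2 * μ - 1) / (H - η)) * waveExtDeriv z H μ F η - z ^ 2 * F (max η 0)

/-- A twice continuously differentiable extension of a function `F` with `IsDampedWave z H μ F` to
negative times. -/
def waveExt (z H μ : ℝ) (F : ℝ → ℝ) (η : ℝ) : ℝ := 1 + ∫ s in (0 : ℝ)..η, waveExtDeriv z H μ F s

/-! ### Two-sided derivatives by extension to negative times -/

section WaveExt

variable {z H μ : ℝ} {F : ℝ → ℝ}

lemma waveExt_zero : waveExt z H μ F 0 = 1 := by simp [waveExt]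

lemma waveExtDeriv_zero : waveExtDeriv z H μ F 0 = 0 := by simp [waveExtDeriv]

lemma IsDampedWave.eq_waveExt (h : IsDampedWave z H μ F) {t : ℝ} (ht : t ∈ Ico 0 H) :
    F t = waveExt z H μ F t := by
  rw [h.eq_integral t ht, waveExt]
  congr 1
  refine intervalIntegral.integral_congr fun τ hτ => ?_
  have hτ' := uIcc_subset_Ico ht hτ
  simp only [waveExtDeriv]
  congr 3
  refine intervalIntegral.integral_congr fun s hs => ?_
  have hs' := uIcc_subset_Ico hτ' hs
  simp only [max_eq_left hs'.1]

lemma continuousOn_max_zero (hH : 0 < H) (hF : ContinuousOn F (Ico 0 H)) :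
    ContinuousOn (fun s => F (max s 0)) (Iio H) :=
  hF.comp (by fun_prop) fun _ hs => ⟨le_max_right _ _, max_lt hs hH⟩

lemma uIcc_subset_Iio (hH : 0 < H) {η : ℝ} (hη : η < H) : uIcc 0 η ⊆ Iio H :=
  fun _ hs => hs.2.trans_lt (max_lt hH hη)

lemma hasDerivAt_primitive_Iio {g : ℝ → ℝ} (hH : 0 < H) (hg : ContinuousOn g (Iio H)) {η : ℝ}
    (hη : η < H) : HasDerivAt (fun t => ∫ s in (0 : ℝ)..t, g s) (g η) η :=
  intervalIntegral.integral_hasDerivAt_right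
    ((hg.mono (uIcc_subset_Iio hH hη)).intervalIntegrable)
    (hg.stronglyMeasurableAtFilter isOpen_Iio η hη) (hg.continuousAt (Iio_mem_nhds hη))

/-- The product rule gives back the differential equation: the power factor produces the damping
term, and in the derivative of the primitive the two opposite powers cancel. -/
lemma hasDerivAt_waveExtDeriv (hH : 0 < H) (hF : ContinuousOn F (Ico 0 H)) {η : ℝ} (hη : η < H) :
    HasDerivAt (waveExtDeriv z H μ F) (waveExtDeriv₂ z H μ F η) η := by
  have hs : H - η ≠ 0 := (sub_pos.mpr hη).ne'
  have hI := hasDerivAt_primitive_Iio hH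
    ((continuousOn_sub_rpow H (-(2 * μ - 1))).mul (continuousOn_max_zero hH hF)) hη
  refine ((((hasDerivAt_sub_rpow hη (2 * μ - 1)).mul hI).const_mul (z ^ 2)).neg).congr_deriv ?_
  simp only [Pi.mul_apply]
  rw [waveExtDeriv₂, waveExtDeriv, rpow_sub_one hs, rpow_neg (sub_pos.mpr hη).le]
  have hp : (H - η) ^ (2 * μ - 1) ≠ 0 := (rpow_pos_of_pos (sub_pos.mpr hη) _).ne'
  field_simp
  ring

lemma continuousOn_waveExtDeriv (hH : 0 < H) (hF : ContinuousOn F (Ico 0 H)) :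
    ContinuousOn (waveExtDeriv z H μ F) (Iio H) :=
  fun _ hη => (hasDerivAt_waveExtDeriv hH hF hη).continuousAt.continuousWithinAt

lemma continuousOn_waveExtDeriv₂ (hH : 0 < H) (hF : ContinuousOn F (Ico 0 H)) :
    ContinuousOn (waveExtDeriv₂ z H μ F) (Iio H) :=
  ((((continuousOn_const (c := 2 * μ - 1)).div (continuousOn_const.sub continuousOn_id)
    fun _ hs => (sub_pos.mpr (mem_Iio.mp hs)).ne').neg).mul
      (continuousOn_waveExtDeriv hH hF)).sub ((continuousOn_max_zero hH hF).const_mul _)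

lemma hasDerivAt_waveExt (hH : 0 < H) (hF : ContinuousOn F (Ico 0 H)) {η : ℝ} (hη : η < H) :
    HasDerivAt (waveExt z H μ F) (waveExtDeriv z H μ F η) η :=
  (hasDerivAt_primitive_Iio hH (continuousOn_waveExtDeriv hH hF) hη).const_add 1

end WaveExt

/-- Only `|F| ≤ 1` is used, so `C` depends neither on `z` nor on `F`. The growth `z²` is of order
`l(l+1)`, which the decay of the zonal coefficients absorbs. -/
lemma exists_bound_waveExt {H μ b : ℝ} (hH : 0 < H) (hb : b < H) :
    ∃ C, 0 ≤ C ∧ ∀ (z : ℝ) (F : ℝ → ℝ), IsDampedWave z H μ F → ∀ η ∈ Ioo (-1) b,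
      |waveExtDeriv z H μ F η| ≤ C * z ^ 2 ∧ |waveExtDeriv₂ z H μ F η| ≤ C * z ^ 2 := by
  have hbd : ∀ q : ℝ, ∃ B, 0 ≤ B ∧ ∀ s ∈ Icc (-1) (max b 0), |(H - s) ^ q| ≤ B := by
    intro q
    obtain ⟨B, hB⟩ := (isCompact_Icc (a := (-1 : ℝ)) (b := max b 0)).exists_bound_of_continuousOn
      ((continuousOn_sub_rpow H q).mono fun s hs => hs.2.trans_lt (max_lt hb hH))
    exact ⟨|B|, abs_nonneg _, fun s hs => (hB s hs).trans (le_abs_self _)⟩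
  obtain ⟨B₁, hB₁0, hB₁⟩ := hbd (2 * μ - 1)
  obtain ⟨B₂, hB₂0, hB₂⟩ := hbd (-(2 * μ - 1))
  set m := max b 0 + 1 with hm
  have hm0 : 0 ≤ m := by positivity
  have hHb : 0 < H - b := sub_pos.mpr hb
  set C₁ := B₁ * (B₂ * m) with hC₁
  have hC₁0 : 0 ≤ C₁ := by positivity
  set C₂ := |2 * μ - 1| / (H - b) * C₁ + 1 with hC₂
  have hC₂0 : 0 ≤ C₂ := by positivity
  have key : ∀ (z : ℝ) (F : ℝ → ℝ), IsDampedWave z H μ F → ∀ η ∈ Ioo (-1) b,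
      |waveExtDeriv z H μ F η| ≤ C₁ * z ^ 2 := by
    intro z F hF η hη
    have hsub : ∀ s ∈ uIcc 0 η, s ∈ Icc (-1) (max b 0) := fun s hs =>
      ⟨(le_min (by norm_num) hη.1.le).trans hs.1,
        hs.2.trans (by rw [max_comm b]; exact max_le_max le_rfl hη.2.le)⟩
    have h1 := hB₁ η (hsub η right_mem_uIcc)
    have h2 : ‖∫ s in (0 : ℝ)..η, (H - s) ^ (-(2 * μ - 1)) * F (max s 0)‖ ≤ B₂ * |η - 0| := by
      refine intervalIntegral.norm_integral_le_of_norm_le_const fun s hs => ?_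
      have hs' := hsub s (uIoc_subset_uIcc hs)
      rw [norm_mul]
      calc _ ≤ B₂ * 1 := mul_le_mul (hB₂ s hs') (hF.abs_le _ ⟨le_max_right _ _,
              max_lt (hs'.2.trans_lt (max_lt hb hH)) hH⟩) (abs_nonneg _) hB₂0
        _ = B₂ := mul_one _
    have h3 : |η - 0| ≤ m := by
      rw [sub_zero, abs_le]
      have := le_max_left b 0
      have := le_max_right b 0
      constructor <;> linarith [hη.1, hη.2]
    rw [waveExtDeriv, abs_neg, abs_mul, abs_mul, abs_of_nonneg (sq_nonneg z), mul_comm]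
    exact mul_le_mul_of_nonneg_right (mul_le_mul h1
      (h2.trans (mul_le_mul_of_nonneg_left h3 hB₂0)) (abs_nonneg _) hB₁0) (sq_nonneg z)
  refine ⟨C₁ + C₂, by positivity, fun z F hF η hη => ⟨(key z F hF η hη).trans ?_, ?_⟩⟩
  · nlinarith [sq_nonneg z]
  · have h1 := key z F hF η hη
    have h2 : |F (max η 0)| ≤ 1 := hF.abs_le _ ⟨le_max_right _ _, max_lt (hη.2.trans hb) hH⟩
    have h3 : |-((2 * μ - 1) / (H - η))| ≤ |2 * μ - 1| / (H - b) := by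
      rw [abs_neg, abs_div, abs_of_pos (a := H - η) (by linarith [hη.2])]
      exact div_le_div_of_nonneg_left (abs_nonneg _) hHb (by linarith [hη.2])
    calc |waveExtDeriv₂ z H μ F η|
        ≤ |-((2 * μ - 1) / (H - η)) * waveExtDeriv z H μ F η| + |z ^ 2 * F (max η 0)| := abs_sub _ _
      _ ≤ |2 * μ - 1| / (H - b) * (C₁ * z ^ 2) + z ^ 2 * 1 := by
        rw [abs_mul, abs_mul, abs_of_nonneg (sq_nonneg z)]
        gcongr
      _ = C₂ * z ^ 2 := by rw [hC₂]; ring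
      _ ≤ (C₁ + C₂) * z ^ 2 := by nlinarith [sq_nonneg z]

/-! ### Legendre polynomials -/

section Legendre

open Polynomial

lemma iterate_derivative_X_mul' (f : ℝ[X]) (n : ℕ) :
    derivative^[n + 1] (X * f) = X * derivative^[n + 1] f + (n + 1 : ℝ[X]) * derivative^[n] f := by
  induction n with
  | zero =>
    simp only [zero_add, Function.iterate_one, derivative_mul, derivative_X, Nat.cast_zero,
      Function.iterate_zero, id]
    ring
  | succ n ih =>
    rw [Function.iterate_succ_apply', ih]
    simp only [derivative_add, derivative_mul, derivative_X, derivative_natCast, derivative_one,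
      ← Function.iterate_succ_apply' derivative]
    push_cast
    ring

lemma iterate_derivative_sq_sub_one_mul (f : ℝ[X]) (n : ℕ) :
    derivative^[n + 2] ((X ^ 2 - 1) * f) = (X ^ 2 - 1) * derivative^[n + 2] f +
      2 * (n + 2 : ℝ[X]) * (X * derivative^[n + 1] f) +
        (n + 2 : ℝ[X]) * (n + 1 : ℝ[X]) * derivative^[n] f := by
  have h : (X ^ 2 - 1) * f = X * (X * f) - f := by ring
  rw [h, iterate_derivative_sub, show n + 2 = n + 1 + 1 by rfl, iterate_derivative_X_mul',
    iterate_derivative_X_mul', iterate_derivative_X_mul']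
  push_cast
  ring

/-- The function `u = (X² - 1)^l` satisfies `(X² - 1) u' = 2l X u`; differentiating `l + 1` times by
Leibniz' rule gives the equation for the `l`-th derivative of `u`. -/
lemma legendre_ode (l : ℕ) :
    (X ^ 2 - 1) * derivative (derivative (legendre l)) + 2 * (X * derivative (legendre l)) =
      ((l * (l + 1) : ℕ) : ℝ[X]) * legendre l := by
  rcases l with _ | n
  · simp [legendre]
  set u : ℝ[X] := (X ^ 2 - 1) ^ (n + 1) with hu
  have h1 : (X ^ 2 - 1) * derivative u = ((2 * (n + 1) : ℕ) : ℝ[X]) * (X * u) := by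
    rw [hu, derivative_pow]
    simp
    ring
  have h2 := congrArg (fun q => derivative^[n + 2] q) h1
  rw [iterate_derivative_sq_sub_one_mul, iterate_derivative_natCast_mul,
    show n + 2 = n + 1 + 1 by rfl, iterate_derivative_X_mul',
    ← Function.iterate_succ_apply derivative, ← Function.iterate_succ_apply derivative,
    ← Function.iterate_succ_apply derivative] at h2
  simp only [legendre, derivative_C_mul, ← Function.iterate_succ_apply' derivative]
  rw [← hu]
  push_cast at h2 ⊢
  linear_combination (C (1 / (2 ^ (n + 1) * ((n + 1).factorial : ℝ)))) * h2

/-- At `a` only the Leibniz term in which every derivative falls on the power survives. This gives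
`P_l(±1)` from Rodrigues' formula. -/
lemma eval_iterate_derivative_sub_pow_mul (a : ℝ) (n : ℕ) (q : ℝ[X]) :
    (derivative^[n] ((X - C a) ^ n * q)).eval a = n.factorial * q.eval a := by
  induction n generalizing q with
  | zero => simp
  | succ n ih =>
    have : derivative ((X - C a) ^ (n + 1) * q) =
        (X - C a) ^ n * ((n + 1 : ℝ[X]) * q + (X - C a) * derivative q) := by
      rw [derivative_mul, derivative_X_sub_C_pow]
      rw [add_tsub_cancel_right]
      push_cast
      simp only [map_add, map_natCast, map_one]
      ring
    rw [Function.iterate_succ_apply, this, ih, Nat.factorial_succ]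
    simp
    ring

lemma legendre_eval_one (l : ℕ) : (legendre l).eval 1 = 1 := by
  have h : (X ^ 2 - 1 : ℝ[X]) ^ l = (X - C 1) ^ l * (X + 1) ^ l := by
    rw [← mul_pow]
    congr 1
    simp
    ring
  rw [legendre, eval_mul, h, eval_iterate_derivative_sub_pow_mul]
  simp
  field_simp
  norm_num

lemma legendre_eval_neg_one (l : ℕ) : (legendre l).eval (-1) = (-1) ^ l := by
  have h : (X ^ 2 - 1 : ℝ[X]) ^ l = (X - C (-1)) ^ l * (X - 1) ^ l := by
    rw [← mul_pow]
    congr 1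
    simp
    ring
  rw [legendre, eval_mul, h, eval_iterate_derivative_sub_pow_mul]
  simp
  rw [show (-1 - 1 : ℝ) = (-1) * 2 by norm_num, mul_pow]
  field_simp

lemma degree_legendre (l : ℕ) : (legendre l).degree = l := by
  have hm : (X ^ 2 - 1 : ℝ[X]).Monic := by
    simpa using monic_X_pow_sub_C (1 : ℝ) (n := 2) two_ne_zero
  have hd : ((X ^ 2 - 1 : ℝ[X]) ^ l).natDegree = l + l := by
    rw [hm.natDegree_pow]
    have : (X ^ 2 - 1 : ℝ[X]).natDegree = 2 := by
      simpa using natDegree_X_pow_sub_C (n := 2) (r := (1 : ℝ))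
    rw [this]
    ring
  have hlead : ((X ^ 2 - 1 : ℝ[X]) ^ l).coeff (l + l) = 1 := by
    rw [← hd]
    exact (hm.pow l)
  have hc : (1 / (2 ^ l * (l.factorial : ℝ))) ≠ 0 := by positivity
  rw [legendre, degree_C_mul hc]
  refine degree_eq_of_le_of_coeff_ne_zero ?_ ?_
  · refine natDegree_le_iff_degree_le.mp ((natDegree_iterate_derivative _ _).trans ?_)
    rw [hd]
    omega
  · rw [coeff_iterate_derivative, hlead]
    simp

/-- The Legendre polynomials as a polynomial sequence. -/
def legendreSequence : Polynomial.Sequence ℝ := ⟨legendre, degree_legendre⟩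

lemma intervalIntegrable_eval (p : ℝ[X]) (a b : ℝ) :
    IntervalIntegrable (fun x => p.eval x) volume a b := p.continuous.intervalIntegrable a b

lemma integral_derivative (p : ℝ[X]) :
    ∫ x in (-1 : ℝ)..1, (derivative p).eval x = p.eval 1 - p.eval (-1) :=
  intervalIntegral.integral_eq_sub_of_hasDerivAt (fun x _ => p.hasDerivAt x)
    (intervalIntegrable_eval _ _ _)

/-- With `p = P_k` and `q = P_l`, the polynomial `(X² - 1)(p q' - p' q)` vanishes at `±1`, and by
the Legendre equation its derivative is the difference of the eigenvalues times `p q`. -/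
lemma integral_legendre_mul_legendre {k l : ℕ} (h : k ≠ l) :
    ∫ x in (-1 : ℝ)..1, (legendre k * legendre l).eval x = 0 := by
  set p := legendre k
  set q := legendre l
  have hI := integral_derivative ((X ^ 2 - 1) * (p * derivative q - derivative p * q))
  have hd : derivative ((X ^ 2 - 1) * (p * derivative q - derivative p * q)) =
      C (((l * (l + 1) : ℕ) : ℝ) - ((k * (k + 1) : ℕ) : ℝ)) * (p * q) := by
    have h1 := legendre_ode k
    have h2 := legendre_ode l
    simp only [derivative_mul, derivative_pow, derivative_X, derivative_one, map_sub,
      C_eq_natCast]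
    simp only [Nat.cast_ofNat]
    linear_combination p * h2 - q * h1
  rw [hd] at hI
  simp only [eval_mul, eval_C, eval_sub, eval_pow, eval_X, eval_one, one_pow, sub_self, zero_mul,
    even_two.neg_one_pow, intervalIntegral.integral_const_mul] at hI
  have hne : ((l * (l + 1) : ℕ) : ℝ) - ((k * (k + 1) : ℕ) : ℝ) ≠ 0 := by
    rw [sub_ne_zero]
    intro h'
    have h'' : l * (l + 1) = k * (k + 1) := by exact_mod_cast h'
    rcases lt_or_gt_of_ne h with h3 | h3 <;> nlinarith
  simp only [eval_mul]
  exact (mul_eq_zero.mp hI).resolve_left hne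

lemma integral_legendre_mul_of_degree_lt {l : ℕ} {q : ℝ[X]} (hq : q.degree < l) :
    ∫ x in (-1 : ℝ)..1, (legendre l * q).eval x = 0 := by
  have hmem : q ∈ Submodule.span ℝ (legendreSequence '' Set.Iio l) := by
    rw [legendreSequence.span_degreeLT fun i _ =>
      (leadingCoeff_ne_zero.mpr (legendreSequence.ne_zero i)).isUnit]
    exact Polynomial.mem_degreeLT.mpr hq
  induction hmem using Submodule.span_induction with
  | mem x hx =>
    obtain ⟨k, hk, rfl⟩ := hx
    exact integral_legendre_mul_legendre (ne_of_gt hk)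
  | zero => simp
  | add x y _ _ hx hy =>
    have : ∀ {q : ℝ[X]}, q ∈ Submodule.span ℝ (legendreSequence '' Set.Iio l) → q.degree < l := by
      intro q hq
      rw [legendreSequence.span_degreeLT fun i _ =>
        (leadingCoeff_ne_zero.mpr (legendreSequence.ne_zero i)).isUnit] at hq
      exact Polynomial.mem_degreeLT.mp hq
    simp only [mul_add, eval_add]
    rw [intervalIntegral.integral_add (intervalIntegrable_eval _ _ _)
      (intervalIntegrable_eval _ _ _), hx (this ‹_›), hy (this ‹_›), add_zero]
  | smul a x _ hx =>
    rcases eq_or_ne a 0 with rfl | ha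
    · simp
    · have hdeg : x.degree < l := by
        rw [smul_eq_C_mul, degree_C_mul ha] at hq
        exact hq
      simp only [mul_smul_comm, eval_smul, smul_eq_mul, intervalIntegral.integral_const_mul,
        hx hdeg, mul_zero]

/-- Integrate the derivative of `X p²`, whose boundary value is `2`. Leading terms cancel in `X p' -
l p`, so it has degree below `l` and is orthogonal to `p`; hence `∫ p · X p' = l ∫ p²` and `(2l + 1)
∫ p² = 2`. -/
lemma integral_legendre_sq (l : ℕ) :
    ∫ x in (-1 : ℝ)..1, (legendre l * legendre l).eval x = 2 / (2 * l + 1) := by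
  set p := legendre l
  have hI := integral_derivative (X * (p * p))
  have hdeg : (X * derivative p - (l : ℝ[X]) * p).degree < (l : WithBot ℕ) := by
    rw [degree_lt_iff_coeff_zero]
    intro m hm
    have hp : ∀ j, l < j → p.coeff j = 0 := fun j hj =>
      coeff_eq_zero_of_degree_lt (by rw [degree_legendre]; exact_mod_cast hj)
    rw [coeff_sub, ← C_eq_natCast, coeff_C_mul]
    rcases m with _ | m
    · have : l = 0 := by omega
      simp [this]
    · rw [coeff_X_mul, coeff_derivative]
      rcases hm.eq_or_lt with h | h
      · rw [h]
        push_cast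
        ring
      · rw [hp _ h]
        ring
  have h2 := integral_legendre_mul_of_degree_lt hdeg
  have e1 : derivative (X * (p * p)) = p * p + C 2 * (p * (X * derivative p - (l : ℝ[X]) * p)) +
      C (2 * l : ℝ) * (p * p) := by
    simp only [derivative_mul, derivative_X, map_mul, map_ofNat, C_eq_natCast]
    ring
  have i1 := intervalIntegrable_eval (p * p) (-1) 1
  have i2 := intervalIntegrable_eval (p * (X * derivative p - (l : ℝ[X]) * p)) (-1) 1
  rw [e1] at hI
  simp only [eval_add, eval_C_mul] at hI
  rw [intervalIntegral.integral_add (i1.add (i2.const_mul 2)) (i1.const_mul _),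
    intervalIntegral.integral_add i1 (i2.const_mul 2), intervalIntegral.integral_const_mul,
    intervalIntegral.integral_const_mul, h2] at hI
  simp only [eval_mul, eval_X] at hI ⊢
  rw [legendre_eval_one, legendre_eval_neg_one, ← mul_pow] at hI
  norm_num at hI
  rw [eq_div_iff (by positivity)]
  linarith

/-- By the Legendre equation `p² + (1 - x²) p'²/(l(l+1))` has derivative `2x p'²/(l(l+1))`. It
therefore grows away from `0` towards its value `1` at both end points, and it dominates `p²`. -/
lemma abs_legendre_eval_le_one (l : ℕ) {x : ℝ} (hx : x ∈ Icc (-1) 1) :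
    |(legendre l).eval x| ≤ 1 := by
  rcases Nat.eq_zero_or_pos l with rfl | hl
  · simp [legendre]
  set p := legendre l with hp
  set lam : ℝ := l * (l + 1) with hlam
  have hlam0 : 0 < lam := by
    have : (0 : ℝ) < l := by exact_mod_cast hl
    positivity
  set f : ℝ → ℝ := fun x => p.eval x ^ 2 + (1 - x ^ 2) * (derivative p).eval x ^ 2 / lam with hf
  have hfd : ∀ x, HasDerivAt f (2 * x * (derivative p).eval x ^ 2 / lam) x := by
    intro x
    have hode := congrArg (eval x) (legendre_ode l)
    simp only [eval_add, eval_mul, eval_sub, eval_pow, eval_X, eval_one, eval_natCast,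
      eval_ofNat] at hode
    have hx2 : HasDerivAt (fun x : ℝ => 1 - x ^ 2) (-(2 * x)) x := by
      simpa using ((hasDerivAt_id x).pow 2).const_sub 1
    refine (((p.hasDerivAt x).pow 2).add ((hx2.mul
      (((derivative p).hasDerivAt x).pow 2)).div_const lam)).congr_deriv ?_
    simp only [Pi.pow_apply]
    push_cast at hode ⊢
    rw [← hlam, ← hp] at hode
    field_simp
    linear_combination (-(derivative p).eval x) * hode
  have hcont : Continuous f := continuous_iff_continuousAt.mpr fun x => (hfd x).continuousAt
  have hle : f x ≤ 1 := by
    rcases le_total 0 x with h0 | h0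
    · have hmono : MonotoneOn f (Icc 0 1) := by
        refine monotoneOn_of_deriv_nonneg (convex_Icc 0 1) hcont.continuousOn
          (fun y _ => (hfd y).differentiableAt.differentiableWithinAt) ?_
        intro y hy
        rw [interior_Icc] at hy
        rw [(hfd y).deriv]
        have := hy.1
        positivity
      have := hmono ⟨h0, hx.2⟩ ⟨zero_le_one, le_rfl⟩ hx.2
      simpa [hf, hp, legendre_eval_one] using this
    · have hanti : AntitoneOn f (Icc (-1) 0) := by
        refine antitoneOn_of_deriv_nonpos (convex_Icc (-1) 0) hcont.continuousOn
          (fun y _ => (hfd y).differentiableAt.differentiableWithinAt) ?_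
        intro y hy
        rw [interior_Icc] at hy
        rw [(hfd y).deriv]
        exact div_nonpos_of_nonpos_of_nonneg
          (mul_nonpos_of_nonpos_of_nonneg (by linarith [hy.2]) (sq_nonneg _)) hlam0.le
      have := hanti ⟨le_rfl, by norm_num⟩ ⟨hx.1, h0⟩ hx.1
      simpa [hf, hp, legendre_eval_neg_one, ← pow_mul, mul_comm l 2] using this
  have h1 : 0 ≤ (1 - x ^ 2) * (derivative p).eval x ^ 2 / lam := by
    have : 0 ≤ 1 - x ^ 2 := by nlinarith [hx.1, hx.2]
    positivity
  exact abs_le_of_sq_le_sq (by simp only [hf] at hle; linarith) zero_le_one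

end Legendre

/-! ### Completeness of the Legendre polynomials and Legendre series at the end point -/

section LegendreSeries

open Polynomial

lemma integral_mul_eq_zero_of_legendre {h : ℝ → ℝ} (hc : ContinuousOn h (Icc (-1) 1))
    (horth : ∀ l, ∫ x in (-1 : ℝ)..1, (legendre l).eval x * h x = 0) (q : ℝ[X]) :
    ∫ x in (-1 : ℝ)..1, q.eval x * h x = 0 := by
  have hint : ∀ q : ℝ[X], IntervalIntegrable (fun x => q.eval x * h x) volume (-1) 1 := fun q =>
    ContinuousOn.intervalIntegrable (by
      rw [uIcc_of_le (by norm_num)]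
      exact q.continuous.continuousOn.mul hc)
  have hq : q ∈ Submodule.span ℝ (Set.range legendreSequence) := by
    rw [legendreSequence.span fun i =>
      (leadingCoeff_ne_zero.mpr (legendreSequence.ne_zero i)).isUnit]
    trivial
  induction hq using Submodule.span_induction with
  | mem x hx =>
    obtain ⟨k, rfl⟩ := hx
    exact horth k
  | zero => simp
  | add p q _ _ hp hq =>
    simp only [eval_add, add_mul]
    rw [intervalIntegral.integral_add (hint p) (hint q), hp, hq, add_zero]
  | smul a p _ hp =>
    simp only [eval_smul, smul_eq_mul, mul_assoc, intervalIntegral.integral_const_mul, hp, mul_zero]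

/-- By Weierstrass there is a polynomial `q` within `ε` of `h`, and orthogonality gives `∫ h² = ∫ (h
- q) h ≤ ε ∫ |h|` for every `ε`. -/
lemma eq_zero_of_legendre_orthogonal {h : ℝ → ℝ} (hc : ContinuousOn h (Icc (-1) 1))
    (horth : ∀ l, ∫ x in (-1 : ℝ)..1, (legendre l).eval x * h x = 0) :
    ∀ x ∈ Icc (-1 : ℝ) 1, h x = 0 := by
  have hle : (-1 : ℝ) ≤ 1 := by norm_num
  have hc' : ContinuousOn h (uIcc (-1) 1) := by rwa [uIcc_of_le hle]
  have hsq : ContinuousOn (fun x => h x * h x) (uIcc (-1) 1) := hc'.mul hc'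
  have habs : IntervalIntegrable (fun x => |h x|) volume (-1) 1 := hc'.abs.intervalIntegrable
  set M := ∫ x in (-1 : ℝ)..1, |h x|
  have hM : 0 ≤ M := intervalIntegral.integral_nonneg hle fun x _ => abs_nonneg _
  have hsmall : ∀ ε > 0, ∫ x in (-1 : ℝ)..1, h x * h x ≤ ε * M := by
    intro ε hε
    obtain ⟨q, hq⟩ := exists_polynomial_near_of_continuousOn (-1) 1 h hc ε hε
    have hqi : IntervalIntegrable (fun x => q.eval x * h x) volume (-1) 1 :=
      (q.continuous.continuousOn.mul hc').intervalIntegrable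
    calc ∫ x in (-1 : ℝ)..1, h x * h x
        = ∫ x in (-1 : ℝ)..1, (h x * h x - q.eval x * h x) := by
          rw [intervalIntegral.integral_sub hsq.intervalIntegrable hqi,
            integral_mul_eq_zero_of_legendre hc horth, sub_zero]
      _ ≤ ∫ x in (-1 : ℝ)..1, ε * |h x| := by
          refine intervalIntegral.integral_mono_on hle (hsq.intervalIntegrable.sub hqi)
            (habs.const_mul ε) fun x hx => ?_
          rw [← sub_mul]
          refine (le_abs_self _).trans ?_
          rw [abs_mul, abs_sub_comm]
          exact mul_le_mul_of_nonneg_right (hq x hx).le (abs_nonneg _)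
      _ = ε * M := intervalIntegral.integral_const_mul _ _
  have hzero : ∫ x in (-1 : ℝ)..1, h x * h x ≤ 0 := by
    refine le_of_forall_pos_le_add fun δ hδ => ?_
    refine (hsmall (δ / (M + 1)) (by positivity)).trans ?_
    rw [zero_add, div_mul_eq_mul_div, div_le_iff₀ (by positivity)]
    nlinarith
  intro x hx
  by_contra hne
  have := intervalIntegral.integral_pos (f := fun x => h x * h x) (by norm_num : (-1 : ℝ) < 1)
    (hc.mul hc) (fun y _ => mul_self_nonneg _) ⟨x, hx, mul_self_pos.mpr hne⟩
  linarith

lemma eq_zero_of_legendre_orthogonal_complex {h : ℝ → ℂ} (hc : ContinuousOn h (Icc (-1) 1))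
    (horth : ∀ l, ∫ x in (-1 : ℝ)..1, (((legendre l).eval x : ℝ) : ℂ) * h x = 0) :
    ∀ x ∈ Icc (-1 : ℝ) 1, h x = 0 := by
  have hint : ∀ l, IntervalIntegrable (fun x => (((legendre l).eval x : ℝ) : ℂ) * h x) volume (-1) 1 :=
    fun l => ContinuousOn.intervalIntegrable (by
      rw [uIcc_of_le (by norm_num)]
      exact (Complex.continuous_ofReal.comp (legendre l).continuous).continuousOn.mul hc)
  intro x hx
  refine Complex.ext ?_ ?_
  · refine eq_zero_of_legendre_orthogonal (h := fun x => (h x).re)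
      (Complex.continuous_re.comp_continuousOn hc) (fun l => ?_) x hx
    have := Complex.reCLM.intervalIntegral_comp_comm (hint l)
    rw [horth l, map_zero] at this
    simpa using this
  · refine eq_zero_of_legendre_orthogonal (h := fun x => (h x).im)
      (Complex.continuous_im.comp_continuousOn hc) (fun l => ?_) x hx
    have := Complex.imCLM.intervalIntegral_comp_comm (hint l)
    rw [horth l, map_zero] at this
    simpa using this

/-- An absolutely summable Legendre series of a continuous function converges to the function at
the end point `1`. -/
lemma hasSum_legendre_series {A : ℝ → ℂ} (hA : Continuous A) {a : ℕ → ℂ}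
    (ha : ∀ l : ℕ, a l = (2 * l + 1) / 2 * ∫ x in (-1 : ℝ)..1, (((legendre l).eval x : ℝ) : ℂ) * A x)
    (hs : Summable fun l => ‖a l‖) : HasSum a (A 1) := by
  have hle : (-1 : ℝ) ≤ 1 := by norm_num
  have hterm : ∀ l, Continuous fun x : ℝ => a l * (((legendre l).eval x : ℝ) : ℂ) := fun l =>
    continuous_const.mul (Complex.continuous_ofReal.comp (legendre l).continuous)
  have hbound : ∀ l, ∀ x ∈ Icc (-1 : ℝ) 1, ‖a l * (((legendre l).eval x : ℝ) : ℂ)‖ ≤ ‖a l‖ := by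
    intro l x hx
    rw [norm_mul, Complex.norm_real]
    exact mul_le_of_le_one_right (norm_nonneg _) (abs_legendre_eval_le_one l hx)
  set B : ℝ → ℂ := fun x => ∑' l, a l * (((legendre l).eval x : ℝ) : ℂ)
  have hB : ContinuousOn B (Icc (-1) 1) :=
    continuousOn_tsum (fun l => (hterm l).continuousOn) hs hbound
  have hsum : ∀ x ∈ Icc (-1 : ℝ) 1, HasSum (fun l => a l * (((legendre l).eval x : ℝ) : ℂ)) (B x) :=
    fun x hx => (Summable.of_norm_bounded hs fun l => hbound l x hx).hasSum
  have hsub : uIoc (-1 : ℝ) 1 ⊆ Icc (-1) 1 := by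
    rw [uIoc_of_le hle]
    exact Ioc_subset_Icc_self
  -- The sum `B` of the series has the same Legendre coefficients as `A`, so completeness identifies
  -- the two on `[-1, 1]`.
  have hcoef : ∀ k, ∫ x in (-1 : ℝ)..1, (((legendre k).eval x : ℝ) : ℂ) * B x =
      ∫ x in (-1 : ℝ)..1, (((legendre k).eval x : ℝ) : ℂ) * A x := by
    intro k
    have hk : Continuous fun x : ℝ => (((legendre k).eval x : ℝ) : ℂ) :=
      Complex.continuous_ofReal.comp (legendre k).continuous
    have h1 := intervalIntegral.hasSum_integral_of_dominated_convergence (μ := volume)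
      (a := (-1 : ℝ)) (b := 1)
      (F := fun l x => (((legendre k).eval x : ℝ) : ℂ) * (a l * (((legendre l).eval x : ℝ) : ℂ)))
      (f := fun x => (((legendre k).eval x : ℝ) : ℂ) * B x) (fun l _ => ‖a l‖)
      (fun l => (hk.mul (hterm l)).aestronglyMeasurable)
      (fun l => Eventually.of_forall fun x hx => by
        rw [norm_mul, Complex.norm_real]
        exact (mul_le_of_le_one_left (norm_nonneg _)
          (abs_legendre_eval_le_one k (hsub hx))).trans (hbound l x (hsub hx)))
      (Eventually.of_forall fun x _ => hs) (by simp)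
      (Eventually.of_forall fun x hx => (hsum x (hsub hx)).mul_left _)
    have h2 : ∀ l, ∫ x in (-1 : ℝ)..1, (((legendre k).eval x : ℝ) : ℂ) *
        (a l * (((legendre l).eval x : ℝ) : ℂ)) =
        a l * ((∫ x in (-1 : ℝ)..1, (legendre k * legendre l).eval x : ℝ) : ℂ) := by
      intro l
      rw [← intervalIntegral.integral_ofReal, ← intervalIntegral.integral_const_mul]
      refine intervalIntegral.integral_congr fun x _ => ?_
      simp only [eval_mul, Complex.ofReal_mul]
      ring
    simp only [h2] at h1
    have h3 := hasSum_single (f := fun l => a l *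
        ((∫ x in (-1 : ℝ)..1, (legendre k * legendre l).eval x : ℝ) : ℂ)) k fun l hl => by
      rw [ integral_legendre_mul_legendre hl.symm, Complex.ofReal_zero, mul_zero]
    rw [h1.unique h3, integral_legendre_sq, ha]
    have : (2 * k + 1 : ℂ) ≠ 0 := by exact_mod_cast Nat.succ_ne_zero (2 * k)
    push_cast
    field_simp
  have hz := eq_zero_of_legendre_orthogonal_complex (h := fun x => A x - B x)
    (hA.continuousOn.sub hB) (fun k => by
      have hk : Continuous fun x : ℝ => (((legendre k).eval x : ℝ) : ℂ) :=
        Complex.continuous_ofReal.comp (legendre k).continuous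
      simp only [mul_sub]
      have i1 : IntervalIntegrable (fun x : ℝ => (((legendre k).eval x : ℝ) : ℂ) * A x) volume
          (-1) 1 := (hk.mul hA).intervalIntegrable _ _
      have i2 : IntervalIntegrable (fun x : ℝ => (((legendre k).eval x : ℝ) : ℂ) * B x) volume
          (-1) 1 := ContinuousOn.intervalIntegrable (by
        rw [uIcc_of_le hle]
        exact hk.continuousOn.mul hB)
      rw [intervalIntegral.integral_sub i1 i2, hcoef, sub_self]) 1 ⟨hle, le_rfl⟩
  have h1 := hsum 1 ⟨hle, le_rfl⟩
  rw [← sub_eq_zero.mp hz] at h1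
  simpa [legendre_eval_one] using h1

/-- Cauchy-Schwarz in the form `y ≤ (s/2) y² + 1/(2s)` with `s = √(2l + 1)`, the value for which the
two integrals are equal. -/
lemma integral_abs_legendre_le (l : ℕ) :
    ∫ x in (-1 : ℝ)..1, |(legendre l).eval x| ≤ 2 / √(2 * l + 1) := by
  set s := √(2 * (l : ℝ) + 1) with hs
  have hs0 : 0 < s := by positivity
  have hss : s * s = 2 * l + 1 := Real.mul_self_sqrt (by positivity)
  have i1 : IntervalIntegrable (fun x => s / 2 * (legendre l * legendre l).eval x) volume (-1) 1 :=
    (intervalIntegrable_eval _ _ _).const_mul _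
  calc ∫ x in (-1 : ℝ)..1, |(legendre l).eval x|
      ≤ ∫ x in (-1 : ℝ)..1, (s / 2 * (legendre l * legendre l).eval x + 1 / (2 * s)) := by
        refine intervalIntegral.integral_mono_on (by norm_num)
          ((legendre l).continuous.abs.intervalIntegrable _ _)
          (i1.add (by simp)) fun x _ => ?_
        rw [eval_mul, ← abs_mul_abs_self ((legendre l).eval x)]
        set y := |(legendre l).eval x|
        have h := sq_nonneg (s * y - 1)
        have : s / 2 * (y * y) + 1 / (2 * s) - y = (s * y - 1) ^ 2 / (2 * s) := by
          field_simp
          ring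
        have h2 : 0 ≤ (s * y - 1) ^ 2 / (2 * s) := by positivity
        linarith
    _ = 2 / s := by
        rw [intervalIntegral.integral_add i1 (by simp), intervalIntegral.integral_const_mul,
          integral_legendre_sq, ← hss]
        simp
        field_simp
        norm_num

end LegendreSeries

/-! ### Zonal coefficients -/

lemma contDiff_coe_sphPoint : ContDiff ℝ ∞ fun p : ℝ × ℝ => ((sphPoint p.1 p.2 : S2) : E3) := by
  simp only [coe_sphPoint]
  fun_prop

lemma apply_eq_radialExt (ψ : TestFun) (x : S2) : ψ.1 x = radialExt ψ.1 (x : E3) := by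
  simp only [radialExt, radial_coe]

lemma coe_ne_zero (x : S2) : (x : E3) ≠ 0 := by
  intro h
  have := mem_sphere_zero_iff_norm.mp x.2
  simp [h] at this

lemma contDiff_apply_sphPoint (ψ : TestFun) :
    ContDiff ℝ ∞ fun p : ℝ × ℝ => ψ.1 (sphPoint p.1 p.2) := by
  simp only [apply_eq_radialExt]
  exact contDiff_iff_contDiffAt.mpr fun p =>
    ContDiffAt.comp (g := radialExt ψ.1) p
      (contDiffAt_radialExt ψ.2 (coe_ne_zero (sphPoint p.1 p.2))) contDiff_coe_sphPoint.contDiffAt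

lemma continuous_testFun (ψ : TestFun) : Continuous ψ.1 := ψ.2.continuous

lemma sphPoint_zero (φ : ℝ) : sphPoint 0 φ = sphPoint 0 0 := by
  ext1
  simp [coe_sphPoint]

/-- The coefficients of the expansion of a test function in zonal harmonics. -/
def zonalCoeff (l : ℕ) (ψ : TestFun) : ℂ :=
  ((2 * l + 1) / (4 * π) : ℝ) * ∫ θ in (0 : ℝ)..π, ∫ φ in (0 : ℝ)..(2 * π),
    (((legendre l).eval (cos θ) : ℝ) : ℂ) * ψ.1 (sphPoint θ φ) * (sin θ : ℂ)

lemma assocLegendre_one {l : ℕ} {m : ℤ} (hm : m ≠ 0) : assocLegendre l m 1 = 0 := by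
  rcases m with m | m
  · have : m ≠ 0 := by
      rintro rfl
      exact hm rfl
    simp [assocLegendre, assocLegendreNat, this]
  · simp [assocLegendre, assocLegendreNat]

lemma assocLegendre_zero (l : ℕ) (x : ℝ) : assocLegendre l 0 x = (legendre l).eval x := by
  change assocLegendre l (Int.ofNat 0) x = _
  simp [assocLegendre, assocLegendreNat]

lemma harmonicConst_zero (l : ℕ) : harmonicConst l 0 = √((2 * l + 1) / (4 * π)) := by
  simp [harmonicConst, Nat.factorial_ne_zero]

/-- At the pole the factor `√(1 - cos² θ)^|m|` annihilates every harmonic with `m ≠ 0`. -/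
lemma sum_harmonics_eq (l : ℕ) (ψ : TestFun) :
    ∑ m ∈ Finset.Icc (-(l : ℤ)) (l : ℤ), conj (sphHarmonic l m 0 0) * pairing (sphHarmonic l m) ψ =
      zonalCoeff l ψ := by
  rw [Finset.sum_eq_single 0]
  · have h1 : sphHarmonic l 0 0 0 = (√((2 * l + 1) / (4 * π)) : ℝ) := by
      simp [sphHarmonic, assocLegendre_zero, legendre_eval_one, harmonicConst_zero]
    have h2 : pairing (sphHarmonic l 0) ψ = (√((2 * l + 1) / (4 * π)) : ℝ) *
        ∫ θ in (0 : ℝ)..π, ∫ φ in (0 : ℝ)..(2 * π),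
          (((legendre l).eval (cos θ) : ℝ) : ℂ) * ψ.1 (sphPoint θ φ) * (sin θ : ℂ) := by
      rw [pairing, ← intervalIntegral.integral_const_mul]
      refine intervalIntegral.integral_congr fun θ _ => ?_
      rw [← intervalIntegral.integral_const_mul]
      refine intervalIntegral.integral_congr fun φ _ => ?_
      simp only [sphHarmonic, assocLegendre_zero, harmonicConst_zero, Int.cast_zero, mul_zero,
        zero_mul, Complex.exp_zero, mul_one]
      ring
    rw [h1, h2, Complex.conj_ofReal, ← mul_assoc, ← Complex.ofReal_mul,
      Real.mul_self_sqrt (by positivity), zonalCoeff]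
  · intro m _ hm
    simp [sphHarmonic, assocLegendre_one hm]
  · intro h
    simp at h

/-- The average of a test function over the circle at the height `x` above the equator. -/
def azimuthalMean (ψ : TestFun) (x : ℝ) : ℂ :=
  (1 / (2 * π) : ℝ) * ∫ φ in (0 : ℝ)..(2 * π), ψ.1 (sphPoint (arccos x) φ)

lemma continuous_azimuthalMean (ψ : TestFun) : Continuous (azimuthalMean ψ) := by
  have h : Continuous fun p : ℝ × ℝ => (arccos p.1, p.2) := by fun_prop
  have h2 : Continuous (Function.uncurry fun x φ => ψ.1 (sphPoint (arccos x) φ)) := by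
    have h3 := (contDiff_apply_sphPoint ψ).continuous.comp h
    simp only [Function.comp_def] at h3
    simpa only [Function.uncurry_def] using h3
  have h3 := intervalIntegral.continuous_parametric_intervalIntegral_of_continuous'
    (μ := volume) h2 0 (2 * π)
  unfold azimuthalMean
  exact continuous_const.mul h3

lemma azimuthalMean_one (ψ : TestFun) : azimuthalMean ψ 1 = ψ.1 (sphPoint 0 0) := by
  simp only [azimuthalMean, arccos_one, sphPoint_zero, intervalIntegral.integral_const]
  have := pi_ne_zero
  simp
  field_simp

lemma integral_cos_sin {g : ℝ → ℂ} (hg : Continuous g) :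
    ∫ θ in (0 : ℝ)..π, g (cos θ) * (sin θ : ℂ) = ∫ x in (-1 : ℝ)..1, g x := by
  have h := intervalIntegral.integral_deriv_smul_comp (a := 0) (b := π) (g := g)
    (f := cos) (f' := fun θ => -sin θ) (fun x _ => hasDerivAt_cos x)
    (continuous_sin.neg.continuousOn) hg
  rw [cos_zero, cos_pi, intervalIntegral.integral_symm (-1) 1] at h
  rw [← neg_inj, ← h, ← intervalIntegral.integral_neg]
  refine intervalIntegral.integral_congr fun θ _ => ?_
  simp only [Function.comp, Complex.real_smul]
  push_cast
  ring

lemma zonalCoeff_eq (l : ℕ) (ψ : TestFun) : zonalCoeff l ψ =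
    (2 * l + 1) / 2 * ∫ x in (-1 : ℝ)..1,
      (((legendre l).eval x : ℝ) : ℂ) * azimuthalMean ψ x := by
  have hP : Continuous fun x : ℝ => (((legendre l).eval x : ℝ) : ℂ) :=
    Complex.continuous_ofReal.comp (legendre l).continuous
  rw [← integral_cos_sin (g := fun x => (((legendre l).eval x : ℝ) : ℂ) * azimuthalMean ψ x)
    (hP.mul (continuous_azimuthalMean ψ)), zonalCoeff,
    ← intervalIntegral.integral_const_mul, ← intervalIntegral.integral_const_mul]
  refine intervalIntegral.integral_congr fun θ hθ => ?_
  rw [uIcc_of_le pi_pos.le] at hθ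
  simp only [azimuthalMean, arccos_cos hθ.1 hθ.2, intervalIntegral.integral_mul_const,
    intervalIntegral.integral_const_mul]
  have : (π : ℂ) ≠ 0 := by exact_mod_cast pi_ne_zero
  push_cast
  rw [show (4 * π : ℂ) = 2 * (2 * π) by ring]
  field_simp

lemma norm_zonalCoeff_le (l : ℕ) (ψ : TestFun) {S : ℝ} (hS : ∀ x, ‖ψ.1 x‖ ≤ S) :
    ‖zonalCoeff l ψ‖ ≤ √(2 * l + 1) * S := by
  have hS0 : 0 ≤ S := (norm_nonneg _).trans (hS (sphPoint 0 0))
  have hA : ∀ x, ‖azimuthalMean ψ x‖ ≤ S := by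
    intro x
    have h := intervalIntegral.norm_integral_le_of_norm_le_const (a := 0) (b := 2 * π)
      (f := fun φ => ψ.1 (sphPoint (arccos x) φ)) (C := S) fun φ _ => hS _
    have hpi := pi_pos
    rw [azimuthalMean, norm_mul, Complex.norm_real, Real.norm_of_nonneg (by positivity)]
    rw [sub_zero, abs_of_pos (by positivity)] at h
    calc _ ≤ 1 / (2 * π) * (S * (2 * π)) := by gcongr
      _ = S := by field_simp
  have hle : (-1 : ℝ) ≤ 1 := by norm_num
  have h1 : ‖∫ x in (-1 : ℝ)..1, (((legendre l).eval x : ℝ) : ℂ) * azimuthalMean ψ x‖ ≤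
      (∫ x in (-1 : ℝ)..1, |(legendre l).eval x|) * S := by
    rw [← intervalIntegral.integral_mul_const]
    refine intervalIntegral.norm_integral_le_of_norm_le hle (Eventually.of_forall fun x _ => ?_)
      (((legendre l).continuous.abs.mul continuous_const).intervalIntegrable _ _)
    rw [norm_mul, Complex.norm_real]
    exact mul_le_mul_of_nonneg_left (hA x) (norm_nonneg _)
  have h2 := integral_abs_legendre_le l
  set s := √(2 * (l : ℝ) + 1) with hs
  have hs0 : 0 < s := by positivity
  have hss : s * s = 2 * l + 1 := Real.mul_self_sqrt (by positivity)
  have h3 : ‖((2 * l + 1) / 2 : ℂ)‖ = s * s / 2 := by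
    have : ((2 * l + 1) / 2 : ℂ) = ((s * s / 2 : ℝ) : ℂ) := by
      rw [hss]
      push_cast
      rfl
    rw [this, Complex.norm_real, Real.norm_of_nonneg (by positivity)]
  rw [zonalCoeff_eq, norm_mul, h3]
  calc _ ≤ s * s / 2 * (2 / s * S) := by gcongr; exact h1.trans (by gcongr)
    _ = s * S := by field_simp

/-- The partial derivative of a function of two variables in the direction `v`. -/
def partialDeriv (v : ℝ × ℝ) (f : ℝ × ℝ → ℂ) : ℝ × ℝ → ℂ := fun p => fderiv ℝ f p v

lemma ContDiff.partialDeriv {f : ℝ × ℝ → ℂ} (hf : ContDiff ℝ ∞ f) (v : ℝ × ℝ) :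
    ContDiff ℝ ∞ (partialDeriv v f) :=
  (hf.fderiv_right (m := ∞) (by exact le_rfl)).clm_apply contDiff_const

lemma hasDerivAt_fst_slice {f : ℝ × ℝ → ℂ} (hf : ContDiff ℝ ∞ f) (θ φ : ℝ) :
    HasDerivAt (fun t => f (t, φ)) (partialDeriv (1, 0) f (θ, φ)) θ :=
  ((hf.differentiable (by simp)) (θ, φ)).hasFDerivAt.comp_hasDerivAt θ
    ((hasDerivAt_id θ).prodMk (hasDerivAt_const θ φ))

lemma hasDerivAt_snd_slice {f : ℝ × ℝ → ℂ} (hf : ContDiff ℝ ∞ f) (θ φ : ℝ) :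
    HasDerivAt (fun t => f (θ, t)) (partialDeriv (0, 1) f (θ, φ)) φ :=
  ((hf.differentiable (by simp)) (θ, φ)).hasFDerivAt.comp_hasDerivAt φ
    ((hasDerivAt_const φ θ).prodMk (hasDerivAt_id φ))

lemma integral_swap_of_continuous {f : ℝ → ℝ → ℂ} (hf : Continuous (Function.uncurry f))
    (a b : ℝ) (ha : 0 ≤ a) (hb : 0 ≤ b) :
    ∫ x in (0 : ℝ)..a, ∫ y in (0 : ℝ)..b, f x y = ∫ y in (0 : ℝ)..b, ∫ x in (0 : ℝ)..a, f x y := by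
  simp only [intervalIntegral.integral_of_le ha, intervalIntegral.integral_of_le hb]
  refine integral_integral_swap ?_
  rw [Measure.prod_restrict]
  have h := hf.integrableOn_Icc (a := ((0 : ℝ), (0 : ℝ))) (b := (a, b)) (μ := volume)
  rw [Icc_prod_eq] at h
  exact h.mono_set (prod_mono Ioc_subset_Icc_self Ioc_subset_Icc_self)

/-- Green's identity in coordinates, with `P_l(cos θ)` an eigenfunction. The polar part is
integrated by the Lagrange identity, whose boundary terms carry `sin θ` and vanish at both poles;
the azimuthal part is the integral over a period of a derivative. -/
lemma zonalCoeff_sphLaplacian (l : ℕ) (ψ : TestFun) :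
    zonalCoeff l (sphLaplacian ψ) = -((l * (l + 1) : ℕ) : ℂ) * zonalCoeff l ψ := by
  set f : ℝ × ℝ → ℂ := fun p => ψ.1 (sphPoint p.1 p.2) with hf
  have hfs : ContDiff ℝ ∞ f := contDiff_apply_sphPoint ψ
  set f₁ := partialDeriv (1, 0) f with hf₁
  set f₂ := partialDeriv (0, 1) f with hf₂
  have hf₁s : ContDiff ℝ ∞ f₁ := ContDiff.partialDeriv hfs _
  have hf₂s : ContDiff ℝ ∞ f₂ := ContDiff.partialDeriv hfs _
  set f₁₁ := partialDeriv (1, 0) f₁ with hf₁₁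
  set f₂₂ := partialDeriv (0, 1) f₂ with hf₂₂
  have hf₁₁s : ContDiff ℝ ∞ f₁₁ := ContDiff.partialDeriv hf₁s _
  have hf₂₂s : ContDiff ℝ ∞ f₂₂ := ContDiff.partialDeriv hf₂s _
  set P : ℝ → ℂ := fun θ => (((legendre l).eval (cos θ) : ℝ) : ℂ) with hP
  set P₁ : ℝ → ℂ := fun θ => ((((legendre l).derivative).eval (cos θ) : ℝ) : ℂ) with hP₁
  set P₂ : ℝ → ℂ := fun θ => ((((legendre l).derivative.derivative).eval (cos θ) : ℝ) : ℂ) with hP₂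
  have hpoly : ∀ q : Polynomial ℝ, ∀ θ, HasDerivAt (fun θ => ((q.eval (cos θ) : ℝ) : ℂ))
      (((q.derivative.eval (cos θ) : ℝ) : ℂ) * (-sin θ : ℝ)) θ := by
    intro q θ
    have := ((q.hasDerivAt (cos θ)).comp θ (hasDerivAt_cos θ)).ofReal_comp
    refine this.congr_deriv ?_
    push_cast
    rfl
  have hpolyc : ∀ q : Polynomial ℝ, Continuous (fun θ => ((q.eval (cos θ) : ℝ) : ℂ)) := fun q =>
    Complex.continuous_ofReal.comp (q.continuous.comp continuous_cos)
  have hsinc : Continuous fun θ : ℝ => ((sin θ : ℝ) : ℂ) :=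
    Complex.continuous_ofReal.comp continuous_sin
  have hcosc : Continuous fun θ : ℝ => ((cos θ : ℝ) : ℂ) :=
    Complex.continuous_ofReal.comp continuous_cos
  have hsind : ∀ θ : ℝ, HasDerivAt (fun θ : ℝ => ((sin θ : ℝ) : ℂ)) ((cos θ : ℝ) : ℂ) θ := fun θ =>
    (hasDerivAt_sin θ).ofReal_comp
  set lam : ℂ := ((l * (l + 1) : ℕ) : ℂ) with hlam
  have hode : ∀ θ : ℝ, ((sin θ : ℝ) : ℂ) ^ 2 * P₂ θ - 2 * ((cos θ : ℝ) : ℂ) * P₁ θ = -lam * P θ := by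
    intro θ
    have h := congrArg (Polynomial.eval (cos θ)) (legendre_ode l)
    simp only [Polynomial.eval_add, Polynomial.eval_mul, Polynomial.eval_sub, Polynomial.eval_pow,
      Polynomial.eval_X, Polynomial.eval_one, Polynomial.eval_natCast,
      Polynomial.eval_ofNat] at h
    have h2 : sin θ ^ 2 * ((legendre l).derivative.derivative).eval (cos θ) -
        2 * cos θ * ((legendre l).derivative).eval (cos θ) =
        -((l * (l + 1) : ℕ) : ℝ) * (legendre l).eval (cos θ) := by
      rw [sin_sq]
      linear_combination -h
    have h3 := congrArg (fun x : ℝ => (x : ℂ)) h2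
    simpa only [Complex.ofReal_sub, Complex.ofReal_mul, Complex.ofReal_pow, Complex.ofReal_neg,
      Complex.ofReal_natCast, Complex.ofReal_ofNat] using h3
  -- The Lagrange identity in the polar angle.
  have hlag : ∀ φ, ∫ θ in (0 : ℝ)..π, (P θ * (((cos θ : ℝ) : ℂ) * f₁ (θ, φ) +
      ((sin θ : ℝ) : ℂ) * f₁₁ (θ, φ)) + lam * P θ * ((sin θ : ℝ) : ℂ) * f (θ, φ)) = 0 := by
    intro φ
    have hd : ∀ θ ∈ uIcc (0 : ℝ) π, HasDerivAt (fun θ => ((sin θ : ℝ) : ℂ) *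
        (P θ * f₁ (θ, φ) - P₁ θ * (-((sin θ : ℝ) : ℂ)) * f (θ, φ)))
        (P θ * (((cos θ : ℝ) : ℂ) * f₁ (θ, φ) + ((sin θ : ℝ) : ℂ) * f₁₁ (θ, φ)) +
          lam * P θ * ((sin θ : ℝ) : ℂ) * f (θ, φ)) θ := by
      intro θ _
      have h1 := hasDerivAt_fst_slice hfs θ φ
      have h2 := hasDerivAt_fst_slice hf₁s θ φ
      refine ((hsind θ).mul (((hpoly _ θ).mul h2).sub (((hpoly _ θ).mul
        (hsind θ).neg).mul h1))).congr_deriv ?_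
      have e := hode θ
      simp only [Pi.mul_apply, Pi.sub_apply, Pi.neg_apply, ← hP, ← hP₁, ← hf₁, ← hf₁₁]
      push_cast at e ⊢
      linear_combination (-(Complex.sin θ) * f (θ, φ)) * e
    have hI := intervalIntegral.integral_eq_sub_of_hasDerivAt hd (by
      refine Continuous.intervalIntegrable ?_ _ _
      have c1 : Continuous fun θ : ℝ => f (θ, φ) := hfs.continuous.comp (by fun_prop)
      have c2 : Continuous fun θ : ℝ => f₁ (θ, φ) := hf₁s.continuous.comp (by fun_prop)
      have c3 : Continuous fun θ : ℝ => f₁₁ (θ, φ) := hf₁₁s.continuous.comp (by fun_prop)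
      exact ((hpolyc _).mul ((hcosc.mul c2).add (hsinc.mul c3))).add
        (((continuous_const.mul (hpolyc _)).mul hsinc).mul c1))
    rw [hI]
    simp
  -- The azimuthal part integrates to zero.
  have hazi : ∀ θ, ∫ φ in (0 : ℝ)..(2 * π), f₂₂ (θ, φ) = 0 := by
    intro θ
    have hper : ∀ φ, f₂ (θ, φ + 2 * π) = f₂ (θ, φ) := by
      intro φ
      have h1 := (hasDerivAt_snd_slice hfs θ (φ + 2 * π)).comp_add_const φ (2 * π)
      have h2 : (fun t => f (θ, t + 2 * π)) = fun t => f (θ, t) := by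
        funext t
        have : sphPoint θ (t + 2 * π) = sphPoint θ t := by
          ext1
          simp [coe_sphPoint]
        simp only [hf, this]
      rw [h2] at h1
      exact h1.unique (hasDerivAt_snd_slice hfs θ φ)
    have c : Continuous fun φ : ℝ => f₂₂ (θ, φ) := hf₂₂s.continuous.comp (by fun_prop)
    have hI := intervalIntegral.integral_eq_sub_of_hasDerivAt
      (fun φ (_ : φ ∈ uIcc 0 (2 * π)) => hasDerivAt_snd_slice hf₂s θ φ)
      (c.intervalIntegrable _ _)
    rw [hI]
    have := hper 0
    rw [zero_add] at this
    rw [this, sub_self]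
  -- Multiplied by the surface density, only the azimuthal term remains singular at the poles, and
  -- it integrates to zero in `φ` before `θ` is integrated.
  have hlap : ∀ θ ∈ Ioo 0 π, ∀ φ, (sphLaplacian ψ).1 (sphPoint θ φ) * ((sin θ : ℝ) : ℂ) =
      ((cos θ : ℝ) : ℂ) * f₁ (θ, φ) + ((sin θ : ℝ) : ℂ) * f₁₁ (θ, φ) +
        ((sin θ : ℝ) : ℂ)⁻¹ * f₂₂ (θ, φ) := by
    intro θ hθ φ
    have hs : sin θ ≠ 0 := (sin_pos_of_pos_of_lt_pi hθ.1 hθ.2).ne'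
    have hs' : ((sin θ : ℝ) : ℂ) ≠ 0 := by exact_mod_cast hs
    have d1 : (deriv fun t => ψ.1 (sphPoint t φ)) = fun t => f₁ (t, φ) :=
      funext fun t => (hasDerivAt_fst_slice hfs t φ).deriv
    have d2 : (deriv fun t => ψ.1 (sphPoint θ t)) = fun t => f₂ (θ, t) :=
      funext fun t => (hasDerivAt_snd_slice hfs θ t).deriv
    rw [sphLaplacian_apply_sphPoint ψ θ φ hs, d1, d2, (hasDerivAt_fst_slice hf₁s θ φ).deriv,
      (hasDerivAt_snd_slice hf₂s θ φ).deriv, ← hf₁₁, ← hf₂₂]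
    rw [Complex.ofReal_div, Complex.ofReal_div, Complex.ofReal_pow, Complex.ofReal_one]
    field_simp
    ring
  have hcont : Continuous fun p : ℝ × ℝ => P p.1 * (((cos p.1 : ℝ) : ℂ) * f₁ p +
      ((sin p.1 : ℝ) : ℂ) * f₁₁ p) + lam * P p.1 * ((sin p.1 : ℝ) : ℂ) * f p :=
    (((hpolyc _).comp continuous_fst).mul (((hcosc.comp continuous_fst).mul hf₁s.continuous).add
      ((hsinc.comp continuous_fst).mul hf₁₁s.continuous))).add
      (((continuous_const.mul ((hpolyc _).comp continuous_fst)).mul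
        (hsinc.comp continuous_fst)).mul hfs.continuous)
  have hswap : ∫ θ in (0 : ℝ)..π, ∫ φ in (0 : ℝ)..(2 * π), (P θ * (((cos θ : ℝ) : ℂ) * f₁ (θ, φ) +
      ((sin θ : ℝ) : ℂ) * f₁₁ (θ, φ)) + lam * P θ * ((sin θ : ℝ) : ℂ) * f (θ, φ)) = 0 := by
    rw [integral_swap_of_continuous (f := fun θ φ => P θ * (((cos θ : ℝ) : ℂ) * f₁ (θ, φ) +
      ((sin θ : ℝ) : ℂ) * f₁₁ (θ, φ)) + lam * P θ * ((sin θ : ℝ) : ℂ) * f (θ, φ)) hcont _ _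
      pi_pos.le two_pi_pos.le]
    simp only [hlag, intervalIntegral.integral_zero]
  have hc₁ : ∀ θ, Continuous fun φ : ℝ => P θ * (sphLaplacian ψ).1 (sphPoint θ φ) *
      ((sin θ : ℝ) : ℂ) := fun θ => (continuous_const.mul
    ((contDiff_apply_sphPoint (sphLaplacian ψ)).continuous.comp
      (by fun_prop : Continuous fun φ : ℝ => (θ, φ)))).mul continuous_const
  have hc₂ : ∀ θ, Continuous fun φ : ℝ => P θ * ψ.1 (sphPoint θ φ) * ((sin θ : ℝ) : ℂ) :=
    fun θ => (continuous_const.mul (hfs.continuous.comp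
      (by fun_prop : Continuous fun φ : ℝ => (θ, φ)))).mul continuous_const
  have hc₃ : ∀ θ, Continuous fun φ : ℝ => P θ * (((sin θ : ℝ) : ℂ)⁻¹ * f₂₂ (θ, φ)) :=
    fun θ => continuous_const.mul (continuous_const.mul (hf₂₂s.continuous.comp
      (by fun_prop : Continuous fun φ : ℝ => (θ, φ))))
  have hkey : ∀ θ ∈ Ioo 0 π, ∫ φ in (0 : ℝ)..(2 * π), (P θ * (((cos θ : ℝ) : ℂ) * f₁ (θ, φ) +
      ((sin θ : ℝ) : ℂ) * f₁₁ (θ, φ)) + lam * P θ * ((sin θ : ℝ) : ℂ) * f (θ, φ)) =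
      (∫ φ in (0 : ℝ)..(2 * π), P θ * (sphLaplacian ψ).1 (sphPoint θ φ) * ((sin θ : ℝ) : ℂ)) +
        lam * ∫ φ in (0 : ℝ)..(2 * π), P θ * ψ.1 (sphPoint θ φ) * ((sin θ : ℝ) : ℂ) := by
    intro θ hθ
    have h0 : ∫ φ in (0 : ℝ)..(2 * π), P θ * (((sin θ : ℝ) : ℂ)⁻¹ * f₂₂ (θ, φ)) = 0 := by
      rw [intervalIntegral.integral_const_mul, intervalIntegral.integral_const_mul, hazi,
        mul_zero, mul_zero]
    have i₁ := (hc₁ θ).intervalIntegrable (μ := volume) 0 (2 * π)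
    have i₂ := ((hc₂ θ).const_mul lam).intervalIntegrable (μ := volume) 0 (2 * π)
    have i₃ := (hc₃ θ).intervalIntegrable (μ := volume) 0 (2 * π)
    rw [← intervalIntegral.integral_const_mul, ← intervalIntegral.integral_add i₁ i₂,
      ← sub_zero (∫ φ in (0 : ℝ)..(2 * π), (P θ * (sphLaplacian ψ).1 (sphPoint θ φ) *
        ((sin θ : ℝ) : ℂ) + lam * (P θ * ψ.1 (sphPoint θ φ) * ((sin θ : ℝ) : ℂ)))), ← h0,
      ← intervalIntegral.integral_sub (i₁.add i₂) i₃]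
    refine intervalIntegral.integral_congr fun φ _ => ?_
    have := hlap θ hθ φ
    simp only [hf]
    linear_combination (-P θ) * this
  have hcΔ : Continuous (Function.uncurry fun θ φ : ℝ => P θ * (sphLaplacian ψ).1 (sphPoint θ φ) *
      ((sin θ : ℝ) : ℂ)) :=
    (((hpolyc _).comp continuous_fst).mul
      (contDiff_apply_sphPoint (sphLaplacian ψ)).continuous).mul (hsinc.comp continuous_fst)
  have hcψ : Continuous (Function.uncurry fun θ φ : ℝ => P θ * ψ.1 (sphPoint θ φ) *
      ((sin θ : ℝ) : ℂ)) :=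
    (((hpolyc _).comp continuous_fst).mul hfs.continuous).mul (hsinc.comp continuous_fst)
  have hsum : (∫ θ in (0 : ℝ)..π, ∫ φ in (0 : ℝ)..(2 * π), P θ *
      (sphLaplacian ψ).1 (sphPoint θ φ) * ((sin θ : ℝ) : ℂ)) +
      lam * (∫ θ in (0 : ℝ)..π, ∫ φ in (0 : ℝ)..(2 * π), P θ * ψ.1 (sphPoint θ φ) *
        ((sin θ : ℝ) : ℂ)) = 0 := by
    rw [← hswap, ← intervalIntegral.integral_const_mul, ← intervalIntegral.integral_add
      ((intervalIntegral.continuous_parametric_intervalIntegral_of_continuous' hcΔ _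
        _).intervalIntegrable _ _)
      (((intervalIntegral.continuous_parametric_intervalIntegral_of_continuous' hcψ _
        _).const_mul _).intervalIntegrable _ _)]
    refine (intervalIntegral.integral_congr_ae ?_).symm
    -- The coordinate formula fails at `θ = π`, which belongs to the half-open interval of
    -- integration but has measure zero.
    filter_upwards [compl_mem_ae_iff.mpr (measure_singleton π)] with θ hne hθ
    rw [uIoc_of_le pi_pos.le] at hθ
    exact hkey θ ⟨hθ.1, lt_of_le_of_ne hθ.2 hne⟩
  rw [zonalCoeff, zonalCoeff]
  linear_combination ((2 * l + 1) / (4 * π) : ℝ) * hsum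

/-! ### Existence -/

lemma exists_bound_testFun (ψ : TestFun) : ∃ S, ∀ x, ‖ψ.1 x‖ ≤ S := by
  obtain ⟨S, hS⟩ := isCompact_univ.exists_bound_of_continuousOn (continuous_testFun ψ).continuousOn
  exact ⟨S, fun x => hS x (mem_univ x)⟩

/-- The decay rate `√(2l + 1) / (l (l + 1))` of the zonal coefficients. -/
def zonalDecay (l : ℕ) : ℝ := √(2 * l + 1) / ((l * (l + 1) : ℕ) : ℝ)

lemma summable_zonalDecay : Summable zonalDecay := by
  have h : Summable fun n : ℕ => 2 * (1 / (n : ℝ) ^ (3 / 2 : ℝ)) :=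
    (Real.summable_one_div_nat_rpow.mpr (by norm_num)).mul_left 2
  refine Summable.of_nonneg_of_le (fun l => by unfold zonalDecay; positivity) (fun l => ?_) h
  rcases Nat.eq_zero_or_pos l with rfl | hl
  · simp [zonalDecay]
  have hl' : (1 : ℝ) ≤ l := by exact_mod_cast hl
  have hl0 : (0 : ℝ) < l := by linarith
  have h1 : √(2 * (l : ℝ) + 1) ≤ 2 * √l := by
    rw [Real.sqrt_le_left (by positivity), mul_pow, Real.sq_sqrt hl0.le]
    linarith
  have h2 : (l : ℝ) ^ (3 / 2 : ℝ) = l * √l := by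
    rw [show (3 / 2 : ℝ) = 1 + 1 / 2 by norm_num, rpow_add hl0, rpow_one, Real.sqrt_eq_rpow]
  have hs : √(l : ℝ) * √l = l := Real.mul_self_sqrt hl0.le
  have hs0 : 0 < √(l : ℝ) := Real.sqrt_pos.mpr hl0
  rw [zonalDecay, h2]
  push_cast
  rw [mul_one_div, div_le_div_iff₀ (by positivity) (by positivity)]
  calc √(2 * (l : ℝ) + 1) * (l * √l) ≤ 2 * √l * (l * √l) := by gcongr
    _ = 2 * (l * l) := by linear_combination (2 * (l : ℝ)) * hs
    _ ≤ 2 * (l * (l + 1)) := by gcongr; linarith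

/-- The eigenvalue relation exchanges one Laplacian for a division by `l(l+1)`. -/
lemma norm_zonalCoeff_le_decay {l : ℕ} (hl : l ≠ 0) (ψ : TestFun) {S : ℝ}
    (hS : ∀ x, ‖(sphLaplacian ψ).1 x‖ ≤ S) : ‖zonalCoeff l ψ‖ ≤ S * zonalDecay l := by
  have h := norm_zonalCoeff_le l (sphLaplacian ψ) hS
  have hpos : 0 < ((l * (l + 1) : ℕ) : ℝ) := by
    have : 0 < l * (l + 1) := by positivity
    exact_mod_cast this
  rw [zonalCoeff_sphLaplacian, norm_mul, norm_neg, Complex.norm_natCast] at h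
  rw [zonalDecay, mul_div_assoc', le_div_iff₀ hpos]
  linarith

/-- Of two Laplacians, one is spent on the weight `l(l+1)` and the other on summability. -/
lemma summable_norm_zonalCoeff_mul (ψ : TestFun) :
    Summable fun l : ℕ => ((l * (l + 1) : ℕ) : ℝ) * ‖zonalCoeff l ψ‖ := by
  obtain ⟨S, hS⟩ := exists_bound_testFun (sphLaplacian (sphLaplacian ψ))
  have hS0 : 0 ≤ S := (norm_nonneg _).trans (hS (sphPoint 0 0))
  refine Summable.of_nonneg_of_le (fun l => by positivity) (fun l => ?_)
    (summable_zonalDecay.mul_left S)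
  rcases eq_or_ne l 0 with rfl | hl
  · simp [zonalDecay]
  · have := norm_zonalCoeff_le_decay hl _ hS
    rwa [zonalCoeff_sphLaplacian, norm_mul, norm_neg, Complex.norm_natCast] at this

/-- The term `l = 0` has eigenvalue zero and needs its own bound; `zonalDecay 0` is `0` by the
convention for division by zero. -/
lemma norm_zonalCoeff_le_of_bounds {ψ : TestFun} {S₀ S₁ : ℝ} (h₀ : ∀ x, ‖ψ.1 x‖ ≤ S₀)
    (h₁ : ∀ x, ‖(sphLaplacian ψ).1 x‖ ≤ S₁) (l : ℕ) :
    ‖zonalCoeff l ψ‖ ≤ (if l = 0 then S₀ else 0) + S₁ * zonalDecay l := by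
  rcases eq_or_ne l 0 with rfl | hl
  · have := norm_zonalCoeff_le 0 ψ h₀
    simpa [zonalDecay] using this
  · rw [if_neg hl, zero_add]
    exact norm_zonalCoeff_le_decay hl ψ h₁

lemma hasSum_zonal_bound (S₀ S₁ : ℝ) :
    HasSum (fun l : ℕ => (if l = 0 then S₀ else 0) + S₁ * zonalDecay l)
      (S₀ + S₁ * ∑' l, zonalDecay l) :=
  (hasSum_ite_eq 0 S₀).add (summable_zonalDecay.hasSum.mul_left S₁)

lemma summable_norm_zonalCoeff (ψ : TestFun) : Summable fun l : ℕ => ‖zonalCoeff l ψ‖ := by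
  obtain ⟨S₀, h₀⟩ := exists_bound_testFun ψ
  obtain ⟨S₁, h₁⟩ := exists_bound_testFun (sphLaplacian ψ)
  exact Summable.of_nonneg_of_le (fun l => norm_nonneg _)
    (norm_zonalCoeff_le_of_bounds h₀ h₁) (hasSum_zonal_bound S₀ S₁).summable

/-- The expansion of the delta function, which yields the initial condition: on the degenerate
circle at the pole the azimuthal mean is the value itself. -/
lemma hasSum_zonalCoeff (ψ : TestFun) :
    HasSum (fun l => zonalCoeff l ψ) (ψ.1 (sphPoint 0 0)) := by
  rw [← azimuthalMean_one]
  exact hasSum_legendre_series (continuous_azimuthalMean ψ) (fun l => zonalCoeff_eq l ψ)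
    (summable_norm_zonalCoeff ψ)

lemma continuous_zonal_slice (ψ : TestFun) (θ : ℝ) : Continuous fun φ => ψ.1 (sphPoint θ φ) :=
  (contDiff_apply_sphPoint ψ).continuous.comp (by fun_prop : Continuous fun φ : ℝ => (θ, φ))

lemma azimuthalMean_add (ψ χ : TestFun) (x : ℝ) :
    azimuthalMean (ψ + χ) x = azimuthalMean ψ x + azimuthalMean χ x := by
  rw [azimuthalMean, azimuthalMean, azimuthalMean, ← mul_add, ← intervalIntegral.integral_add
    ((continuous_zonal_slice ψ _).intervalIntegrable _ _)
    ((continuous_zonal_slice χ _).intervalIntegrable _ _)]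
  rfl

lemma azimuthalMean_smul (a : ℂ) (ψ : TestFun) (x : ℝ) :
    azimuthalMean (a • ψ) x = a * azimuthalMean ψ x := by
  rw [azimuthalMean, azimuthalMean, mul_left_comm, ← intervalIntegral.integral_const_mul a]
  rfl

lemma zonalCoeff_add (l : ℕ) (ψ χ : TestFun) :
    zonalCoeff l (ψ + χ) = zonalCoeff l ψ + zonalCoeff l χ := by
  have hP : Continuous fun x : ℝ => (((legendre l).eval x : ℝ) : ℂ) :=
    Complex.continuous_ofReal.comp (legendre l).continuous
  have hi : ∀ ψ : TestFun, IntervalIntegrable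
      (fun x => (((legendre l).eval x : ℝ) : ℂ) * azimuthalMean ψ x) volume (-1) 1 := fun ψ =>
    (hP.mul (continuous_azimuthalMean ψ)).intervalIntegrable _ _
  simp only [zonalCoeff_eq, azimuthalMean_add, mul_add ((((legendre l).eval _ : ℝ) : ℂ))]
  rw [intervalIntegral.integral_add (hi ψ) (hi χ), mul_add]

lemma zonalCoeff_smul (l : ℕ) (a : ℂ) (ψ : TestFun) :
    zonalCoeff l (a • ψ) = a * zonalCoeff l ψ := by
  simp only [zonalCoeff_eq, azimuthalMean_smul, mul_left_comm _ a,
    intervalIntegral.integral_const_mul]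

/-! ### Derivatives within a half-open interval from two-sided ones -/

section Calculus

variable {f U U₁ U₂ : ℝ → ℂ} {H : ℝ}

lemma eqOn_derivWithin_of_hasDerivAt (hf : EqOn f U (Ico 0 H))
    (h1 : ∀ t ∈ Ico 0 H, HasDerivAt U (U₁ t) t) : EqOn (derivWithin f (Ico 0 H)) U₁ (Ico 0 H) := by
  intro t ht
  rw [derivWithin_congr hf (hf ht)]
  exact (h1 t ht).hasDerivWithinAt.derivWithin ((uniqueDiffOn_Ico 0 H) t ht)

lemma eqOn_iteratedDerivWithin_two_of_hasDerivAt (hf : EqOn f U (Ico 0 H))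
    (h1 : ∀ t ∈ Ico 0 H, HasDerivAt U (U₁ t) t) (h2 : ∀ t ∈ Ico 0 H, HasDerivAt U₁ (U₂ t) t) :
    EqOn (iteratedDerivWithin 2 f (Ico 0 H)) U₂ (Ico 0 H) := by
  rw [iteratedDerivWithin_succ, iteratedDerivWithin_one]
  exact eqOn_derivWithin_of_hasDerivAt (eqOn_derivWithin_of_hasDerivAt hf h1) h2

lemma contDiffOn_two_of_hasDerivAt (hf : EqOn f U (Ico 0 H))
    (h1 : ∀ t ∈ Ico 0 H, HasDerivAt U (U₁ t) t) (h2 : ∀ t ∈ Ico 0 H, HasDerivAt U₁ (U₂ t) t)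
    (h3 : ContinuousOn U₂ (Ico 0 H)) : ContDiffOn ℝ 2 f (Ico 0 H) := by
  have e1 := eqOn_derivWithin_of_hasDerivAt hf h1
  have e2 := eqOn_iteratedDerivWithin_two_of_hasDerivAt hf h1 h2
  have c0 : DifferentiableOn ℝ f (Ico 0 H) := DifferentiableOn.congr
    (fun t ht => (h1 t ht).differentiableAt.differentiableWithinAt) hf
  have c1 : DifferentiableOn ℝ (derivWithin f (Ico 0 H)) (Ico 0 H) := DifferentiableOn.congr
    (fun t ht => (h2 t ht).differentiableAt.differentiableWithinAt) e1
  refine contDiffOn_of_continuousOn_differentiableOn_deriv (n := 2) ?_ ?_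
  · intro m hm
    have hm' : m ≤ 2 := by exact_mod_cast hm
    interval_cases m
    · simpa only [iteratedDerivWithin_zero] using c0.continuousOn
    · simpa only [iteratedDerivWithin_one] using c1.continuousOn
    · exact h3.congr e2
  · intro m hm
    have hm' : m < 2 := by exact_mod_cast hm
    interval_cases m
    · simpa only [iteratedDerivWithin_zero] using c0
    · simpa only [iteratedDerivWithin_one] using c1

end Calculus

lemma summable_mul_zonalCoeff {w : ℕ → ℝ} (hw : ∀ l, |w l| ≤ 1) (ψ : TestFun) :
    Summable fun l => (w l : ℂ) * zonalCoeff l ψ := by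
  refine Summable.of_norm_bounded (summable_norm_zonalCoeff ψ) fun l => ?_
  rw [norm_mul, Complex.norm_real]
  exact mul_le_of_le_one_left (norm_nonneg _) (hw l)

/-- The linear functional with given bounded zonal multipliers. -/
def zonalFunctional (w : ℕ → ℝ) (hw : ∀ l, |w l| ≤ 1) : TestFun →ₗ[ℂ] ℂ where
  toFun ψ := ∑' l, (w l : ℂ) * zonalCoeff l ψ
  map_add' ψ χ := by
    rw [← (summable_mul_zonalCoeff hw ψ).tsum_add (summable_mul_zonalCoeff hw χ)]
    exact tsum_congr fun l => by rw [zonalCoeff_add, mul_add]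
  map_smul' a ψ := by
    rw [RingHom.id_apply, smul_eq_mul, ← tsum_mul_left]
    exact tsum_congr fun l => by rw [zonalCoeff_smul, mul_left_comm]

lemma norm_apply_le_of_iteratedFDeriv {ψ : TestFun} {M : ℝ} {x : S2}
    (h : ‖iteratedFDeriv ℝ 0 (radialExt ψ.1) (x : E3)‖ ≤ M) : ‖ψ.1 x‖ ≤ M := by
  rwa [norm_iteratedFDeriv_zero, ← apply_eq_radialExt] at h

lemma norm_sphLaplacian_le_of_iteratedFDeriv {ψ : TestFun} {M : ℝ} {x : S2}
    (h : ‖iteratedFDeriv ℝ 2 (radialExt ψ.1) (x : E3)‖ ≤ M) : ‖(sphLaplacian ψ).1 x‖ ≤ 3 * M := by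
  change ‖Δ (radialExt ψ.1) (x : E3)‖ ≤ _
  rw [InnerProductSpace.laplacian_eq_iteratedFDeriv_orthonormalBasis (radialExt ψ.1)
    (EuclideanSpace.basisFun (Fin 3) ℝ)]
  refine (norm_sum_le _ _).trans ((Finset.sum_le_card_nsmul _ _ M fun i _ => ?_).trans ?_)
  · refine ((iteratedFDeriv ℝ 2 (radialExt ψ.1) (x : E3)).le_opNorm _).trans ?_
    simpa [Fin.prod_univ_two] using h
  · simp

lemma isDistribution_zonalFunctional (w : ℕ → ℝ) (hw : ∀ l, |w l| ≤ 1) :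
    IsDistribution (zonalFunctional w hw) := by
  refine ⟨2, 1 + 3 * ∑' l, zonalDecay l, fun ψ M hM => ?_⟩
  have h₀ : ∀ x, ‖ψ.1 x‖ ≤ M := fun x => norm_apply_le_of_iteratedFDeriv (hM 0 (by norm_num) x)
  have h₁ : ∀ x, ‖(sphLaplacian ψ).1 x‖ ≤ 3 * M := fun x =>
    norm_sphLaplacian_le_of_iteratedFDeriv (hM 2 le_rfl x)
  have hs := hasSum_zonal_bound M (3 * M)
  refine (tsum_of_norm_bounded hs fun l => ?_).trans (le_of_eq (by ring))
  rw [norm_mul, Complex.norm_real]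
  exact (mul_le_of_le_one_left (norm_nonneg _) (hw l)).trans (norm_zonalCoeff_le_of_bounds h₀ h₁ l)

lemma freq_sq {c r : ℝ} (l : ℕ) : freq c r l ^ 2 = c ^ 2 / r ^ 2 * ((l * (l + 1) : ℕ) : ℝ) := by
  rw [freq, div_pow, mul_pow, Real.sq_sqrt (by positivity)]
  push_cast
  ring

/-- Here `e'/e = 1/(H - η)` and `c² e/D = 2(ν - 1)/(H - η)`, which explains the choice of `ν`. -/
lemma equation_coeff_eq {c D H η : ℝ} (hc : c ≠ 0) (hD : D ≠ 0) (hη : η < H) (hH : H ≠ 0) :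
    expansion H η / D + deriv (expansion H) η / (c ^ 2 * expansion H η) =
      1 / c ^ 2 * ((2 * order c D H - 1) / (H - η)) := by
  have hs : H - η ≠ 0 := (sub_pos.mpr hη).ne'
  have hd : HasDerivAt (expansion H) (H / (H - η) ^ 2) η := by
    refine ((hasDerivAt_const η H).div ((hasDerivAt_id η).const_sub H) hs).congr_deriv ?_
    simp
  rw [hd.deriv, expansion, order]
  field_simp
  ring

section Existence

variable {c D r H : ℝ}

/-- The solution of the Cauchy problem. -/
def zonalSolution (hc : 0 < c) (hD : 0 < D) (hr : 0 < r) (hH : 0 < H) (η : ℝ) :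
    TestFun →ₗ[ℂ] ℂ := by
  classical
  exact if h : η ∈ Ico 0 H then zonalFunctional (fun l => timeFactor c D r H l η)
    fun l => (isDampedWave_timeFactor hc hD hr hH l).abs_le η h else 0

lemma zonalSolution_of_mem (hc : 0 < c) (hD : 0 < D) (hr : 0 < r) (hH : 0 < H) {η : ℝ}
    (h : η ∈ Ico 0 H) : zonalSolution hc hD hr hH η =
    zonalFunctional (fun l => timeFactor c D r H l η)
      fun l => (isDampedWave_timeFactor hc hD hr hH l).abs_le η h := by
  rw [zonalSolution, dif_pos h]

lemma hasSum_zonalSolution (hc : 0 < c) (hD : 0 < D) (hr : 0 < r) (hH : 0 < H) {η : ℝ}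
    (h : η ∈ Ico 0 H) (ψ : TestFun) :
    HasSum (fun l : ℕ => (timeFactor c D r H l η : ℂ) * zonalCoeff l ψ)
      (zonalSolution hc hD hr hH η ψ) := by
  rw [zonalSolution_of_mem hc hD hr hH h]
  exact (summable_mul_zonalCoeff
    (fun l => (isDampedWave_timeFactor hc hD hr hH l).abs_le η h) ψ).hasSum

lemma summable_bound_waveExt (C : ℝ) (ψ : TestFun) :
    Summable fun l => C * freq c r l ^ 2 * ‖zonalCoeff l ψ‖ := by
  refine ((summable_norm_zonalCoeff_mul ψ).mul_left (C * (c ^ 2 / r ^ 2))).congr fun l => ?_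
  rw [freq_sq]
  ring

lemma norm_ofReal_mul_le {a b : ℝ} {x : ℂ} (h : |a| ≤ b) : ‖(a : ℂ) * x‖ ≤ b * ‖x‖ := by
  rw [norm_mul, Complex.norm_real]
  exact mul_le_mul_of_nonneg_right h (norm_nonneg _)

/-- The pairing of the solution with a test function, extended to negative times. -/
def solutionExt (c D r H : ℝ) (ψ : TestFun) (η : ℝ) : ℂ :=
  ∑' l, ((waveExt (freq c r l) H (order c D H) (timeFactor c D r H l) η : ℝ) : ℂ) * zonalCoeff l ψ

/-- The first derivative of `solutionExt`. -/
def solutionExtDeriv (c D r H : ℝ) (ψ : TestFun) (η : ℝ) : ℂ :=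
  ∑' l, ((waveExtDeriv (freq c r l) H (order c D H) (timeFactor c D r H l) η : ℝ) : ℂ) *
    zonalCoeff l ψ

/-- The second derivative of `solutionExt`. -/
def solutionExtDeriv₂ (c D r H : ℝ) (ψ : TestFun) (η : ℝ) : ℂ :=
  ∑' l, ((waveExtDeriv₂ (freq c r l) H (order c D H) (timeFactor c D r H l) η : ℝ) : ℂ) *
    zonalCoeff l ψ

lemma exists_bound_timeFactor (hc : 0 < c) (hD : 0 < D) (hr : 0 < r) (hH : 0 < H) {b : ℝ}
    (hb : b < H) : ∃ C, ∀ l, ∀ η ∈ Ioo (-1) b,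
      |waveExtDeriv (freq c r l) H (order c D H) (timeFactor c D r H l) η| ≤ C * freq c r l ^ 2 ∧
      |waveExtDeriv₂ (freq c r l) H (order c D H) (timeFactor c D r H l) η| ≤
        C * freq c r l ^ 2 := by
  obtain ⟨C, -, hC⟩ := exists_bound_waveExt (μ := order c D H) hH hb
  exact ⟨C, fun l => hC _ _ (isDampedWave_timeFactor hc hD hr hH l)⟩

lemma exists_mem_Ioo_of_mem_Ico {t : ℝ} (ht : t ∈ Ico 0 H) :
    ∃ b, b < H ∧ t ∈ Ioo (-1) b ∧ (0 : ℝ) ∈ Ioo (-1) b := by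
  obtain ⟨b, hb1, hb2⟩ := exists_between ht.2
  exact ⟨b, hb2, ⟨by linarith [ht.1], hb1⟩, by norm_num, ht.1.trans_lt hb1⟩

/-- Termwise differentiation on the open interval `(-1, b)`, where the differentiated series is
dominated. Convergence at one point is also needed and is taken at `0`, where the series is the
delta expansion. -/
lemma hasDerivAt_solutionExt (hc : 0 < c) (hD : 0 < D) (hr : 0 < r) (hH : 0 < H) (ψ : TestFun)
    {t : ℝ} (ht : t ∈ Ico 0 H) :
    HasDerivAt (solutionExt c D r H ψ) (solutionExtDeriv c D r H ψ t) t := by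
  obtain ⟨b, hb, htb, h0b⟩ := exists_mem_Ioo_of_mem_Ico ht
  obtain ⟨C, hC⟩ := exists_bound_timeFactor hc hD hr hH hb
  refine hasDerivAt_tsum_of_isPreconnected (g := fun l y => ((waveExt (freq c r l) H (order c D H)
      (timeFactor c D r H l) y : ℝ) : ℂ) * zonalCoeff l ψ)
    (g' := fun l y => ((waveExtDeriv (freq c r l) H (order c D H)
      (timeFactor c D r H l) y : ℝ) : ℂ) * zonalCoeff l ψ)
    (summable_bound_waveExt (c := c) (r := r) C ψ) isOpen_Ioo
    isPreconnected_Ioo (fun l y hy => ?_) (fun l y hy => ?_) h0b ?_ htb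
  · exact ((hasDerivAt_waveExt hH (isDampedWave_timeFactor hc hD hr hH l).continuousOn
      (hy.2.trans hb)).ofReal_comp).mul_const _
  · exact norm_ofReal_mul_le (hC l y hy).1
  · simpa only [waveExt_zero, Complex.ofReal_one, one_mul] using (hasSum_zonalCoeff ψ).summable

lemma hasDerivAt_solutionExtDeriv (hc : 0 < c) (hD : 0 < D) (hr : 0 < r) (hH : 0 < H)
    (ψ : TestFun) {t : ℝ} (ht : t ∈ Ico 0 H) :
    HasDerivAt (solutionExtDeriv c D r H ψ) (solutionExtDeriv₂ c D r H ψ t) t := by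
  obtain ⟨b, hb, htb, h0b⟩ := exists_mem_Ioo_of_mem_Ico ht
  obtain ⟨C, hC⟩ := exists_bound_timeFactor hc hD hr hH hb
  refine hasDerivAt_tsum_of_isPreconnected (g := fun l y => ((waveExtDeriv (freq c r l) H (order c D H)
      (timeFactor c D r H l) y : ℝ) : ℂ) * zonalCoeff l ψ)
    (g' := fun l y => ((waveExtDeriv₂ (freq c r l) H (order c D H)
      (timeFactor c D r H l) y : ℝ) : ℂ) * zonalCoeff l ψ)
    (summable_bound_waveExt (c := c) (r := r) C ψ) isOpen_Ioo
    isPreconnected_Ioo (fun l y hy => ?_) (fun l y hy => ?_) h0b ?_ htb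
  · exact ((hasDerivAt_waveExtDeriv hH (isDampedWave_timeFactor hc hD hr hH l).continuousOn
      (hy.2.trans hb)).ofReal_comp).mul_const _
  · exact norm_ofReal_mul_le (hC l y hy).2
  · simpa only [waveExtDeriv_zero, Complex.ofReal_zero, zero_mul] using summable_zero

lemma continuousOn_solutionExtDeriv₂ (hc : 0 < c) (hD : 0 < D) (hr : 0 < r) (hH : 0 < H)
    (ψ : TestFun) : ContinuousOn (solutionExtDeriv₂ c D r H ψ) (Ico 0 H) := by
  intro t ht
  obtain ⟨b, hb, htb, -⟩ := exists_mem_Ioo_of_mem_Ico ht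
  obtain ⟨C, hC⟩ := exists_bound_timeFactor hc hD hr hH hb
  have h : ContinuousOn (solutionExtDeriv₂ c D r H ψ) (Ioo (-1) b) := by
    refine continuousOn_tsum (fun l => ?_) (summable_bound_waveExt (c := c) (r := r) C ψ)
      fun l y hy => norm_ofReal_mul_le (hC l y hy).2
    exact (Complex.continuous_ofReal.comp_continuousOn ((continuousOn_waveExtDeriv₂ hH
      (isDampedWave_timeFactor hc hD hr hH l).continuousOn).mono
        fun y hy => hy.2.trans hb)).mul continuousOn_const
  exact (h.continuousAt (Ioo_mem_nhds htb.1 htb.2)).continuousWithinAt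

lemma solutionExt_equation (hc : 0 < c) (hD : 0 < D) (hr : 0 < r) (hH : 0 < H) (ψ : TestFun)
    {t : ℝ} (ht : t ∈ Ico 0 H) :
    (((2 * order c D H - 1) / (H - t) : ℝ) : ℂ) * solutionExtDeriv c D r H ψ t +
      solutionExtDeriv₂ c D r H ψ t =
      ((c ^ 2 / r ^ 2 : ℝ) : ℂ) * zonalSolution hc hD hr hH t (sphLaplacian ψ) := by
  obtain ⟨b, hb, htb, -⟩ := exists_mem_Ioo_of_mem_Ico ht
  obtain ⟨C, hC⟩ := exists_bound_timeFactor hc hD hr hH hb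
  have s1 : Summable fun l => ((waveExtDeriv (freq c r l) H (order c D H)
      (timeFactor c D r H l) t : ℝ) : ℂ) * zonalCoeff l ψ :=
    Summable.of_norm_bounded (summable_bound_waveExt (c := c) (r := r) C ψ)
      fun l => norm_ofReal_mul_le (hC l t htb).1
  have s2 : Summable fun l => ((waveExtDeriv₂ (freq c r l) H (order c D H)
      (timeFactor c D r H l) t : ℝ) : ℂ) * zonalCoeff l ψ :=
    Summable.of_norm_bounded (summable_bound_waveExt (c := c) (r := r) C ψ)
      fun l => norm_ofReal_mul_le (hC l t htb).2
  rw [solutionExtDeriv, solutionExtDeriv₂, ← tsum_mul_left, ← (s1.mul_left _).tsum_add s2,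
    ← (hasSum_zonalSolution hc hD hr hH ht (sphLaplacian ψ)).tsum_eq, ← tsum_mul_left]
  refine tsum_congr fun l => ?_
  rw [zonalCoeff_sphLaplacian, waveExtDeriv₂, max_eq_left ht.1, freq_sq]
  push_cast
  ring

lemma eqOn_zonalSolution (hc : 0 < c) (hD : 0 < D) (hr : 0 < r) (hH : 0 < H) (ψ : TestFun) :
    EqOn (fun η => zonalSolution hc hD hr hH η ψ) (solutionExt c D r H ψ) (Ico 0 H) := by
  intro t ht
  simp only [solutionExt]
  rw [← (hasSum_zonalSolution hc hD hr hH ht ψ).tsum_eq]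
  exact tsum_congr fun l => by rw [← (isDampedWave_timeFactor hc hD hr hH l).eq_waveExt ht]

lemma isSolution_zonalSolution (hc : 0 < c) (hD : 0 < D) (hr : 0 < r) (hH : 0 < H) :
    IsSolution c D r H (zonalSolution hc hD hr hH) where
  isDistribution η hη := by
    rw [zonalSolution_of_mem hc hD hr hH hη]
    exact isDistribution_zonalFunctional _ _
  contDiffOn ψ := contDiffOn_two_of_hasDerivAt (eqOn_zonalSolution hc hD hr hH ψ)
    (fun _ ht => hasDerivAt_solutionExt hc hD hr hH ψ ht)
    (fun _ ht => hasDerivAt_solutionExtDeriv hc hD hr hH ψ ht)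
    (continuousOn_solutionExtDeriv₂ hc hD hr hH ψ)
  equation ψ η hη := by
    rw [eqOn_derivWithin_of_hasDerivAt (eqOn_zonalSolution hc hD hr hH ψ)
        (fun _ ht => hasDerivAt_solutionExt hc hD hr hH ψ ht) hη,
      eqOn_iteratedDerivWithin_two_of_hasDerivAt (eqOn_zonalSolution hc hD hr hH ψ)
        (fun _ ht => hasDerivAt_solutionExt hc hD hr hH ψ ht)
        (fun _ ht => hasDerivAt_solutionExtDeriv hc hD hr hH ψ ht) hη,
      equation_coeff_eq hc.ne' hD.ne' hη.2 hH.ne']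
    have h := solutionExt_equation hc hD hr hH ψ hη
    have hc' : (c : ℂ) ≠ 0 := by exact_mod_cast hc.ne'
    have h2 : (1 / c ^ 2 : ℂ) * (c ^ 2 / r ^ 2) = 1 / r ^ 2 := by field_simp
    push_cast at h ⊢
    rw [← h2]
    linear_combination (1 / (c : ℂ) ^ 2) * h
  initial ψ := by
    have h0 : (0 : ℝ) ∈ Ico 0 H := ⟨le_rfl, hH⟩
    have h := eqOn_zonalSolution hc hD hr hH ψ h0
    simp only [solutionExt, waveExt_zero, Complex.ofReal_one, one_mul] at h
    rw [h, (hasSum_zonalCoeff ψ).tsum_eq]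
  initial_deriv ψ := by
    rw [eqOn_derivWithin_of_hasDerivAt (eqOn_zonalSolution hc hD hr hH ψ)
      (fun _ ht => hasDerivAt_solutionExt hc hD hr hH ψ ht) ⟨le_rfl, hH⟩]
    simp [solutionExtDeriv, waveExtDeriv_zero]

end Existence

/-! ### Polynomials on the sphere -/

/-- The restriction of a smooth function to the sphere. -/
def restrictSphere (g : E3 → ℂ) (hg : ContDiff ℝ ∞ g) : TestFun :=
  ⟨fun x => g (x : E3), by
    have : Fact (Module.finrank ℝ E3 = 2 + 1) := ⟨by simp⟩
    exact hg.contMDiff.comp (contMDiff_coe_sphere (n := 2))⟩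

lemma norm_coe_sphere (x : S2) : ‖(x : E3)‖ = 1 := mem_sphere_zero_iff_norm.mp x.2

lemma radialExt_eq_of_norm {f : S2 → ℂ} {g : E3 → ℂ} (h : ∀ x : S2, f x = g x) {y : E3}
    (hy : ‖y‖ = 1) : radialExt f y = g y := by
  have := h ⟨y, mem_sphere_zero_iff_norm.mpr hy⟩
  rw [← this, ← radial_coe ⟨y, mem_sphere_zero_iff_norm.mpr hy⟩]
  rfl

lemma radial_smul {s : ℝ} (hs : 0 < s) (x : S2) : radial (s • (x : E3)) = x := by
  ext1
  rw [radial_of_ne (smul_ne_zero hs.ne' (coe_ne_zero x)), norm_smul, norm_coe_sphere,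
    Real.norm_of_nonneg hs.le, smul_smul]
  simp [inv_mul_cancel₀ hs.ne']

/-- The extension is constant along the ray `s ↦ s • x`, whose acceleration is zero. -/
lemma derivs_radialExt_radial {f : S2 → ℂ} (hf : ContMDiff (𝓡 2) 𝓘(ℝ, ℂ) ∞ f) (x : S2) :
    fderiv ℝ (radialExt f) (x : E3) x = 0 ∧
      iteratedFDeriv ℝ 2 (radialExt f) (x : E3) ![(x : E3), (x : E3)] = 0 := by
  have hC := deriv2_comp_curve (g := radialExt f) (t := 1) (γ := fun s => s • (x : E3))
    (γ' := fun _ => (x : E3)) (γ'' := 0)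
    (by simpa using contDiffAt_radialExt hf (coe_ne_zero x))
    (fun s => by simpa using (hasDerivAt_id s).smul_const (x : E3)) (hasDerivAt_const _ _)
  have hC0 : (fun s : ℝ => radialExt f (s • (x : E3))) =ᶠ[𝓝 1] fun _ => f x := by
    filter_upwards [lt_mem_nhds (zero_lt_one (α := ℝ))] with s hs
    rw [radialExt, radial_smul hs]
  have hC1 : deriv (fun s : ℝ => radialExt f (s • (x : E3))) =ᶠ[𝓝 1] fun _ => 0 := by
    simpa using hC0.deriv
  have h1 := hC.1.symm.trans hC1.eq_of_nhds
  have h2 := hC.2.symm.trans hC1.deriv_eq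
  exact ⟨by simpa using h1, by simpa using h2⟩

lemma deriv2_great_circle {g : E3 → ℂ} {x e : E3} (hg : ContDiffAt ℝ ∞ g x) :
    deriv (deriv fun s : ℝ => g (cos s • x + sin s • e)) 0 =
      iteratedFDeriv ℝ 2 g x ![e, e] - fderiv ℝ g x x := by
  have h := deriv2_comp_curve (g := g) (t := 0) (γ := fun s => cos s • x + sin s • e)
    (γ' := fun s => (-sin s) • x + cos s • e) (γ'' := (-cos 0) • x + (-sin 0) • e)
    (by simpa using hg)
    (fun s => ((hasDerivAt_cos s).smul_const _).add ((hasDerivAt_sin s).smul_const _))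
    (((hasDerivAt_sin 0).neg.smul_const _).add ((hasDerivAt_cos 0).smul_const _))
  rw [h.2]
  simp [sub_eq_add_neg]

lemma norm_great_circle {x e : E3} (hx : ‖x‖ = 1) (he : ‖e‖ = 1) (hxe : inner ℝ x e = 0) (s : ℝ) :
    ‖cos s • x + sin s • e‖ = 1 := by
  rw [← sq_eq_sq₀ (norm_nonneg _) zero_le_one, norm_add_sq_real, norm_smul, norm_smul,
    inner_smul_left, inner_smul_right, hxe, hx, he]
  simp

lemma exists_orthonormalBasis_apply_zero {x : E3} (hx : ‖x‖ = 1) :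
    ∃ b : OrthonormalBasis (Fin 3) ℝ E3, b 0 = x := by
  have h : Orthonormal ℝ (({0} : Set (Fin 3)).domRestrict fun _ => x) := by
    refine ⟨fun _ => hx, fun i j hij => (hij (Subsingleton.elim _ _)).elim⟩
  obtain ⟨b, hb⟩ := h.exists_orthonormalBasis_extension_of_card_eq (by simp)
  exact ⟨b, hb 0 rfl⟩

/-- In an orthonormal basis starting with `x`, the radially constant extension and `g` agree along
the great circles in the two tangent directions. The acceleration `-x` of these circles contributes
one radial derivative of `g` for each direction, while the radial derivatives of the extension
vanish. -/
lemma sphLaplacian_restrictSphere (g : E3 → ℂ) (hg : ContDiff ℝ ∞ g) (x : S2) :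
    (sphLaplacian (restrictSphere g hg)).1 x = Δ g (x : E3) -
      iteratedFDeriv ℝ 2 g (x : E3) ![(x : E3), (x : E3)] - 2 * fderiv ℝ g (x : E3) x := by
  set G := radialExt (restrictSphere g hg).1 with hG
  obtain ⟨b, hb⟩ := exists_orthonormalBasis_apply_zero (norm_coe_sphere x)
  have hGs : ContDiffAt ℝ ∞ G (x : E3) :=
    contDiffAt_radialExt (restrictSphere g hg).2 (coe_ne_zero x)
  obtain ⟨h1, h2⟩ := derivs_radialExt_radial (restrictSphere g hg).2 x
  have key : ∀ i, i ≠ 0 → iteratedFDeriv ℝ 2 G (x : E3) ![b i, b i] =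
      iteratedFDeriv ℝ 2 g (x : E3) ![b i, b i] - fderiv ℝ g (x : E3) x := by
    intro i hi
    have e1 := deriv2_great_circle (e := b i) hGs
    have e2 := deriv2_great_circle (e := b i) (hg.contDiffAt (x := (x : E3)))
    have e3 : (fun s : ℝ => G (cos s • (x : E3) + sin s • b i)) =
        fun s : ℝ => g (cos s • (x : E3) + sin s • b i) := by
      funext s
      refine radialExt_eq_of_norm (fun _ => rfl) (norm_great_circle (norm_coe_sphere x)
        (b.orthonormal.1 i) ?_ s)
      rw [← hb]
      exact b.orthonormal.2 hi.symm
    rw [← e2, ← e3, e1, h1, sub_zero]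
  change Δ G (x : E3) = _
  rw [InnerProductSpace.laplacian_eq_iteratedFDeriv_orthonormalBasis G b,
    InnerProductSpace.laplacian_eq_iteratedFDeriv_orthonormalBasis g b]
  simp only [Fin.sum_univ_three]
  rw [key 1 (by simp), key 2 (by simp), hb, h2]
  ring

/-- The function on `ℝ³` defined by a complex polynomial. -/
def polyFun (Q : MvPolynomial (Fin 3) ℂ) (y : E3) : ℂ := MvPolynomial.eval (fun i => (y i : ℂ)) Q

lemma contDiff_coord (i : Fin 3) : ContDiff ℝ ∞ fun y : E3 => (y i : ℂ) :=
  Complex.ofRealCLM.contDiff.comp (EuclideanSpace.proj i : E3 →L[ℝ] ℝ).contDiff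

lemma contDiff_polyFun (Q : MvPolynomial (Fin 3) ℂ) : ContDiff ℝ ∞ (polyFun Q) := by
  induction Q using MvPolynomial.induction_on with
  | C a =>
    have h : polyFun (MvPolynomial.C a) = fun _ => a := by
      funext y
      simp [polyFun]
    rw [h]
    exact contDiff_const
  | add p q hp hq =>
    have h : polyFun (p + q) = polyFun p + polyFun q := by
      funext y
      simp [polyFun]
    rw [h]
    exact hp.add hq
  | mul_X p i hp =>
    have h : polyFun (p * MvPolynomial.X i) = fun y => polyFun p y * (y i : ℂ) := by
      funext y
      simp [polyFun]
    rw [h]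
    exact hp.mul (contDiff_coord i)

/-- The restriction of a polynomial to the sphere. -/
def polyTest : MvPolynomial (Fin 3) ℂ →ₗ[ℂ] TestFun where
  toFun Q := restrictSphere (polyFun Q) (contDiff_polyFun Q)
  map_add' p q := by
    ext x
    simp [restrictSphere, polyFun]
  map_smul' a p := by
    ext x
    simp [restrictSphere, polyFun, MvPolynomial.smul_eval]

lemma hasFDerivAt_coord (i : Fin 3) (y : E3) : HasFDerivAt (fun y : E3 => (y i : ℂ))
    (Complex.ofRealCLM.comp (EuclideanSpace.proj i : E3 →L[ℝ] ℝ)) y :=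
  (Complex.ofRealCLM.comp (EuclideanSpace.proj i : E3 →L[ℝ] ℝ)).hasFDerivAt

lemma fderiv_polyFun_single (Q : MvPolynomial (Fin 3) ℂ) (y : E3) (i : Fin 3) :
    fderiv ℝ (polyFun Q) y (EuclideanSpace.single i 1) = polyFun (MvPolynomial.pderiv i Q) y := by
  induction Q using MvPolynomial.induction_on with
  | C a =>
    have : polyFun (MvPolynomial.C a) = fun _ => a := by
      funext y
      simp [polyFun]
    simp [this, polyFun]
  | add p q hp hq =>
    have h : polyFun (p + q) = polyFun p + polyFun q := by
      funext y
      simp [polyFun]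
    rw [h, fderiv_add ((contDiff_polyFun p).differentiable (by simp) y)
      ((contDiff_polyFun q).differentiable (by simp) y), add_apply, hp, hq]
    simp [polyFun]
  | mul_X p j hp =>
    have h : polyFun (p * MvPolynomial.X j) = polyFun p * fun y : E3 => (y j : ℂ) := by
      funext y
      simp [polyFun]
    have hd := ((contDiff_polyFun p).differentiable (by simp) y).hasFDerivAt.mul
      (hasFDerivAt_coord j y)
    rw [h, hd.fderiv]
    simp only [add_apply, smul_apply, hp]
    by_cases hij : j = i
    · subst hij
      simp [polyFun, mul_comm]
    · simp [polyFun, hij, mul_comm, MvPolynomial.pderiv_X]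

/-- The Laplacian of a polynomial. -/
def polyLaplacian (Q : MvPolynomial (Fin 3) ℂ) : MvPolynomial (Fin 3) ℂ :=
  ∑ i, MvPolynomial.pderiv i (MvPolynomial.pderiv i Q)

lemma laplacian_polyFun (Q : MvPolynomial (Fin 3) ℂ) (y : E3) :
    Δ (polyFun Q) y = polyFun (polyLaplacian Q) y := by
  rw [InnerProductSpace.laplacian_eq_iteratedFDeriv_orthonormalBasis (polyFun Q)
      (EuclideanSpace.basisFun (Fin 3) ℝ)]
  have : polyFun (polyLaplacian Q) y =
      ∑ i, polyFun (MvPolynomial.pderiv i (MvPolynomial.pderiv i Q)) y := by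
    simp [polyFun, polyLaplacian]
  rw [this]
  refine Finset.sum_congr rfl fun i _ => ?_
  rw [← fderiv_polyFun_single, iteratedFDeriv_two_apply]
  have hd : DifferentiableAt ℝ (fderiv ℝ (polyFun Q)) y :=
    ((contDiff_polyFun Q).fderiv_right (m := 1) (by exact WithTop.coe_le_coe.mpr le_top)).differentiable
      (by simp) y
  have h2 : polyFun (MvPolynomial.pderiv i Q) =
      fun z => fderiv ℝ (polyFun Q) z (EuclideanSpace.single i 1) :=
    funext fun z => (fderiv_polyFun_single Q z i).symm
  rw [h2, fderiv_clm_apply hd (differentiableAt_const _)]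
  simp

lemma polyFun_smul {Q : MvPolynomial (Fin 3) ℂ} {n : ℕ} (hQ : Q.IsHomogeneous n) (s : ℝ) (y : E3) :
    polyFun Q (s • y) = (s : ℂ) ^ n * polyFun Q y := by
  simp only [polyFun, MvPolynomial.eval_eq', Finset.mul_sum]
  refine Finset.sum_congr rfl fun d hd => ?_
  have h : ∑ i, d i = n := by
    rw [← Finsupp.degree_eq_sum, Finsupp.degree_eq_weight_one]
    exact hQ (MvPolynomial.mem_support_iff.mp hd)
  simp only [PiLp.smul_apply, smul_eq_mul, Complex.ofReal_mul, mul_pow, Finset.prod_mul_distrib,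
    Finset.prod_pow_eq_pow_sum, h]
  ring

/-- Euler's identities: differentiate `Q(s x) = s^n Q(x)` once and twice at `s = 1`. -/
lemma euler_polyFun {Q : MvPolynomial (Fin 3) ℂ} {n : ℕ} (hQ : Q.IsHomogeneous n) (x : E3) :
    fderiv ℝ (polyFun Q) x x = n * polyFun Q x ∧
      iteratedFDeriv ℝ 2 (polyFun Q) x ![x, x] = n * (n - 1) * polyFun Q x := by
  have hC := deriv2_comp_curve (g := polyFun Q) (t := 1) (γ := fun s => s • x)
    (γ' := fun _ => x) (γ'' := 0) (contDiff_polyFun Q).contDiffAt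
    (fun s => by simpa using (hasDerivAt_id s).smul_const x) (hasDerivAt_const _ _)
  have h0 : (fun s : ℝ => polyFun Q (s • x)) = fun s : ℝ => (s : ℂ) ^ n * polyFun Q x :=
    funext fun s => polyFun_smul hQ s x
  have hp : ∀ (m : ℕ) (a : ℂ) (s : ℝ), HasDerivAt (fun s : ℝ => (s : ℂ) ^ m * a)
      (m * (s : ℂ) ^ (m - 1) * a) s := by
    intro m a s
    simpa using ((hasDerivAt_pow m (s : ℂ)).comp_ofReal).mul_const a
  have h1 : deriv (fun s : ℝ => polyFun Q (s • x)) =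
      fun s : ℝ => (s : ℂ) ^ (n - 1) * (n * polyFun Q x) := by
    rw [h0]
    funext s
    rw [(hp n _ s).deriv]
    ring
  rw [h1, (hp _ _ _).deriv] at hC
  simp only [one_smul, map_zero, add_zero, Complex.ofReal_one, one_pow, one_mul, mul_one] at hC
  refine ⟨hC.1.symm, hC.2.symm.trans ?_⟩
  rcases n with _ | n
  · simp
  · push_cast
    simp
    ring

/-- Euler's identities contribute `n(n-1) + 2n = n(n+1)`. Up to a polynomial of lower degree, `Q` is
thus an eigenfunction, so uniqueness needs no harmonic decomposition. -/
lemma sphLaplacian_polyTest {Q : MvPolynomial (Fin 3) ℂ} {n : ℕ} (hQ : Q.IsHomogeneous n) :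
    sphLaplacian (polyTest Q) =
      polyTest (polyLaplacian Q) - ((n * (n + 1) : ℝ) : ℂ) • polyTest Q := by
  ext x
  obtain ⟨h1, h2⟩ := euler_polyFun hQ (x : E3)
  change (sphLaplacian (restrictSphere (polyFun Q) (contDiff_polyFun Q))).1 x =
    polyFun (polyLaplacian Q) x - ((n * (n + 1) : ℝ) : ℂ) * polyFun Q x
  rw [sphLaplacian_restrictSphere, laplacian_polyFun, h1, h2]
  push_cast
  ring

lemma isHomogeneous_polyLaplacian {Q : MvPolynomial (Fin 3) ℂ} {n : ℕ} (hQ : Q.IsHomogeneous n) :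
    (polyLaplacian Q).IsHomogeneous (n - 1 - 1) :=
  MvPolynomial.IsHomogeneous.sum _ _ _ fun _ _ => hQ.pderiv.pderiv

lemma polyLaplacian_eq_zero {Q : MvPolynomial (Fin 3) ℂ} {n : ℕ} (hQ : Q.IsHomogeneous n)
    (hn : n < 2) : polyLaplacian Q = 0 := by
  refine Finset.sum_eq_zero fun i _ => ?_
  have h : (MvPolynomial.pderiv i Q).IsHomogeneous 0 := by
    have := hQ.pderiv (i := i)
    rwa [show n - 1 = 0 by omega] at this
  rw [MvPolynomial.totalDegree_eq_zero_iff_eq_C.mp (Nat.le_zero.mp h.totalDegree_le)]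
  simp

/-! ### Density of the polynomials -/

/-- The convolution of a scalar function with a vector-valued function on `ℝ³`. -/
def convol {F : Type} [NormedAddCommGroup F] [NormedSpace ℝ F] (p : E3 → ℝ) (f : E3 → F) : E3 → F :=
  convolution p f (ContinuousLinearMap.lsmul ℝ ℝ) volume

lemma convol_apply {F : Type} [NormedAddCommGroup F] [NormedSpace ℝ F] (p : E3 → ℝ) (f : E3 → F)
    (x : E3) : convol p f x = ∫ t, p t • f (x - t) := rfl

lemma hasCompactSupport_of_tsupport {F : Type} [NormedAddCommGroup F] {f : E3 → F} {R : ℝ}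
    (hf : tsupport f ⊆ Metric.closedBall 0 R) : HasCompactSupport f :=
  (isCompact_closedBall _ _).of_isClosed_subset (isClosed_tsupport f) hf

/-- The derivative is put on the compactly supported factor, so approximating derivatives reduces to
uniform approximation with `f` replaced by its derivatives. -/
lemma hasFDerivAt_convol {F : Type} [NormedAddCommGroup F] [NormedSpace ℝ F] [CompleteSpace F]
    {p : E3 → ℝ} (hp : Continuous p) {f : E3 → F} (hf : ContDiff ℝ ∞ f) (hc : HasCompactSupport f)
    (x : E3) : HasFDerivAt (convol p f) (convol p (fderiv ℝ f) x) x := by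
  have h := hc.hasFDerivAt_convolution_right (ContinuousLinearMap.lsmul ℝ ℝ) (μ := volume)
    hp.locallyIntegrable (hf.of_le (by exact_mod_cast le_top)) x
  have hL : (ContinuousLinearMap.lsmul ℝ ℝ : ℝ →L[ℝ] F →L[ℝ] F).precompR E3 =
      ContinuousLinearMap.lsmul ℝ ℝ := by
    ext a L
    simp [ContinuousLinearMap.precompR_apply]
  rw [hL] at h
  exact h

lemma integrable_convol {F : Type} [NormedAddCommGroup F] [NormedSpace ℝ F]
    {p : E3 → ℝ} (hp : Continuous p) {f : E3 → F} (hf : Continuous f) (hc : HasCompactSupport f)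
    (x : E3) : Integrable fun t => p t • f (x - t) :=
  (hp.smul (hf.comp (continuous_const.sub continuous_id))).integrable_of_hasCompactSupport
    ((hc.comp_homeomorph (Homeomorph.subLeft x)).smul_left)

/-- Convolution with the bumps approximates `f` by uniform continuity, and replacing a bump by `p j`
costs at most `∫ ‖f‖ / (j + 1)`. Radius `3` suffices: for `x` on the unit sphere and `x - t` in the
support of `f`, `‖t‖ ≤ 1 + 2`. -/
lemma eventually_norm_convol_sub_le {F : Type} [NormedAddCommGroup F] [NormedSpace ℝ F]
    [CompleteSpace F] {p : ℕ → E3 → ℝ} (hp : ∀ j, Continuous (p j)) {φ : ℕ → ContDiffBump (0 : E3)}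
    (hφ : Tendsto (fun j => (φ j).rOut) atTop (𝓝 0))
    (hpφ : ∀ j : ℕ, ∀ t, ‖t‖ ≤ 3 → |p j t - (φ j).normed volume t| ≤ 1 / ((j : ℝ) + 1))
    {f : E3 → F} (hf : Continuous f) (hs : tsupport f ⊆ Metric.closedBall 0 2) {ε : ℝ}
    (hε : 0 < ε) : ∀ᶠ j in atTop, ∀ x : S2, ‖convol (p j) f x - f x‖ ≤ ε := by
  have hc := hasCompactSupport_of_tsupport hs
  obtain ⟨δ, hδ, hu⟩ := Metric.uniformContinuous_iff.mp (hc.uniformContinuous_of_continuous hf)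
    (ε / 2) (half_pos hε)
  set I := ∫ t, ‖f t‖ with hI
  have hI0 : 0 ≤ I := integral_nonneg fun _ => norm_nonneg _
  have hlim : Tendsto (fun j : ℕ => 1 / ((j : ℝ) + 1) * I) atTop (𝓝 0) := by
    simpa using tendsto_one_div_add_atTop_nhds_zero_nat.mul_const I
  filter_upwards [hφ.eventually (gt_mem_nhds hδ), hlim.eventually (ge_mem_nhds (half_pos hε))]
    with j h1 h2 x
  have hb : ‖convol ((φ j).normed volume) f x - f x‖ ≤ ε / 2 := by
    rw [← dist_eq_norm]
    refine (φ j).dist_normed_convolution_le hf.aestronglyMeasurable fun y hy => ?_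
    exact (hu ((Metric.mem_ball.mp hy).trans h1)).le
  have hd : ‖convol (p j) f x - convol ((φ j).normed volume) f x‖ ≤ 1 / ((j : ℝ) + 1) * I := by
    have hcn : Continuous ((φ j).normed (volume : Measure E3)) := (φ j).continuous_normed
    rw [convol_apply, convol_apply, ← integral_sub (integrable_convol (hp j) hf hc _)
      (integrable_convol hcn hf hc _)]
    have hI2 : I = ∫ t, ‖f ((x : E3) - t)‖ := (integral_sub_left_eq_self (fun t => ‖f t‖) _ _).symm
    rw [hI2, ← integral_const_mul]
    refine norm_integral_le_of_norm_le ?_ (Eventually.of_forall fun t => ?_)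
    · exact ((hf.integrable_of_hasCompactSupport hc).norm.comp_sub_left (x : E3)).const_mul _
    · rw [← sub_smul, norm_smul]
      by_cases ht : ‖t‖ ≤ 3
      · exact mul_le_mul_of_nonneg_right (hpφ j t ht) (norm_nonneg _)
      · have : f ((x : E3) - t) = 0 := by
          by_contra hne
          have h3 := hs (subset_tsupport f hne)
          rw [mem_closedBall_zero_iff] at h3
          have h4 : ‖t‖ ≤ ‖(x : E3)‖ + ‖(x : E3) - t‖ := by
            have := norm_sub_le (x : E3) ((x : E3) - t)
            rwa [sub_sub_cancel] at this
          rw [norm_coe_sphere] at h4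
          linarith
        simp [this]
  calc _ ≤ ‖convol (p j) f x - convol ((φ j).normed volume) f x‖ +
        ‖convol ((φ j).normed volume) f x - f x‖ := norm_sub_le_norm_sub_add_norm_sub _ _ _
    _ ≤ ε / 2 + ε / 2 := add_le_add (hd.trans h2) hb
    _ = ε := add_halves ε

/-- The target space is quantified inside the induction because the step passes from `f` to `fderiv
ℝ f`. -/
lemma eventually_norm_iteratedFDeriv_convol_sub_le {p : ℕ → E3 → ℝ} (hp : ∀ j, Continuous (p j))
    {φ : ℕ → ContDiffBump (0 : E3)} (hφ : Tendsto (fun j => (φ j).rOut) atTop (𝓝 0))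
    (hpφ : ∀ j : ℕ, ∀ t, ‖t‖ ≤ 3 → |p j t - (φ j).normed volume t| ≤ 1 / ((j : ℝ) + 1))
    {ε : ℝ} (hε : 0 < ε) (k : ℕ) : ∀ {F : Type} [NormedAddCommGroup F] [NormedSpace ℝ F]
    [CompleteSpace F] {f : E3 → F}, ContDiff ℝ ∞ f → tsupport f ⊆ Metric.closedBall 0 2 →
    ∀ᶠ j in atTop, ∀ x : S2,
      ‖iteratedFDeriv ℝ k (fun y => convol (p j) f y - f y) (x : E3)‖ ≤ ε := by
  induction k with
  | zero =>
    intro F _ _ _ f hf hs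
    simpa using eventually_norm_convol_sub_le hp hφ hpφ hf.continuous hs hε
  | succ k ih =>
    intro F _ _ _ f hf hs
    have h := ih (f := fderiv ℝ f) (hf.fderiv_right (m := ∞) (by exact le_rfl))
      ((tsupport_fderiv_subset ℝ).trans hs)
    filter_upwards [h] with j hj x
    have hd : fderiv ℝ (fun y => convol (p j) f y - f y) =
        fun y => convol (p j) (fderiv ℝ f) y - fderiv ℝ f y := by
      funext y
      exact ((hasFDerivAt_convol (hp j) hf (hasCompactSupport_of_tsupport hs) y).sub
        (hf.differentiable (by simp) y).hasFDerivAt).fderiv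
    rw [← norm_iteratedFDeriv_fderiv, hd]
    exact hj x

/-- The real-valued function on `ℝ³` defined by a real polynomial. -/
def realPolyFun (Q : MvPolynomial (Fin 3) ℝ) (y : E3) : ℝ := MvPolynomial.eval (fun i => y i) Q

lemma realPolyFun_mul_X (Q : MvPolynomial (Fin 3) ℝ) (i : Fin 3) (y : E3) :
    realPolyFun (Q * MvPolynomial.X i) y = realPolyFun Q y * y i := by
  simp [realPolyFun]

lemma continuous_realPolyFun (Q : MvPolynomial (Fin 3) ℝ) : Continuous (realPolyFun Q) := by
  have : realPolyFun Q = fun y : E3 => MvPolynomial.eval (fun i => y i) Q := rfl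
  rw [this]
  exact (MvPolynomial.continuous_eval Q).comp (by fun_prop)

/-- Writing `t_i = x_i - (x - t)_i` moves a coordinate factor either out of the integral or onto
`f`, which is why `f` varies in the induction. -/
lemma exists_polyFun_eq_convol (Q : MvPolynomial (Fin 3) ℝ) : ∀ {f : E3 → ℂ}, Continuous f →
    HasCompactSupport f → ∃ R, polyFun R = convol (realPolyFun Q) f := by
  induction Q using MvPolynomial.induction_on with
  | C a =>
    intro f hf hc
    refine ⟨MvPolynomial.C (a • ∫ t, f t), ?_⟩
    funext x
    have h : ∀ t, realPolyFun (MvPolynomial.C a) t = a := fun t => by simp [realPolyFun]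
    simp only [convol_apply, h, integral_smul, integral_sub_left_eq_self f volume x]
    simp [polyFun]
  | add p q hp hq =>
    intro f hf hc
    obtain ⟨R, hR⟩ := hp hf hc
    obtain ⟨S, hS⟩ := hq hf hc
    refine ⟨R + S, ?_⟩
    funext x
    have h : ∀ t, realPolyFun (p + q) t = realPolyFun p t + realPolyFun q t :=
      fun t => by simp [realPolyFun]
    have h2 : polyFun (R + S) x = polyFun R x + polyFun S x := by simp [polyFun]
    rw [h2, hR, hS]
    simp only [convol_apply, h, add_smul]
    exact (integral_add (integrable_convol (continuous_realPolyFun p) hf hc x)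
      (integrable_convol (continuous_realPolyFun q) hf hc x)).symm
  | mul_X p i hp =>
    intro f hf hc
    have hg : Continuous fun y : E3 => (y i : ℂ) * f y := (contDiff_coord i).continuous.mul hf
    have hgc : HasCompactSupport fun y : E3 => (y i : ℂ) * f y := hc.mul_left
    obtain ⟨R, hR⟩ := hp hf hc
    obtain ⟨S, hS⟩ := hp hg hgc
    refine ⟨R * MvPolynomial.X i - S, ?_⟩
    funext x
    have h2 : polyFun (R * MvPolynomial.X i - S) x = (x i : ℂ) * polyFun R x - polyFun S x := by
      simp [polyFun, mul_comm]
    rw [h2, hR, hS]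
    simp only [convol_apply]
    rw [← integral_const_mul, ← integral_sub
      ((integrable_convol (continuous_realPolyFun p) hf hc x).const_mul _)
      (integrable_convol (continuous_realPolyFun p) hg hgc x)]
    refine integral_congr_ae (Eventually.of_forall fun t => ?_)
    simp only [realPolyFun_mul_X, Complex.real_smul, PiLp.sub_apply]
    push_cast
    ring

/-- The coordinates of `ℝ³` as continuous functions. -/
def coordMap (i : Fin 3) : C(E3, ℝ) := ⟨fun y => y i, by fun_prop⟩

lemma aeval_coordMap (Q : MvPolynomial (Fin 3) ℝ) (t : E3) :
    (MvPolynomial.aeval coordMap Q : C(E3, ℝ)) t = realPolyFun Q t := by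
  induction Q using MvPolynomial.induction_on with
  | C a => simp [realPolyFun]
  | add p q hp hq => simp only [map_add, ContinuousMap.add_apply, hp, hq, realPolyFun]
  | mul_X p i hp =>
    rw [map_mul, ContinuousMap.mul_apply, hp, MvPolynomial.aeval_X, realPolyFun_mul_X]
    rfl

lemma exists_realPolyFun_near {g : E3 → ℝ} (hg : Continuous g) (R : ℝ) {ε : ℝ} (hε : 0 < ε) :
    ∃ Q, ∀ t, ‖t‖ ≤ R → |realPolyFun Q t - g t| ≤ ε := by
  let A : Subalgebra ℝ C(E3, ℝ) := (MvPolynomial.aeval (R := ℝ) coordMap).range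
  have hA : A.SeparatesPoints := by
    intro x y hxy
    obtain ⟨i, hi⟩ : ∃ i, x i ≠ y i := by
      by_contra! h
      exact hxy (PiLp.ext h)
    exact ⟨coordMap i, ⟨coordMap i, ⟨MvPolynomial.X i, MvPolynomial.aeval_X _ _⟩, rfl⟩, hi⟩
  obtain ⟨a, ⟨Q, rfl⟩, h⟩ :=
    ContinuousMap.exists_mem_subalgebra_near_continuous_of_isCompact_of_separatesPoints hA ⟨g, hg⟩
      (isCompact_closedBall (0 : E3) R) hε
  refine ⟨Q, fun t ht => ?_⟩
  rw [← aeval_coordMap]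
  exact (h t (mem_closedBall_zero_iff.mpr ht)).le

/-- Weierstrass' argument: mollify by polynomials close to shrinking normalized bumps. The resulting
convolutions are polynomials. -/
lemma exists_polyFun_near {f : E3 → ℂ} (hf : ContDiff ℝ ∞ f)
    (hs : tsupport f ⊆ Metric.closedBall 0 2) (N : ℕ) {ε : ℝ} (hε : 0 < ε) :
    ∃ R, ∀ k ≤ N, ∀ x : S2, ‖iteratedFDeriv ℝ k (fun y => polyFun R y - f y) (x : E3)‖ ≤ ε := by
  let φ : ℕ → ContDiffBump (0 : E3) := fun j =>
    ⟨1 / (2 * ((j : ℝ) + 1)), 1 / ((j : ℝ) + 1), by positivity,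
      one_div_lt_one_div_of_lt (by positivity) (by linarith [j.cast_nonneg (α := ℝ)])⟩
  have hφ : Tendsto (fun j => (φ j).rOut) atTop (𝓝 0) := tendsto_one_div_add_atTop_nhds_zero_nat
  have hQ : ∀ j : ℕ, ∃ Q, ∀ t, ‖t‖ ≤ 3 →
      |realPolyFun Q t - (φ j).normed volume t| ≤ 1 / ((j : ℝ) + 1) := fun j =>
    exists_realPolyFun_near (φ j).continuous_normed 3 (by positivity)
  choose Q hQ using hQ
  have h : ∀ᶠ j in atTop, ∀ k ∈ Finset.range (N + 1), ∀ x : S2,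
      ‖iteratedFDeriv ℝ k (fun y => convol (realPolyFun (Q j)) f y - f y) (x : E3)‖ ≤ ε :=
    (Finset.eventually_all _).mpr fun k _ => eventually_norm_iteratedFDeriv_convol_sub_le
      (fun j => continuous_realPolyFun (Q j)) hφ hQ hε k hf hs
  obtain ⟨j, hj⟩ := h.exists
  obtain ⟨R, hR⟩ := exists_polyFun_eq_convol (Q j) hf.continuous (hasCompactSupport_of_tsupport hs)
  refine ⟨R, fun k hk x => ?_⟩
  rw [hR]
  exact hj k (Finset.mem_range.mpr (Nat.lt_succ_of_le hk)) x

lemma exists_contDiff_extension (ψ : TestFun) : ∃ f : E3 → ℂ, ContDiff ℝ ∞ f ∧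
    tsupport f ⊆ Metric.closedBall 0 2 ∧ ∀ x : S2, f x = ψ.1 x := by
  -- Evaluated at `‖y‖²`, this cutoff is `1` on the sphere and vanishes when `‖y‖²` is at least
  -- `1/2` away from `1`. It removes the singularity at the origin and confines the support to the
  -- ball of radius `2`.
  let b : ContDiffBump (1 : ℝ) := ⟨1 / 4, 1 / 2, by norm_num, by norm_num⟩
  have hb0 : ∀ y : E3, 1 / 2 ≤ |‖y‖ ^ 2 - 1| → b (‖y‖ ^ 2) = 0 := fun y hy =>
    b.zero_of_le_dist hy
  refine ⟨fun y => b (‖y‖ ^ 2) • radialExt ψ.1 y, contDiff_iff_contDiffAt.mpr fun y => ?_,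
    closure_minimal (fun y hy => ?_) Metric.isClosed_closedBall, fun x => ?_⟩
  · by_cases hy : y = 0
    · have h0 : ∀ᶠ z : E3 in 𝓝 0, ‖z‖ ^ 2 < 1 / 2 := by
        have : Continuous fun z : E3 => ‖z‖ ^ 2 := by fun_prop
        exact this.continuousAt.eventually (gt_mem_nhds (by norm_num))
      have h1 : (fun y => b (‖y‖ ^ 2) • radialExt ψ.1 y) =ᶠ[𝓝 y] fun _ => 0 := by
        rw [hy]
        filter_upwards [h0] with z hz
        rw [hb0 z (by rw [abs_of_nonpos] <;> linarith), zero_smul]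
      exact contDiffAt_const.congr_of_eventuallyEq h1
    · exact (b.contDiff.comp (contDiff_norm_sq ℝ)).contDiffAt.smul (contDiffAt_radialExt ψ.2 hy)
  · rw [mem_closedBall_zero_iff]
    by_contra! h
    refine hy ?_
    simp only
    rw [hb0 y (by rw [abs_of_nonneg] <;> nlinarith), zero_smul]
  · simp only [norm_coe_sphere, ← apply_eq_radialExt]
    rw [one_pow, b.one_of_mem_closedBall (Metric.mem_closedBall_self b.rIn_pos.le), one_smul]

lemma exists_bound_iteratedFDeriv_unit (N : ℕ) : ∃ B : ℝ, 1 ≤ B ∧ ∀ i ≤ N, ∀ x : S2,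
    ‖iteratedFDeriv ℝ i (fun y : E3 => ‖y‖⁻¹ • y) (x : E3)‖ ≤ B := by
  have h : ∀ i : ℕ, ∃ C : ℝ, ∀ x : S2, ‖iteratedFDeriv ℝ i (fun y : E3 => ‖y‖⁻¹ • y) (x : E3)‖ ≤ C := by
    intro i
    have hc : Continuous fun x : S2 => iteratedFDeriv ℝ i (fun y : E3 => ‖y‖⁻¹ • y) (x : E3) := by
      refine continuous_iff_continuousAt.mpr fun x => ?_
      have h1 : ContDiffAt ℝ ∞ (fun w : E3 => ‖w‖⁻¹ • w) (x : E3) :=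
        ((contDiffAt_norm ℝ (coe_ne_zero x)).inv (norm_ne_zero_iff.mpr (coe_ne_zero x))).smul
          contDiffAt_id
      have h2 : ContDiffAt ℝ 0 (iteratedFDeriv ℝ i (fun w : E3 => ‖w‖⁻¹ • w)) (x : E3) :=
        h1.iteratedFDeriv_right (by rw [zero_add]; exact_mod_cast le_top)
      exact h2.continuousAt.comp continuous_subtype_val.continuousAt
    obtain ⟨C, hC⟩ := (isCompact_univ.bddAbove_image hc.norm.continuousOn)
    exact ⟨C, fun x => hC ⟨x, mem_univ _, rfl⟩⟩
  choose C hC using h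
  refine ⟨1 + ∑ i ∈ Finset.range (N + 1), |C i|, ?_, fun i hi x => ?_⟩
  · exact le_add_of_nonneg_right (Finset.sum_nonneg fun _ _ => abs_nonneg _)
  · have := Finset.single_le_sum (f := fun i => |C i|) (fun _ _ => abs_nonneg _)
      (Finset.mem_range.mpr (Nat.lt_succ_of_le hi))
    have h2 := (hC i x).trans (le_abs_self _)
    linarith

/-- The norms of test functions are those of the radial extension, while the approximation controls
`g`. Away from the origin the extension is `g` composed with `y ↦ ‖y‖⁻¹ • y`, so the Faà di Bruno
estimate compares them; `B ≥ 1` allows one power `B ^ N` for all orders. -/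
lemma norm_iteratedFDeriv_radialExt_le {χ : TestFun} {g : E3 → ℂ} (hg : ContDiff ℝ ∞ g)
    (hχ : ∀ x : S2, χ.1 x = g x) {N : ℕ} {B ε : ℝ} (hB : 1 ≤ B)
    (hu : ∀ i ≤ N, ∀ x : S2, ‖iteratedFDeriv ℝ i (fun y : E3 => ‖y‖⁻¹ • y) (x : E3)‖ ≤ B)
    (h : ∀ k ≤ N, ∀ x : S2, ‖iteratedFDeriv ℝ k g (x : E3)‖ ≤ ε) {k : ℕ} (hk : k ≤ N) (x : S2) :
    ‖iteratedFDeriv ℝ k (radialExt χ.1) (x : E3)‖ ≤ N.factorial * ε * B ^ N := by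
  have hε : 0 ≤ ε := (norm_nonneg _).trans (h k hk x)
  have ho : IsOpen ({0}ᶜ : Set E3) := isOpen_compl_singleton
  have hx : (x : E3) ∈ ({0}ᶜ : Set E3) := coe_ne_zero x
  have he : radialExt χ.1 =ᶠ[𝓝 (x : E3)] g ∘ fun y : E3 => ‖y‖⁻¹ • y := by
    filter_upwards [ho.mem_nhds hx] with y hy
    rw [radialExt, hχ, radial_of_ne hy]
    rfl
  have hs : ContDiffOn ℝ ∞ (fun y : E3 => ‖y‖⁻¹ • y) {0}ᶜ := fun y hy =>
    (((contDiffAt_norm ℝ hy).inv (norm_ne_zero_iff.mpr hy)).smul contDiffAt_id).contDiffWithinAt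
  have hx1 : ‖(x : E3)‖⁻¹ • (x : E3) = x := by simp
  have hm := norm_iteratedFDerivWithin_comp_le (n := k) (C := ε) (D := B) hg.contDiffOn hs
    (by exact_mod_cast le_top) uniqueDiffOn_univ ho.uniqueDiffOn (mapsTo_univ _ _) hx
    (fun i hi => by
      rw [hx1, iteratedFDerivWithin_univ]
      exact h i (hi.trans hk) x)
    (fun i h1 hi => by
      rw [iteratedFDerivWithin_of_isOpen _ ho hx]
      exact (hu i (hi.trans hk) x).trans (le_self_pow₀ hB (by omega)))
  rw [(he.iteratedFDeriv ℝ k).eq_of_nhds, ← iteratedFDerivWithin_of_isOpen _ ho hx]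
  refine hm.trans ?_
  gcongr

lemma IsDistribution.eq_zero_of_polyTest {T : TestFun →ₗ[ℂ] ℂ} (hT : IsDistribution T)
    (h : ∀ Q, T (polyTest Q) = 0) : T = 0 := by
  obtain ⟨N, K, hK⟩ := hT
  obtain ⟨B, hB, hu⟩ := exists_bound_iteratedFDeriv_unit N
  ext ψ
  obtain ⟨f, hf, hs, hfψ⟩ := exists_contDiff_extension ψ
  have hle : ∀ ε > 0, ‖T ψ‖ ≤ K * (N.factorial * ε * B ^ N) := by
    intro ε hε
    obtain ⟨R, hR⟩ := exists_polyFun_near hf hs N hε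
    have hT2 : T (polyTest R - ψ) = -T ψ := by rw [map_sub, h, zero_sub]
    rw [← norm_neg, ← hT2]
    refine hK _ _ fun k hk x => norm_iteratedFDeriv_radialExt_le
      (g := fun y => polyFun R y - f y) ((contDiff_polyFun R).sub hf) (fun x => ?_) hB hu hR hk x
    rw [hfψ]
    rfl
  -- Letting `ε` tend to zero makes the sign of `K` irrelevant.
  have hlim : Tendsto (fun ε : ℝ => K * (N.factorial * ε * B ^ N)) (𝓝[>] 0) (𝓝 0) := by
    have hc : Continuous fun ε : ℝ => K * (N.factorial * ε * B ^ N) := by fun_prop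
    have := hc.tendsto 0
    simp only [mul_zero, zero_mul] at this
    exact this.mono_left nhdsWithin_le_nhds
  have := ge_of_tendsto hlim (eventually_mem_nhdsWithin.mono hle)
  simpa using norm_le_zero_iff.mp this

/-! ### Uniqueness -/

lemma IsDistribution.sub {T S : TestFun →ₗ[ℂ] ℂ} (hT : IsDistribution T) (hS : IsDistribution S) :
    IsDistribution (T - S) := by
  obtain ⟨N, K, hK⟩ := hT
  obtain ⟨N', K', hK'⟩ := hS
  refine ⟨max N N', K + K', fun ψ M hM => ?_⟩
  have h1 := hK ψ M fun k hk => hM k (hk.trans (le_max_left _ _))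
  have h2 := hK' ψ M fun k hk => hM k (hk.trans (le_max_right _ _))
  calc _ ≤ ‖T ψ‖ + ‖S ψ‖ := norm_sub_le _ _
    _ ≤ (K + K') * M := by linarith

lemma IsSolution.hasDerivWithinAt {c D r H : ℝ} {v : ℝ → TestFun →ₗ[ℂ] ℂ}
    (hv : IsSolution c D r H v) (ψ : TestFun) {t : ℝ} (ht : t ∈ Ico 0 H) :
    HasDerivWithinAt (fun s => v s ψ) (derivWithin (fun s => v s ψ) (Ico 0 H) t) (Ico 0 H) t :=
  ((hv.contDiffOn ψ).differentiableOn (by simp) t ht).hasDerivWithinAt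

lemma IsSolution.hasDerivWithinAt_derivWithin {c D r H : ℝ} (hc : 0 < c) (hD : 0 < D) (hH : 0 < H)
    {v : ℝ → TestFun →ₗ[ℂ] ℂ} (hv : IsSolution c D r H v) (ψ : TestFun) {t : ℝ}
    (ht : t ∈ Ico 0 H) :
    HasDerivWithinAt (derivWithin (fun s => v s ψ) (Ico 0 H))
      (-((2 * order c D H - 1) / (H - t)) • derivWithin (fun s => v s ψ) (Ico 0 H) t +
        (c ^ 2 / r ^ 2) • v t (sphLaplacian ψ)) (Ico 0 H) t := by
  have hu : UniqueDiffOn ℝ (Ico 0 H) := uniqueDiffOn_Ico 0 H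
  have h1 := ((hv.contDiffOn ψ).differentiableOn_iteratedDerivWithin (m := 1) (by norm_num) hu t
    ht).hasDerivWithinAt
  have h2 := hv.equation ψ t ht
  rw [equation_coeff_eq hc.ne' hD.ne' ht.2 hH.ne'] at h2
  rw [← iteratedDerivWithin_succ, iteratedDerivWithin_one] at h1
  refine h1.congr_deriv ?_
  have hcc : (c : ℂ) ≠ 0 := by exact_mod_cast hc.ne'
  set p := (2 * order c D H - 1) / (H - t)
  simp only [Complex.real_smul]
  push_cast at h2 ⊢
  have h3 : (c : ℂ) ^ 2 * (1 / (c : ℂ) ^ 2) = 1 := by field_simp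
  linear_combination (c : ℂ) ^ 2 * h2 - h3 * (p * derivWithin (fun s => v s ψ) (Ico 0 H) t +
    iteratedDerivWithin 2 (fun s => v s ψ) (Ico 0 H) t)

/-- For `lam = 0` the energy does not control `y`. Hence only `y₁ = 0` is drawn from it, and then
`y` is constant. -/
lemma eq_zero_of_dampedWave {H lam : ℝ} (hlam : 0 ≤ lam) {y y₁ : ℝ → ℂ} {p : ℝ → ℝ}
    (hp : ∀ t ∈ Ico 0 H, 0 ≤ p t)
    (h1 : ∀ t ∈ Ico 0 H, HasDerivWithinAt y (y₁ t) (Ico 0 H) t)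
    (h2 : ∀ t ∈ Ico 0 H, HasDerivWithinAt y₁ (-(p t) • y₁ t - lam • y t) (Ico 0 H) t)
    (h0 : y 0 = 0) (h0' : y₁ 0 = 0) {t : ℝ} (ht : t ∈ Ico 0 H) : y t = 0 := by
  have hy₁ : ∀ s ∈ Ico 0 H, ‖y₁ s‖ ≤ 0 := by
    intro s hs
    have h := energy_le hp h1 h2 hs
    rw [h0, h0', norm_zero] at h
    have := mul_nonneg hlam (sq_nonneg ‖y s‖)
    nlinarith [norm_nonneg (y₁ s)]
  have h := (convex_Ico 0 H).norm_image_sub_le_of_norm_hasDerivWithin_le h1 hy₁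
    ⟨le_rfl, ht.1.trans_lt ht.2⟩ ht
  rw [h0, sub_zero, zero_mul] at h
  exact norm_le_zero_iff.mp h

/-- By induction on the degree the pairing with `ΔQ` contributes nothing. The pairing with `Q` then
satisfies a homogeneous damped oscillator equation with zero initial data. -/
lemma IsSolution.apply_polyTest_eq {c D r H : ℝ} (hc : 0 < c) (hD : 0 < D) (hH : 0 < H)
    {u v : ℝ → TestFun →ₗ[ℂ] ℂ} (hu : IsSolution c D r H u) (hv : IsSolution c D r H v) (n : ℕ) :
    ∀ Q : MvPolynomial (Fin 3) ℂ, Q.IsHomogeneous n → ∀ t ∈ Ico 0 H,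
      v t (polyTest Q) - u t (polyTest Q) = 0 := by
  induction n using Nat.strong_induction_on with
  | _ n ih =>
    intro Q hQ t ht
    have hL : ∀ s ∈ Ico 0 H,
        v s (polyTest (polyLaplacian Q)) - u s (polyTest (polyLaplacian Q)) = 0 := by
      intro s hs
      -- Truncated subtraction does not lower the degree when `n = 0`; for `n < 2` the Laplacian of
      -- `Q` is zero anyway.
      by_cases hn : n < 2
      · simp [polyLaplacian_eq_zero hQ hn]
      · exact ih (n - 1 - 1) (by omega) _ (isHomogeneous_polyLaplacian hQ) s hs
    refine eq_zero_of_dampedWave (lam := c ^ 2 / r ^ 2 * (n * (n + 1)))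
      (p := fun t => (2 * order c D H - 1) / (H - t)) (by positivity)
      (fun s hs => div_nonneg ?_ (sub_pos.mpr hs.2).le)
      (fun s hs => (hv.hasDerivWithinAt (polyTest Q) hs).sub (hu.hasDerivWithinAt (polyTest Q) hs))
      (fun s hs => ((hv.hasDerivWithinAt_derivWithin hc hD hH (polyTest Q) hs).sub
        (hu.hasDerivWithinAt_derivWithin hc hD hH (polyTest Q) hs)).congr_deriv ?_) ?_ ?_ ht
    · have : 0 ≤ c ^ 2 * H / (2 * D) := by positivity
      rw [order]
      linarith
    · have h := hL s hs
      simp only [Pi.sub_apply, sphLaplacian_polyTest hQ, map_sub, map_smul, Complex.real_smul, smul_eq_mul]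
      push_cast
      linear_combination ((c : ℂ) ^ 2 / (r : ℂ) ^ 2) * h
    · rw [Pi.sub_apply, hv.initial, hu.initial, sub_self]
    · rw [hv.initial_deriv, hu.initial_deriv, sub_self]

lemma IsSolution.eq {c D r H : ℝ} (hc : 0 < c) (hD : 0 < D) (hH : 0 < H)
    {u v : ℝ → TestFun →ₗ[ℂ] ℂ} (hu : IsSolution c D r H u) (hv : IsSolution c D r H v) {t : ℝ}
    (ht : t ∈ Ico 0 H) : v t = u t := by
  refine sub_eq_zero.mp (IsDistribution.eq_zero_of_polyTest
    ((hv.isDistribution t ht).sub (hu.isDistribution t ht)) fun Q => ?_)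
  rw [← Q.sum_homogeneousComponent, map_sum, map_sum]
  exact Finset.sum_eq_zero fun i _ => hu.apply_polyTest_eq hc hD hH hv i _
    (MvPolynomial.homogeneousComponent_isHomogeneous i Q) t ht

end SphDiffusion

end

theorem theorem1 (c D r ηinf : ℝ) (hc : 0 < c) (hD : 0 < D) (hr : 0 < r) (hη : 0 < ηinf) :
    ∃ u : ℝ → SphDiffusion.TestFun →ₗ[ℂ] ℂ,
      SphDiffusion.IsSolution c D r ηinf u ∧
      (∀ η ∈ Ico 0 ηinf, ∀ ψ : SphDiffusion.TestFun,
        HasSum (fun l : ℕ => (SphDiffusion.timeFactor c D r ηinf l η : ℂ) *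
          ∑ m ∈ Finset.Icc (-(l : ℤ)) (l : ℤ),
            conj (SphDiffusion.sphHarmonic l m 0 0) *
              SphDiffusion.pairing (SphDiffusion.sphHarmonic l m) ψ) (u η ψ)) ∧
      ∀ v : ℝ → SphDiffusion.TestFun →ₗ[ℂ] ℂ, SphDiffusion.IsSolution c D r ηinf v →
        ∀ η ∈ Ico 0 ηinf, v η = u η := by

  refine ⟨SphDiffusion.zonalSolution hc hD hr hη,
    SphDiffusion.isSolution_zonalSolution hc hD hr hη, fun η h ψ => ?_, fun v hv η h =>
    (SphDiffusion.isSolution_zonalSolution hc hD hr hη).eq hc hD hη hv h⟩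
  simp only [SphDiffusion.sum_harmonics_eq]
  exact SphDiffusion.hasSum_zonalSolution hc hD hr hη h ψ
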